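/- **Proposition (non-simple policies avoid exponential compounding error).** *Conventions.* A map $g:E\to F$ between Euclidean spaces is *$M$-smooth* if for every unit vector $v\in F$ the function $\langle v,g\rangle$ is $C^2$ with Hessian of operator norm $\le M$ everywhere (for $M=\infty$: $C^2$ only). *Regression.* Let $k\ge1$, let $\mathcal G$ be a set of functions $\mathbb R^k\to\mathbb R$ and $D_{\rm reg}$ a probability law on $\mathbb R^k$. The pair is *convex and $(1,L_0,M_0)$-regular* if $\mathcal G$ is convex, $\|z\|\le1$ for $D_{\rm reg}$-almost every $z$, and every $g\in\mathcal G$ is $L_0$-Lipschitz and $M_0$-smooth with $|g|\le1$ on the unit ball. Its noiseless minimax $L_2$-risk is $$\epsilon_m=\inf_{\hat g}\ \sup_{g\in\mathcal G}\ \mathbb E\Big[\Big(\int|\hat g(z)-g(z)|^2\,dD_{\rm reg}(z)\Big)^{1/2}\Big],$$ where $\hat g$ ranges over the measurable estimators based on $m$ i.i.d. points $z_i\sim D_{\rm reg}$ and the values $g(z_i)$. *The construction.* Let $d=k+2$ and $\tau,\Delta\in(0,1)$. Let $\mathrm{bump}$ be the radial $C^\infty$ function $\mathrm{bump}(z)=\sigma\big((4-\|z\|^2)/3\big)$,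 where $\sigma$ is the standard $C^\infty$ transition function ($0$ on $(-\infty,0]$, $1$ on $[1,\infty)$); thus $0\le \mathrm{bump}\le 1$, it equals $1$ exactly on the closed unit ball and $0$ exactly where $\|z\|\ge2$. With $\mu=\frac14$ put $$A_1=\begin{pmatrix}1+\mu&\frac32\mu\\-\frac32\mu&1-2\mu\end{pmatrix},\quad K_1=\begin{pmatrix}-(1+\mu)&-\frac32\mu\\ \frac32\mu&0\end{pmatrix},\quad A_2=\begin{pmatrix}-(1-\frac\mu4)&\frac32\mu\\0&1-2\mu\end{pmatrix},\quad K_2=\begin{pmatrix}1-\frac\mu4&-\frac32\mu\\0&0\end{pmatrix},$$ and let $\bar A_i,\bar K_i\in\mathbb R^{d\times d}$ be these matrices acting on the first two coordinates, all other entries being $0$. Let $x_{\rm off}=3e_3$, let $P:\mathbb R^d\to\mathbb R^k$ remove the first two coordinates, and let $r(x)=\mathrm{bump}(x-x_{\rm off})$ and $T_g(x)=g(P(x-x_{\rm off}))$. For $g\in\mathcal G$ and $\xi=(i,\omega)\in\{1,2\}\times\{-1,1\}$ define the deterministic expert and the dynamics $$\pi_{g,\xi}(x)=\bar K_ix+\tau\,r(x)T_g(x)\,e_1,$$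 $$f_{g,\xi}(x,u)=\bar A_ix+u-\tau\,r(x)T_g(x)\,e_1+\omega\tau^2\,r(x)\Big(T_g(x)-\frac{\langle e_1,u\rangle\,\mathrm{bump}(u)}{\tau}\Big)e_1,$$ and let $\mathcal I=\{(\pi_{g,\xi},f_{g,\xi})\}$. The law $D$ of the initial state is that of $x_{\rm off}+(0,0,z)$ with $z\sim D_{\rm reg}$, with probability $\frac12$, and that of $\Delta Yw$ with probability $\frac12$, where $Y$ and $w$ are independent, $\mathbb P[Y=1]=\frac12$, $\mathbb P[Y=2^{-j}]=\frac3{\pi^2j^2}$ for $j\ge1$, and $w$ is uniform on the unit ball of $e_1^\perp$. *Imitation learning.* A (possibly randomized) algorithm observes $n$ i.i.d. expert trajectories (states and inputs) of length $H$ with initial states drawn from $D$, and returns a policy, which in general selects $u_t$ at random given $x_1,\dots,x_t,u_1,\dots,u_{t-1}$. For a policy $\hat\pi$ and an instance $(\pi,f)$ let $(x^\star_t,u^\star_t)$ and $(x_t,u_t)$ be the trajectories of the expert $\pi$ and of $\hat\pi$ under $f$, started at the *same* $x_1\sim D$, and put $$R(\hat\pi;\pi,f)=\Big(\mathbb E\sum_{t=1}^H\min\{\|x^\star_t-x_t\|+\|u^\star_t-u_t\|,1\}^2\Big)^{1/2}.$$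 The minimax risk $\mathsf M^{\mathbb A}(n,H)$ of a class $\mathbb A$ of algorithms is the infimum over $\mathbb A$ of the supremum over $\mathcal I$ of the expectation of $R$ over the sample and the randomness of the algorithm. The classes are defined by the policies that are returned, on every sample and with probability one over the randomness of the algorithm: - $\mathbb A_{\rm simple}(L,M)$: Markovian time-invariant policies, with an $L$-Lipschitz and $M$-smooth mean $\mathrm{mean}[\hat\pi](x)$, for which the law of $u-\mathrm{mean}[\hat\pi](x)$, $u\sim\hat\pi(x)$, does not depend on $x$. - $\mathbb A_{\rm gen,smooth}(L,M,\alpha,p)$: Markovian time-invariant policies, with an $L$-Lipschitz and $M$-smooth mean, such that for all $x,x'$ there is a coupling $(u,u')$ of $\hat\pi(x),\hat\pi(x')$ for which, for every vector $v$, the variable $Z=\langle v,u-u'\rangle$ satisfies $\mathbb P\big[|Z-\mathbb EZ|\ge\alpha\,(\mathbb E|Z-\mathbb EZ|^2)^{1/2}\big]\ge p$. - $\mathbb A_{\rm chunk}(L,M,\ell)$: deterministic policies given by an $L$-Lipschitz and $M$-smooth map $x_{\ell h+1}\mapsto(u_{\ell h+1},\dots,u_{\ell h+\ell})$, executed in open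 loop, $h=0,1,\dots$ - $\mathbb A_{\rm period}(L,M,\ell)$: deterministic policies $u_t=\hat\pi(x_t,(t-1)\bmod\ell)$, with each $\hat\pi(\cdot,i)$, $0\le i<\ell$, being $L$-Lipschitz and $M$-smooth. *Claim.* There are universal constants $C<\infty$, $c>0$, $q\in(0,1)$, $\tau_0>0$ and thresholds $L_1,M_1<\infty$ that depend only on $(L_0,M_0)$, such that for every $k\ge1$ the following holds. For every convex $(1,L_0,M_0)$-regular $(\mathcal G,D_{\rm reg})$ on $\mathbb R^k$, all finite $L\ge L_1$ and $M\ge M_1$, all $\tau,\Delta\in(0,1)$ and all integers $n,H\ge0$, with $m=\lceil n/3\rceil$: - (a) for $\mathbb A=\mathbb A_{\rm simple}(L,\infty)$ (non-smooth means): $\ \mathsf M^{\mathbb A}(n,H)\le C\,(e^{-cn}+\epsilon_m)$; - (b) for $\mathbb A=\mathbb A_{\rm gen,smooth}(L,M,\frac14,\frac14)$: $\ \mathsf M^{\mathbb A}(n,H)\le C\,(e^{-cn}+\epsilon_m^{1-q})$; - (c) for $\mathbb A=\mathbb A_{\rm chunk}(L,M,3)$ and for $\mathbb A=\mathbb A_{\rm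 period}(L,M,3)$: $\ \mathsf M^{\mathbb A}(n,H)\le C\,(e^{-cn}+\epsilon_m)$, and if $\tau\le\tau_0$, then even $\mathsf M^{\mathbb A}(n,H)\le e^{-cn}+\epsilon_m$. In particular, for all $s\in\mathbb N$ and $B<\infty$ there is $C'=C'(k,s,B)$ such that, for those $(\mathcal G,D_{\rm reg})$ which also satisfy $\epsilon_m\le B\,m^{-s/k}$ for all $m\ge1$, all $n\ge1$ and all other parameters as before, the bounds (a), (b) and (c) (in its form with a constant) hold with $C$ replaced by $C'$ and $\epsilon_{\lceil n/3\rceil}$ replaced by $n^{-s/k}$. -/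

import Mathlib

open MeasureTheory ProbabilityTheory
open scoped ENNReal NNReal

noncomputable section

namespace CompoundingIL

/-! ## Smoothness of functions -/

/-- `g` is `M`-smooth: for every unit vector `v`, the scalar function `⟨v, g⟩` is twice continuously
differentiable with Hessian of operator norm at most `M`.  For `M = ∞` only the twice continuous
differentiability remains. -/
def IsSmoothWith {E F : Type} [NormedAddCommGroup E] [NormedSpace ℝ E]
    [NormedAddCommGroup F] [InnerProductSpace ℝ F] (M : ℝ≥0∞) (g : E → F) : Prop :=
  ∀ v : F, ‖v‖ = 1 → ContDiff ℝ 2 (fun x => inner ℝ v (g x)) ∧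
    ∀ x, ‖iteratedFDeriv ℝ 2 (fun x => inner ℝ v (g x)) x‖ₑ ≤ M

/-! ## Policies, trajectories and imitation learning algorithms

Time is indexed from `0`: index `t` is the time step `t + 1` of the usual convention. -/

section Imitation

variable (X U : Type) [MeasurableSpace X] [MeasurableSpace U]

/-- What a policy may depend on when it selects the input at time `t`:
the states up to time `t` and the earlier inputs. -/
abbrev Hist (t : ℕ) : Type := (Fin (t + 1) → X) × (Fin t → U)

/-- A (stochastic, history and time dependent) policy. -/
structure HistPolicy where
  kernel : ∀ t : ℕ, Kernel (Hist X U t) U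
  isMarkov : ∀ t, IsMarkovKernel (kernel t)

/-- A sample: `n` trajectories of states and inputs, of length `H`. -/
abbrev Sample (n H : ℕ) : Type := Fin n → Fin H → X × U

/-- A possibly randomized imitation learning algorithm.  It draws a random seed, and returns a policy
that depends (measurably) on the sample and on the seed. -/
structure ILAlg (n H : ℕ) where
  Seed : Type
  [measurableSeed : MeasurableSpace Seed]
  seedLaw : Measure Seed
  isProb : IsProbabilityMeasure seedLaw
  kernel : ∀ t : ℕ, Kernel ((Sample X U n H × Seed) × Hist X U t) U
  isMarkov : ∀ t, IsMarkovKernel (kernel t)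

attribute [instance] ILAlg.measurableSeed

variable {X U}

/-- The policy returned by the algorithm on the sample `S` with the seed `ω`. -/
def ILAlg.policy {n H : ℕ} (alg : ILAlg X U n H) (S : Sample X U n H) (ω : alg.Seed) :
    HistPolicy X U where
  kernel t := Kernel.sectR (alg.kernel t) (S, ω)
  isMarkov t := by
    have := alg.isMarkov t
    infer_instance

/-- Closed-loop states of a deterministic expert started at `x`. -/
def expertState (π : X → U) (f : X → U → X) (x : X) : ℕ → X
  | 0 => x
  | t + 1 => f (expertState π f x t) (π (expertState π f x t))

/-- The expert trajectory of length `H` started at `x`. -/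
def expertTraj (π : X → U) (f : X → U → X) (H : ℕ) (x : X) : Fin H → X × U :=
  fun t => (expertState π f x t, π (expertState π f x t))

/-- The law of a sample of `n` independent expert trajectories. -/
def sampleLaw (π : X → U) (f : X → U → X) (D : Measure X) (n H : ℕ) :
    Measure (Sample X U n H) :=
  Measure.pi fun _ : Fin n => D.map (expertTraj π f H)

/-- The law of the states `x₀, …, x_t` and the inputs `u₀, …, u_{t-1}` when `x₀ ∼ D`, the inputs are
drawn from the policy (with fresh randomness at each step), and `x_{s+1} = f x_s u_s`. -/
def trajLaw (P : HistPolicy X U) (f : X → U → X) (D : Measure X) :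
    (t : ℕ) → Measure (Hist X U t)
  | 0 => D.map fun x => (fun _ => x, Fin.elim0)
  | t + 1 => ((trajLaw P f D t) ⊗ₘ (P.kernel t)).map fun q =>
      (Fin.snoc (α := fun _ => X) q.1.1 (f (q.1.1 (Fin.last t)) q.2),
        Fin.snoc (α := fun _ => U) q.1.2 q.2)

/-- The minimax risk of the class `A` of algorithms for the risk `R` on the problem family `(I, D)`,
with `n` trajectories of horizon `H`. -/
def minimaxRisk {n H : ℕ} (A : Set (ILAlg X U n H))
    (R : HistPolicy X U → (X → U) → (X → U → X) → Measure X → ℕ → ℝ≥0∞)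
    (I : Set ((X → U) × (X → U → X))) (D : Measure X) : ℝ≥0∞ :=
  ⨅ alg ∈ A, ⨆ p ∈ I,
    ∫⁻ S, ∫⁻ ω, R (alg.policy S ω) p.1 p.2 D H ∂alg.seedLaw ∂(sampleLaw p.1 p.2 D n H)

/-- The class of algorithms which, on every sample and with probability one over their own
randomness, return a policy with the property `Q`. -/
def algClass (n H : ℕ) (Q : HistPolicy X U → Prop) : Set (ILAlg X U n H) :=
  {alg | ∀ S, ∀ᵐ ω ∂alg.seedLaw, Q (alg.policy S ω)}

/-- `P` is the time-invariant, Markovian policy `π`. -/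
def HistPolicy.IsStatic (P : HistPolicy X U) (π : Kernel X U) : Prop :=
  ∀ t h, P.kernel t h = π (h.1 (Fin.last t))

end Imitation

section Classes

variable {X U : Type} [NormedAddCommGroup X] [InnerProductSpace ℝ X] [MeasurableSpace X]
  [NormedAddCommGroup U] [InnerProductSpace ℝ U] [MeasurableSpace U]

/-- The `L_p`-trajectory risk.  Under the canonical coupling, the expert trajectory and the imitator
trajectory start at the same initial state `h.1 0`; the expert is deterministic, so that its
trajectory is a function of that state. -/
def trajRisk (p : ℝ) (P : HistPolicy X U) (π : X → U) (f : X → U → X) (D : Measure X) (H : ℕ) :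
    ℝ≥0∞ :=
  (∫⁻ h, ∑ t : Fin H,
    (min (‖expertState π f (h.1 0) t - h.1 t.castSucc‖ₑ
      + ‖π (expertState π f (h.1 0) t) - h.2 t‖ₑ) 1) ^ p ∂(trajLaw P f D H)) ^ (1 / p)

/-- The mean of a stochastic policy. -/
def policyMean (π : Kernel X U) (x : X) : U := ∫ u, u ∂(π x)

/-- `π` has a well-defined mean, which is `L`-Lipschitz and `M`-smooth. -/
def HasSmoothMean (π : Kernel X U) (L : ℝ≥0) (M : ℝ≥0∞) : Prop :=
  (∀ x, Integrable (fun u => u) (π x)) ∧ LipschitzWith L (policyMean π) ∧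
    IsSmoothWith M (policyMean π)

/-- The law of the deviation from the mean does not depend on the state. -/
def IsSimplyStochastic (π : Kernel X U) : Prop :=
  ∀ x x', (π x).map (fun u => u - policyMean π x) = (π x').map (fun u => u - policyMean π x')

/-- The scalar law `ν` is `(α, p)`-anti-concentrated: a variable `Z ∼ ν` satisfies
`ℙ[|Z - 𝔼 Z| ≥ α (𝔼 |Z - 𝔼 Z|²)^{1/2}] ≥ p`. -/
def IsAntiConcentratedLaw (ν : Measure ℝ) (α p : ℝ) : Prop :=
  ENNReal.ofReal p ≤
    ν {z | ENNReal.ofReal α * eLpNorm (fun y => y - ∫ w, w ∂ν) 2 ν ≤ ‖z - ∫ w, w ∂ν‖ₑ}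

/-- Any two action distributions of `π` have a coupling `(u, u')` such that every one-dimensional
marginal of `u - u'` is `(α, p)`-anti-concentrated. -/
def IsAntiConcentrated (π : Kernel X U) (α p : ℝ) : Prop :=
  ∀ x x', ∃ γ : Measure (U × U), γ.map Prod.fst = π x ∧ γ.map Prod.snd = π x' ∧
    ∀ v : U, IsAntiConcentratedLaw (γ.map fun q => inner ℝ v (q.1 - q.2)) α p

/-- `(L, M)`-simple algorithms. -/
def simpleAlgs (n H : ℕ) (L : ℝ≥0) (M : ℝ≥0∞) : Set (ILAlg X U n H) :=
  algClass n H fun P => ∃ π : Kernel X U, P.IsStatic π ∧ HasSmoothMean π L M ∧ IsSimplyStochastic π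

/-- Algorithms returning generalized smooth policies: Markovian, with an `L`-Lipschitz and `M`-smooth
mean, and `(α, p)`-anti-concentrated. -/
def genSmoothAlgs (n H : ℕ) (L : ℝ≥0) (M : ℝ≥0∞) (α p : ℝ) : Set (ILAlg X U n H) :=
  algClass n H fun P => ∃ π : Kernel X U, P.IsStatic π ∧ HasSmoothMean π L M ∧
    IsAntiConcentrated π α p

/-- Algorithms returning deterministic `ℓ`-periodic policies, each of whose `ℓ` components is
`L`-Lipschitz and `M`-smooth. -/
def periodAlgs (n H : ℕ) (L : ℝ≥0) (M : ℝ≥0∞) (ℓ : ℕ) [NeZero ℓ] : Set (ILAlg X U n H) :=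
  algClass n H fun P => ∃ π : Fin ℓ → X → U,
    (∀ i, LipschitzWith L (π i) ∧ IsSmoothWith M (π i)) ∧
    ∀ t h, P.kernel t h = Measure.dirac (π (Fin.ofNat ℓ t) (h.1 (Fin.last t)))

/-- Algorithms returning deterministic `ℓ`-chunked policies: at the times `t = ℓ m` the next `ℓ`
inputs are selected as an `L`-Lipschitz and `M`-smooth function of the state at that time, and are
then executed in open loop. -/
def chunkAlgs (n H : ℕ) (L : ℝ≥0) (M : ℝ≥0∞) (ℓ : ℕ) [NeZero ℓ] : Set (ILAlg X U n H) :=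
  algClass n H fun P => ∃ F : X → PiLp 2 (fun _ : Fin ℓ => U),
    LipschitzWith L F ∧ IsSmoothWith M F ∧
    ∀ t h, P.kernel t h = Measure.dirac
      (F (h.1 ⟨ℓ * (t / ℓ), Nat.lt_succ_of_le (Nat.mul_div_le t ℓ)⟩) (Fin.ofNat ℓ t))

end Classes

/-! ## Regression problems -/

/-- The space of the regression covariates, `ℝᵏ`. -/
abbrev Cov (k : ℕ) : Type := EuclideanSpace ℝ (Fin k)

/-- A regression algorithm maps `n` labelled points to a function, in a jointly measurable way. -/
abbrev RegAlg (k n : ℕ) : Type :=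
  {a : (Fin n → Cov k × ℝ) → Cov k → ℝ // Measurable (Function.uncurry a)}

/-- The minimax `L₂`-risk of noiseless regression with `n` samples over the class `G`. -/
def regMinimax {k : ℕ} (n : ℕ) (G : Set (Cov k → ℝ)) (D : Measure (Cov k)) : ℝ≥0∞ :=
  ⨅ a : RegAlg k n, ⨆ g ∈ G,
    ∫⁻ s, (∫⁻ z, ‖a.1 (fun i => (s i, g (s i))) z - g z‖ₑ ^ 2 ∂D) ^ (1 / 2 : ℝ)
      ∂(Measure.pi fun _ : Fin n => D)

/-- `(G, D)` is `(R, L, M)`-regular (with `G` convex). -/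
structure IsRegularReg {k : ℕ} (G : Set (Cov k → ℝ)) (D : Measure (Cov k))
    (R : ℝ) (L M : ℝ≥0) : Prop where
  support_bound : ∀ᵐ z ∂D, ‖z‖ ≤ R
  bound : ∀ g ∈ G, ∀ z, ‖z‖ ≤ R → |g z| ≤ R
  lipschitz : ∀ g ∈ G, LipschitzWith L g
  smooth : ∀ g ∈ G, IsSmoothWith (M : ℝ≥0∞) g
  convex : Convex ℝ G

/-! ## The embedding construction -/

/-- A radial smooth bump function, which equals `1` exactly on the closed unit ball and vanishes
exactly outside the open ball of radius `2`. -/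
def bump {E : Type} [NormedAddCommGroup E] (z : E) : ℝ :=
  Real.smoothTransition ((4 - ‖z‖ ^ 2) / 3)

theorem bump_eq_one_iff {E : Type} [NormedAddCommGroup E] (z : E) : bump z = 1 ↔ ‖z‖ ≤ 1 := by
  rw [bump, Real.smoothTransition.eq_one_iff_one_le]
  constructor <;> intro h <;> nlinarith [norm_nonneg z]

theorem bump_eq_zero_iff {E : Type} [NormedAddCommGroup E] (z : E) : bump z = 0 ↔ 2 ≤ ‖z‖ := by
  rw [bump, Real.smoothTransition.zero_iff_nonpos]
  constructor <;> intro h <;> nlinarith [norm_nonneg z]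

theorem contDiff_bump {E : Type} [NormedAddCommGroup E] [InnerProductSpace ℝ E] {n : ℕ∞} :
    ContDiff ℝ n (bump : E → ℝ) :=
  Real.smoothTransition.contDiff.comp ((contDiff_const.sub (contDiff_norm_sq ℝ)).div_const 3)

/-- The state and input space `ℝᵈ`, `d = k + 2`: the coordinates `1, 2` of the usual numbering are
`Sum.inl 0, Sum.inl 1`, and the coordinates `3, …, d` are `Sum.inr 0, …, Sum.inr (k - 1)`. -/
abbrev St (k : ℕ) : Type := EuclideanSpace ℝ (Fin 2 ⊕ Fin k)

/-- The open-loop matrices of the challenging pair with parameter `μ`. -/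
def chalA (μ : ℝ) : Fin 2 → Matrix (Fin 2) (Fin 2) ℝ :=
  ![!![1 + μ, 3 / 2 * μ; -(3 / 2 * μ), 1 - 2 * μ],
    !![-(1 - μ / 4), 3 / 2 * μ; 0, 1 - 2 * μ]]

/-- The gain matrices of the challenging pair with parameter `μ`. -/
def chalK (μ : ℝ) : Fin 2 → Matrix (Fin 2) (Fin 2) ℝ :=
  ![!![-(1 + μ), -(3 / 2 * μ); 3 / 2 * μ, 0],
    !![1 - μ / 4, -(3 / 2 * μ); 0, 0]]

/-- A `2 × 2` matrix acting on the first two coordinates. -/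
def embMat {k : ℕ} (B : Matrix (Fin 2) (Fin 2) ℝ) (x : St k) : St k :=
  Matrix.toEuclideanLin (Matrix.fromBlocks B 0 0 (0 : Matrix (Fin k) (Fin k) ℝ)) x

/-- The first canonical basis vector. -/
def e₁ {k : ℕ} : St k := EuclideanSpace.single (Sum.inl 0) 1

/-- The offset `3 e₃`. -/
def xOffset {k : ℕ} [NeZero k] : St k := EuclideanSpace.single (Sum.inr 0) 3

/-- Removes the first two coordinates. -/
def projTail {k : ℕ} (x : St k) : Cov k := WithLp.toLp 2 fun j => x (Sum.inr j)

/-- `z ↦ (0, 0, z)`. -/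
def embTail {k : ℕ} (z : Cov k) : St k := WithLp.toLp 2 (Sum.elim 0 z)

/-- `restrict(x) · 𝒯[g](x)`. -/
def localized {k : ℕ} [NeZero k] (g : Cov k → ℝ) (x : St k) : ℝ :=
  bump (x - xOffset) * g (projTail (x - xOffset))

/-- The expert policy `π_{g,ξ}`, `ξ = (i, ω)`; it does not depend on `ω`. -/
def expertPolicy {k : ℕ} [NeZero k] (τ : ℝ) (g : Cov k → ℝ) (i : Fin 2) (x : St k) : St k :=
  embMat (chalK (1 / 4) i) x + (τ * localized g x) • e₁

/-- The dynamics `f_{g,ξ}`, `ξ = (i, ω)`. -/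
def dynamics {k : ℕ} [NeZero k] (τ : ℝ) (g : Cov k → ℝ) (i : Fin 2) (ω : ℝ) (x u : St k) : St k :=
  embMat (chalA (1 / 4) i) x + u - (τ * localized g x) • e₁
    + (ω * τ ^ 2 * bump (x - xOffset) *
        (g (projTail (x - xOffset)) - inner ℝ e₁ u * bump u / τ)) • e₁

/-- The instance class `{(π_{g,ξ}, f_{g,ξ}) : g ∈ G, ξ ∈ {1, 2} × {-1, 1}}`. -/
def instances {k : ℕ} [NeZero k] (G : Set (Cov k → ℝ)) (τ : ℝ) :
    Set ((St k → St k) × (St k → St k → St k)) :=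
  {p | ∃ g ∈ G, ∃ i : Fin 2, ∃ ω ∈ ({-1, 1} : Set ℝ), p = (expertPolicy τ g i, dynamics τ g i ω)}

/-- The law of the variable `Y`: `ℙ[Y = 1] = 1/2`, and `ℙ[Y = 2⁻ʲ] = 3 / (π² j²)`, `j ≥ 1`. -/
def lawY : Measure ℝ :=
  (1 / 2 : ℝ≥0∞) • Measure.dirac 1 +
    Measure.sum fun j : ℕ =>
      ENNReal.ofReal (3 / (Real.pi ^ 2 * ((j : ℝ) + 1) ^ 2)) • Measure.dirac ((1 / 2 : ℝ) ^ (j + 1))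

/-- The space of the coordinates `2, …, d`. -/
abbrev Perp (k : ℕ) : Type := EuclideanSpace ℝ {i : Fin 2 ⊕ Fin k // i ≠ Sum.inl 0}

/-- Extends a vector of coordinates `2, …, d` by zero. -/
def embPerp {k : ℕ} (w : Perp k) : St k :=
  WithLp.toLp 2 fun i => if h : i ≠ Sum.inl 0 then w ⟨i, h⟩ else 0

/-- The uniform distribution on the unit ball of the coordinates `2, …, d`. -/
def unifPerp (k : ℕ) : Measure (Perp k) := cond volume (Metric.closedBall 0 1)

/-- The law of the initial state: with probability `1/2` (the case `Z = 0`) it is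
`x_offset + (0, 0, z)` with `z ∼ D`, and with probability `1/2` (the case `Z = 1`) it is `Δ Y w`. -/
def initLaw {k : ℕ} [NeZero k] (D : Measure (Cov k)) (Δ : ℝ) : Measure (St k) :=
  (1 / 2 : ℝ≥0∞) • D.map (fun z => xOffset + embTail z) +
    (1 / 2 : ℝ≥0∞) • (lawY.prod (unifPerp k)).map (fun q => (Δ * q.1) • embPerp q.2)

/-- The minimax `L₂`-trajectory risk of a class of algorithms on the embedding construction. -/
def trajMinimax {k : ℕ} [NeZero k] {n H : ℕ} (A : Set (ILAlg (St k) (St k) n H))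
    (G : Set (Cov k → ℝ)) (D : Measure (Cov k)) (τ Δ : ℝ) : ℝ≥0∞ :=
  minimaxRisk A (trajRisk 2) (instances G τ) (initLaw D Δ)

end CompoundingIL

end

open CompoundingIL

/-!
The experts `π_{g,ξ}` differ in the matrices `K_i` only off the hyperplane `x₁ = 0`, and the data
never leave this hyperplane: trajectories from near the origin stay in it, and trajectories from the
offset reach the origin after one step. So nothing is learnt about `ξ`, and the only information on
`g` are the labels `τ g(z)` in the trajectories that start at the offset. If at least a third of the
`n` trajectories are of this kind, which fails with probability at most `exp (-c n)` by a Chernoff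
bound (`measure_card_heads_lt_le`), then a regression algorithm for `⌈n / 3⌉` points can be run on
them.

A regression estimate need not be a smooth function. It is therefore replaced by a nearly closest
member of a dense sequence of regular functions (`exists_dense_seq`, `exists_measurable_selector`),
which costs a factor `2` and an arbitrarily small error. This reduces all the bounds to a
deterministic question, `trajMinimax_le_of_policies`: given regular functions `y` and `g`, build
from `y` alone a policy whose risk on the instances of `g` is of the order of
`‖y - g‖_{L₂} ^ θ`. Such a policy plays the input `-3/8 x₂ e₁` of both experts where `x₁ = 0`, and
`τ y e₁` at the offset. One step after the offset it is in the plane of the first two coordinates,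
at the point `τ (1 - ω τ) (y(z) - g(z)) e₁`, and it has to bring this point back to the origin for
both dynamics `i = 1, 2` at once. No deterministic linear stationary feedback with the given
behaviour on `x₁ = 0` stabilizes both dynamics, but policies of the classes in question can do so.

* A periodic policy knows the time. One step of the period has the gain that removes `x₁` for the
  first dynamics, another step has the gain for the second one, and once `x₁ = 0`, the second
  coordinate decays (`trajRisk_periodPolicy_le`). Similarly, there are three open-loop inputs,
  linear in the state, that steer `x₁` to zero for both dynamics (`trajRisk_chunkPolicy_le`).
* A stationary nonsmooth policy uses the second coordinate as a memory. It writes a multiple of `x₁`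
  into `x₂` at each step, and the size of `x₂` relative to `x₁` tells which of the two gains is
  to be played next. The change between them is a function of `x₂ / x₁`, regularized at a scale `δ`;
  it is Lipschitz uniformly in `δ`, but its second derivative blows up as `δ → 0`
  (`trajRisk_switchPolicy_le`).
* A stochastic policy tosses a coin to decide between the two gains (`coinFeedback`). In each step
  `x₁` is multiplied by `0` or by `± 35/16`, with equal probabilities. This is not contracting in
  mean square, but the expectation of `√|x₁|` is multiplied by `√(35/16) / 2 < 1`. So a potential
  built from square roots decreases by more than the cost of a step (`coin_potential_decrease`), and
  the expected squared cost is of the order of `√|y(z) - g(z)|`, which leads to the exponent `1/4`.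

The policies are smooth because localized regular functions are (`exists_localized_bound`). In the
first and second case the risk is linear in `τ`, so that the constant is `1` for small `τ`.
-/

namespace CompoundingIL

/-! ### Trajectories of history-dependent policies -/

section Trajectories

variable {X U : Type}

/-- The history that consists of the initial state only. -/
def initHist (x : X) : Hist X U 0 := (fun _ => x, Fin.elim0)

/-- Extends a history by the input `u` and the state that it leads to. -/
def stepHist (f : X → U → X) {t : ℕ} (h : Hist X U t) (u : U) : Hist X U (t + 1) :=
  (Fin.snoc (α := fun _ => X) h.1 (f (h.1 (Fin.last t)) u), Fin.snoc (α := fun _ => U) h.2 u)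

/-- The history up to time `t` of given sequences of states and inputs. -/
def seqHist (xs : ℕ → X) (us : ℕ → U) (t : ℕ) : Hist X U t := (fun s => xs s, fun s => us s)

theorem seqHist_zero (xs : ℕ → X) (us : ℕ → U) : seqHist xs us 0 = initHist (xs 0) := by
  ext s
  · simp [seqHist, initHist]
  · exact s.elim0

theorem stepHist_seqHist (f : X → U → X) (xs : ℕ → X) (us : ℕ → U) (t : ℕ)
    (h : xs (t + 1) = f (xs t) (us t)) :
    stepHist f (seqHist xs us t) (us t) = seqHist xs us (t + 1) := by
  ext s
  · refine Fin.lastCases ?_ (fun s => ?_) s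
    · simp [stepHist, seqHist, h]
    · simp [stepHist, seqHist]
  · refine Fin.lastCases ?_ (fun s => ?_) s
    · simp [stepHist, seqHist]
    · simp [stepHist, seqHist]

theorem stepHist_fst_zero (f : X → U → X) {t : ℕ} (h : Hist X U t) (u : U) :
    (stepHist f h u).1 0 = h.1 0 := by
  exact Fin.snoc_castSucc (α := fun _ => X) (f (h.1 (Fin.last t)) u) h.1 (0 : Fin (t + 1))

theorem stepHist_fst_last (f : X → U → X) {t : ℕ} (h : Hist X U t) (u : U) :
    (stepHist f h u).1 (Fin.last (t + 1)) = f (h.1 (Fin.last t)) u := by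
  simp [stepHist]

variable [MeasurableSpace X] [MeasurableSpace U]

theorem measurable_snoc {α β : Type} [MeasurableSpace α] [MeasurableSpace β] {n : ℕ}
    {a : β → Fin n → α} {b : β → α} (ha : Measurable a) (hb : Measurable b) :
    Measurable fun q => (Fin.snoc (α := fun _ => α) (a q) (b q) : Fin (n + 1) → α) := by
  refine measurable_pi_lambda _ fun s => ?_
  refine Fin.lastCases ?_ (fun s => ?_) s
  · simpa using hb
  · simpa using measurable_pi_iff.1 ha s

theorem measurable_stepHist {f : X → U → X} (hf : Measurable (Function.uncurry f)) (t : ℕ) :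
    Measurable fun q : Hist X U t × U => stepHist f q.1 q.2 := by
  refine Measurable.prodMk (measurable_snoc (by fun_prop) ?_) (measurable_snoc (by fun_prop)
    measurable_snd)
  have : Measurable fun q : Hist X U t × U => (q.1.1 (Fin.last t), q.2) := by fun_prop
  exact hf.comp this

theorem measurable_initHist : Measurable (initHist : X → Hist X U 0) :=
  Measurable.prodMk (by fun_prop) measurable_const

/-- The expectation of `F` of the history at time `t`, for the policy `P` started at `x`. -/
noncomputable def startExp (P : HistPolicy X U) (f : X → U → X) :
    (t : ℕ) → (Hist X U t → ℝ≥0∞) → X → ℝ≥0∞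
  | 0, F, x => F (initHist x)
  | t + 1, F, x => startExp P f t (fun h => ∫⁻ u, F (stepHist f h u) ∂(P.kernel t h)) x

theorem lintegral_trajLaw (P : HistPolicy X U) {f : X → U → X}
    (hf : Measurable (Function.uncurry f)) (D : Measure X) [IsProbabilityMeasure D] (t : ℕ) :
    IsProbabilityMeasure (trajLaw P f D t) ∧ ∀ F : Hist X U t → ℝ≥0∞, Measurable F →
      ∫⁻ h, F h ∂(trajLaw P f D t) = ∫⁻ x, startExp P f t F x ∂D := by
  induction t with
  | zero =>
    refine ⟨Measure.isProbabilityMeasure_map measurable_initHist.aemeasurable, fun F hF => ?_⟩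
    exact lintegral_map hF measurable_initHist
  | succ t ih =>
    obtain ⟨ih₁, ih₂⟩ := ih
    have := P.isMarkov t
    have hm : Measurable fun q : Hist X U t × U => stepHist f q.1 q.2 := measurable_stepHist hf t
    refine ⟨Measure.isProbabilityMeasure_map hm.aemeasurable, fun F hF => ?_⟩
    have hF' : Measurable fun q : Hist X U t × U => F (stepHist f q.1 q.2) := hF.comp hm
    calc ∫⁻ h, F h ∂(trajLaw P f D (t + 1))
        = ∫⁻ q, F (stepHist f q.1 q.2) ∂(trajLaw P f D t ⊗ₘ P.kernel t) := lintegral_map hF hm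
      _ = ∫⁻ h, ∫⁻ u, F (stepHist f h u) ∂(P.kernel t h) ∂(trajLaw P f D t) :=
          Measure.lintegral_compProd hF'
      _ = _ := ih₂ _ hF'.lintegral_kernel_prod_right'

/-- Along sequences of states and inputs that the policy follows with probability one, the
expectation is an evaluation. -/
theorem startExp_eq_of_dirac (P : HistPolicy X U) (f : X → U → X) (xs : ℕ → X) (us : ℕ → U)
    (hx : ∀ t, xs (t + 1) = f (xs t) (us t))
    (hP : ∀ t, P.kernel t (seqHist xs us t) = Measure.dirac (us t)) (t : ℕ)
    {F : Hist X U t → ℝ≥0∞} (hF : Measurable F) (hf : Measurable (Function.uncurry f)) :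
    startExp P f t F (xs 0) = F (seqHist xs us t) := by
  induction t with
  | zero => rw [seqHist_zero]; rfl
  | succ t ih =>
    have := P.isMarkov t
    have hF' : Measurable fun q : Hist X U t × U => F (stepHist f q.1 q.2) :=
      hF.comp (measurable_stepHist hf t)
    rw [startExp, ih hF'.lintegral_kernel_prod_right', hP, lintegral_dirac',
      stepHist_seqHist f xs us t (hx t)]
    exact hF'.comp (by fun_prop : Measurable fun u : U => (seqHist xs us t, u))

end Trajectories

/-! ### Algorithms that select from a sequence of policies -/

section Selection

variable {X U : Type} [MeasurableSpace X] [MeasurableSpace U]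

/-- The deterministic algorithm that returns the policy `P (J S)` on the sample `S`. -/
noncomputable def selectAlg {n H : ℕ} (P : ℕ → HistPolicy X U) (J : Sample X U n H → ℕ)
    (hJ : Measurable J) : ILAlg X U n H where
  Seed := Unit
  seedLaw := Measure.dirac ()
  isProb := inferInstance
  kernel t :=
    { toFun := fun q => (P (J q.1.1)).kernel t q.2
      measurable' := by
        have h : Measurable fun q : ℕ × Hist X U t => (P q.1).kernel t q.2 :=
          measurable_from_prod_countable_right fun j => ((P j).kernel t).measurable
        exact h.comp (by fun_prop : Measurable fun q : (Sample X U n H × Unit) × Hist X U t =>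
          (J q.1.1, q.2)) }
  isMarkov t := ⟨fun q => by
    have := (P (J q.1.1)).isMarkov t
    exact inferInstanceAs (IsProbabilityMeasure ((P (J q.1.1)).kernel t q.2))⟩

theorem HistPolicy.ext_kernel {P P' : HistPolicy X U} (h : P.kernel = P'.kernel) : P = P' := by
  cases P; cases P'; cases h; rfl

theorem selectAlg_policy {n H : ℕ} (P : ℕ → HistPolicy X U) (J : Sample X U n H → ℕ)
    (hJ : Measurable J) (S : Sample X U n H) (ω : (selectAlg P J hJ).Seed) :
    (selectAlg P J hJ).policy S ω = P (J S) := by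
  refine HistPolicy.ext_kernel ?_
  funext t
  ext a s hs
  rfl

/-- The minimax risk is at most that of the algorithm that selects from a sequence of policies. -/
theorem minimaxRisk_le_of_select {n H : ℕ} {Q : HistPolicy X U → Prop}
    (R : HistPolicy X U → (X → U) → (X → U → X) → Measure X → ℕ → ℝ≥0∞)
    (I : Set ((X → U) × (X → U → X))) (D : Measure X)
    (P : ℕ → HistPolicy X U) (hQ : ∀ j, Q (P j)) (J : Sample X U n H → ℕ) (hJ : Measurable J)
    (B : ℝ≥0∞)
    (hB : ∀ p ∈ I, ∫⁻ S, R (P (J S)) p.1 p.2 D H ∂(sampleLaw p.1 p.2 D n H) ≤ B) :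
    minimaxRisk (algClass n H Q) R I D ≤ B := by
  refine iInf₂_le_of_le (selectAlg P J hJ) ?_ (iSup₂_le fun p hp => ?_)
  · intro S
    refine Filter.Eventually.of_forall fun ω => ?_
    rw [selectAlg_policy]
    exact hQ _
  · refine le_trans (le_of_eq ?_) (hB p hp)
    refine lintegral_congr fun S => ?_
    simp_rw [selectAlg_policy]
    change ∫⁻ _ : Unit, _ ∂(Measure.dirac ()) = _
    simp

end Selection

/-! ### Samples from a mixture of two laws -/

section Mixture

/-- The law of a fair coin. -/
noncomputable def coin : Measure Bool :=
  (1 / 2 : ℝ≥0∞) • Measure.dirac true + (1 / 2 : ℝ≥0∞) • Measure.dirac false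

instance : IsProbabilityMeasure coin := ⟨by simp [coin, ENNReal.inv_two_add_inv_two]⟩

theorem lintegral_coin (f : Bool → ℝ≥0∞) :
    ∫⁻ c, f c ∂coin = (1 / 2 : ℝ≥0∞) * f true + (1 / 2 : ℝ≥0∞) * f false := by
  simp [coin, lintegral_add_measure, lintegral_smul_measure]

theorem integral_coin (f : Bool → ℝ) : ∫ c, f c ∂coin = f true / 2 + f false / 2 := by
  have h (b : Bool) : Integrable f ((1 / 2 : ℝ≥0∞) • Measure.dirac b) :=
    (Integrable.of_finite (μ := Measure.dirac b)).smul_measure (by simp)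
  rw [coin, integral_add_measure (h true) (h false), integral_smul_measure, integral_smul_measure]
  simp
  ring

/-- The indices of the coins that show `true`. -/
def heads {n : ℕ} (c : Fin n → Bool) : Finset (Fin n) := Finset.univ.filter fun l => c l = true

/-- The exponential rate at which the fraction of heads among fair coins concentrates above
`1/3`. -/
noncomputable def headsRate : ℝ := -Real.log (189 / 200)

theorem headsRate_pos : 0 < headsRate := by
  have := Real.log_neg (by norm_num : (0 : ℝ) < 189 / 200) (by norm_num)
  unfold headsRate
  linarith

theorem exp_neg_headsRate_mul (n : ℕ) : Real.exp (-(headsRate * n)) = (189 / 200 : ℝ) ^ n := by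
  rw [headsRate, neg_mul, neg_neg, mul_comm, Real.exp_nat_mul, Real.exp_log (by norm_num)]

/-- A Chernoff bound. The weights `16/25` for heads and `5/4` for tails have the mean `189/200`, and
`16/25 * (5/4) ^ 2 = 1`, so that the product of the weights is at least `1` if there are at least
twice as many tails as heads. -/
theorem measure_card_heads_lt_le (n : ℕ) :
    Measure.pi (fun _ : Fin n => coin) {c | (heads c).card < ⌈(n : ℝ) / 3⌉₊}
      ≤ ENNReal.ofReal (Real.exp (-(headsRate * n))) := by
  set w : Bool → ℝ := fun b => if b then 16 / 25 else 5 / 4 with hw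
  have hw0 : ∀ b, 0 < w b := by intro b; cases b <;> norm_num [hw]
  have hprod : ∀ c : Fin n → Bool, ∏ l, w (c l)
      = (16 / 25 : ℝ) ^ (heads c).card * (5 / 4) ^ (n - (heads c).card) := by
    intro c
    simp only [hw, Finset.prod_ite, Finset.prod_const, heads]
    congr 2
    have := Finset.card_filter_add_card_filter_not (s := (Finset.univ : Finset (Fin n)))
      (fun l => c l = true)
    simp only [Finset.card_univ, Fintype.card_fin] at this
    omega
  have hint : ∫ c, ∏ l, w (c l) ∂(Measure.pi fun _ : Fin n => coin) = (189 / 200 : ℝ) ^ n := by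
    have h := integral_fintype_prod_eq_pow (ι := Fin n) (μ := coin) w
    rw [h, Fintype.card_fin, integral_coin]
    norm_num [hw]
  have hsub : {c : Fin n → Bool | (heads c).card < ⌈(n : ℝ) / 3⌉₊}
      ⊆ {c | (1 : ℝ) ≤ ∏ l, w (c l)} := by
    intro c hc
    simp only [Set.mem_ofPred_eq] at hc ⊢
    have h1 : ((heads c).card : ℝ) < n / 3 := Nat.lt_ceil.1 hc
    have h2 : 3 * (heads c).card < n := by
      have : (3 * (heads c).card : ℝ) < n := by linarith
      exact_mod_cast this
    obtain ⟨r, hr⟩ : ∃ r, n - (heads c).card = 2 * (heads c).card + r :=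
      ⟨n - 3 * (heads c).card, by omega⟩
    rw [hprod, hr, pow_add, pow_mul, ← mul_assoc, ← mul_pow]
    norm_num
    exact one_le_pow₀ (by norm_num)
  have hmk := mul_meas_ge_le_integral_of_nonneg (μ := Measure.pi fun _ : Fin n => coin)
    (f := fun c => ∏ l, w (c l)) (Filter.Eventually.of_forall fun c =>
      Finset.prod_nonneg fun l _ => (hw0 _).le) (Integrable.of_finite) 1
  rw [hint, one_mul] at hmk
  rw [exp_neg_headsRate_mul]
  refine (measure_mono hsub).trans ?_
  rw [← ENNReal.ofReal_toReal (measure_ne_top _ _)]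
  exact ENNReal.ofReal_le_ofReal hmk

variable {Z X T : Type} [MeasurableSpace Z] [MeasurableSpace X] [MeasurableSpace T]

theorem measurePreserving_pi_comp_injective {m n : ℕ} (D : Measure Z) [IsProbabilityMeasure D]
    (ρ : Measure X) [IsProbabilityMeasure ρ] (ι : Fin m → Fin n) (hι : ι.Injective) :
    MeasurePreserving (fun (w : Fin n → Z × X) (i : Fin m) => (w (ι i)).1)
      (Measure.pi fun _ => D.prod ρ) (Measure.pi fun _ => D) := by
  refine ⟨by fun_prop, ?_⟩
  have h := iIndepFun_pi (ι := Fin n) (Ω := fun _ => Z × X) (μ := fun _ => D.prod ρ)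
    (X := fun _ w => w.1) (fun _ => measurable_fst.aemeasurable)
  have h' := (iIndepFun_iff_map_fun_eq_pi_map fun i => by
    exact (measurable_fst.comp (measurable_pi_apply (ι i))).aemeasurable).1 (h.precomp hι)
  rw [h']
  congr 1
  funext i
  have h1 := (measurePreserving_eval (fun _ : Fin n => D.prod ρ) (ι i))
  have h2 : MeasurePreserving (Prod.fst : Z × X → Z) (D.prod ρ) D := measurePreserving_fst
  exact (h2.comp h1).map_eq

/-- For `n` independent draws from the mixture of the images of `D` and `ρ`, at least a third of
which come from `D` with overwhelming probability, the expectation of a statistic is bounded by that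
of a bound `ψ` in terms of the first `⌈n / 3⌉` draws from `D`. -/
theorem lintegral_pi_mixture_le {n : ℕ} (D : Measure Z) [IsProbabilityMeasure D]
    (ρ : Measure X) [IsProbabilityMeasure ρ] {Θ₁ : Z → T} {Θ₂ : X → T} (hΘ₁ : Measurable Θ₁)
    (hΘ₂ : Measurable Θ₂) {p : Z → Prop} {q : X → Prop} (hp : ∀ᵐ z ∂D, p z) (hq : ∀ᵐ x ∂ρ, q x)
    {F : (Fin n → T) → ℝ≥0∞} (hF : Measurable F) {B : ℝ≥0∞} (hB : ∀ S, F S ≤ B)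
    {ψ : (Fin ⌈(n : ℝ) / 3⌉₊ → Z) → ℝ≥0∞} (hψ : Measurable ψ)
    (hFψ : ∀ (c : Fin n → Bool) (w : Fin n → Z × X), (∀ l, p (w l).1) → (∀ l, q (w l).2) →
      ∀ h : ⌈(n : ℝ) / 3⌉₊ ≤ (heads c).card,
        F (fun l => if c l then Θ₁ (w l).1 else Θ₂ (w l).2)
          ≤ ψ fun i => (w ((heads c).orderEmbOfCardLe h i)).1) :
    ∫⁻ S, F S ∂(Measure.pi fun _ : Fin n =>
        (1 / 2 : ℝ≥0∞) • D.map Θ₁ + (1 / 2 : ℝ≥0∞) • ρ.map Θ₂)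
      ≤ B * ENNReal.ofReal (Real.exp (-(headsRate * n)))
        + ∫⁻ z, ψ z ∂(Measure.pi fun _ => D) := by
  set Θ : Bool × (Z × X) → T := fun a => if a.1 then Θ₁ a.2.1 else Θ₂ a.2.2 with hΘ
  have hΘm : Measurable Θ := by
    refine measurable_from_prod_countable_right fun b => ?_
    cases b
    · exact hΘ₂.comp measurable_snd
    · exact hΘ₁.comp measurable_fst
  have hmix : (1 / 2 : ℝ≥0∞) • D.map Θ₁ + (1 / 2 : ℝ≥0∞) • ρ.map Θ₂
      = (coin.prod (D.prod ρ)).map Θ := by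
    refine Measure.ext_of_lintegral _ fun f hf => ?_
    have hfΘ : Measurable fun a => f (Θ a) := hf.comp hΘm
    have h₁ : Measurable fun a : Z × X => f (Θ₁ a.1) := hf.comp (hΘ₁.comp measurable_fst)
    have h₂ : Measurable fun a : Z × X => f (Θ₂ a.2) := hf.comp (hΘ₂.comp measurable_snd)
    rw [lintegral_map hf hΘm, lintegral_prod _ hfΘ.aemeasurable, lintegral_coin,
      lintegral_add_measure, lintegral_smul_measure, lintegral_smul_measure,
      lintegral_map hf hΘ₁, lintegral_map hf hΘ₂]
    simp only [hΘ, if_true, Bool.false_eq_true, if_false]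
    rw [lintegral_prod _ h₁.aemeasurable, lintegral_prod _ h₂.aemeasurable]
    simp
  have hmp := measurePreserving_arrowProdEquivProdArrow Bool (Z × X) (Fin n) (fun _ => coin)
    (fun _ => D.prod ρ)
  have hG : Measurable fun a : (Fin n → Bool) × (Fin n → Z × X) =>
      F (fun l => Θ (a.1 l, a.2 l)) := by
    refine hF.comp (measurable_pi_lambda _ fun l => hΘm.comp (by fun_prop))
  have hgood : ∀ᵐ w : Fin n → Z × X ∂(Measure.pi fun _ => D.prod ρ),
      ∀ l, p (w l).1 ∧ q (w l).2 := by
    rw [ae_all_iff]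
    intro l
    have h1 : ∀ᵐ a ∂(D.prod ρ), p a.1 ∧ q a.2 :=
      ((Measure.quasiMeasurePreserving_fst (μ := D) (ν := ρ)).ae hp).and
        ((Measure.quasiMeasurePreserving_snd (μ := D) (ν := ρ)).ae hq)
    exact (measurePreserving_eval (fun _ : Fin n => D.prod ρ) l).quasiMeasurePreserving.ae h1
  have hin : ∀ c : Fin n → Bool,
      ∫⁻ w, F (fun l => Θ (c l, w l)) ∂(Measure.pi fun _ : Fin n => D.prod ρ)
        ≤ {c : Fin n → Bool | (heads c).card < ⌈(n : ℝ) / 3⌉₊}.indicator (fun _ => B) c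
          + ∫⁻ z, ψ z ∂(Measure.pi fun _ => D) := by
    intro c
    by_cases h : ⌈(n : ℝ) / 3⌉₊ ≤ (heads c).card
    · refine le_add_of_nonneg_of_le bot_le ?_
      have hmp' := measurePreserving_pi_comp_injective D ρ _
        ((heads c).orderEmbOfCardLe h).injective
      rw [← hmp'.lintegral_comp hψ]
      refine lintegral_mono_ae ?_
      filter_upwards [hgood] with w hw
      exact hFψ c w (fun l => (hw l).1) (fun l => (hw l).2) h
    · have hc : c ∈ {c : Fin n → Bool | (heads c).card < ⌈(n : ℝ) / 3⌉₊} := not_le.1 h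
      rw [Set.indicator_of_mem hc]
      refine le_add_of_le_of_nonneg ?_ bot_le
      calc _ ≤ ∫⁻ _, B ∂(Measure.pi fun _ : Fin n => D.prod ρ) := lintegral_mono fun _ => hB _
        _ = B := by simp
  calc _ = ∫⁻ S, F S ∂((Measure.pi fun _ : Fin n => coin.prod (D.prod ρ)).map
          fun a l => Θ (a l)) := by
        rw [hmix, Measure.pi_map_pi (fun _ => hΘm.aemeasurable)]
    _ = ∫⁻ a, F (fun l => Θ (a l)) ∂(Measure.pi fun _ : Fin n => coin.prod (D.prod ρ)) :=
        lintegral_map hF (measurable_pi_lambda _ fun l => hΘm.comp (measurable_pi_apply l))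
    _ = ∫⁻ a, F (fun l => Θ (a.1 l, a.2 l)) ∂((Measure.pi fun _ : Fin n => coin).prod
          (Measure.pi fun _ => D.prod ρ)) := by
        rw [← hmp.lintegral_comp hG]
        rfl
    _ = ∫⁻ c, ∫⁻ w, F (fun l => Θ (c l, w l)) ∂(Measure.pi fun _ => D.prod ρ)
          ∂(Measure.pi fun _ : Fin n => coin) := lintegral_prod _ hG.aemeasurable
    _ ≤ ∫⁻ c, ({c : Fin n → Bool | (heads c).card < ⌈(n : ℝ) / 3⌉₊}.indicator (fun _ => B) c
          + ∫⁻ z, ψ z ∂(Measure.pi fun _ => D)) ∂(Measure.pi fun _ : Fin n => coin) :=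
        lintegral_mono hin
    _ ≤ _ := by
        rw [lintegral_add_right _ measurable_const,
          lintegral_indicator_const (Set.toFinite _).measurableSet]
        simp only [lintegral_const, measure_univ, mul_one]
        gcongr
        exact measure_card_heads_lt_le n

end Mixture

/-! ### Regression estimators with values in the class -/

section Regression

variable {k : ℕ}

/-- A single regression function with the regularity required of the members of a
`(1, L₀, M₀)`-regular class. -/
structure IsRegularFun (L₀ M₀ : ℝ≥0) (g : Cov k → ℝ) : Prop where
  bound : ∀ z, ‖z‖ ≤ 1 → |g z| ≤ 1
  lipschitz : LipschitzWith L₀ g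
  smooth : IsSmoothWith (M₀ : ℝ≥0∞) g

theorem isSmoothWith_const {E F : Type} [NormedAddCommGroup E] [NormedSpace ℝ E]
    [NormedAddCommGroup F] [InnerProductSpace ℝ F] (M : ℝ≥0∞) (y : F) :
    IsSmoothWith M (fun _ : E => y) := by
  refine fun v _ => ⟨contDiff_const, fun x => ?_⟩
  rw [iteratedFDeriv_const_of_ne (by norm_num), Pi.zero_apply, ← ofReal_norm,
    norm_zero, ENNReal.ofReal_zero]
  exact bot_le

theorem isRegularFun_zero (L₀ M₀ : ℝ≥0) : IsRegularFun L₀ M₀ (fun _ : Cov k => (0 : ℝ)) where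
  bound := by simp
  lipschitz := LipschitzWith.const' 0
  smooth := isSmoothWith_const _ _

theorem IsRegularReg.isRegularFun {G : Set (Cov k → ℝ)} {D : Measure (Cov k)} {L₀ M₀ : ℝ≥0}
    (h : IsRegularReg G D 1 L₀ M₀) {g : Cov k → ℝ} (hg : g ∈ G) : IsRegularFun L₀ M₀ g :=
  ⟨h.bound g hg, h.lipschitz g hg, h.smooth g hg⟩

/-- The distance in `L₂(D)`. -/
noncomputable def regDist (D : Measure (Cov k)) (g g' : Cov k → ℝ) : ℝ≥0∞ :=
  (∫⁻ z, ‖g z - g' z‖ₑ ^ 2 ∂D) ^ (1 / 2 : ℝ)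

theorem regDist_eq_eLpNorm (D : Measure (Cov k)) (g g' : Cov k → ℝ) :
    regDist D g g' = eLpNorm (g - g') 2 D := by
  rw [eLpNorm_eq_lintegral_rpow_enorm_toReal (by norm_num) (by norm_num), regDist]
  simp

theorem regDist_comm (D : Measure (Cov k)) (g g' : Cov k → ℝ) :
    regDist D g g' = regDist D g' g := by
  rw [regDist_eq_eLpNorm, regDist_eq_eLpNorm, eLpNorm_sub_comm]

theorem regDist_triangle (D : Measure (Cov k)) {g g' g'' : Cov k → ℝ} (hg : Measurable g)
    (hg' : Measurable g') (hg'' : Measurable g'') :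
    regDist D g g'' ≤ regDist D g g' + regDist D g' g'' := by
  simp only [regDist_eq_eLpNorm]
  have : g - g'' = (g - g') + (g' - g'') := by abel
  rw [this]
  exact eLpNorm_add_le (hg.sub hg').aestronglyMeasurable (hg'.sub hg'').aestronglyMeasurable
    (by norm_num)

theorem regDist_le_two {D : Measure (Cov k)} [IsProbabilityMeasure D] (hD : ∀ᵐ z ∂D, ‖z‖ ≤ 1)
    {g g' : Cov k → ℝ} (hg : ∀ z, ‖z‖ ≤ 1 → |g z| ≤ 1) (hg' : ∀ z, ‖z‖ ≤ 1 → |g' z| ≤ 1) :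
    regDist D g g' ≤ 2 := by
  rw [regDist_eq_eLpNorm]
  have h : ∀ᵐ z ∂D, ‖(g - g') z‖ ≤ 2 := by
    filter_upwards [hD] with z hz
    have h1 := abs_le.1 (hg z hz)
    have h2 := abs_le.1 (hg' z hz)
    rw [Pi.sub_apply, Real.norm_eq_abs, abs_le]
    constructor <;> linarith
  refine (eLpNorm_le_of_ae_bound h).trans ?_
  simp

/-- A regular class has a countable subset that is dense in `L₂(D)`. -/
theorem exists_dense_seq {D : Measure (Cov k)} [IsProbabilityMeasure D] (hD : ∀ᵐ z ∂D, ‖z‖ ≤ 1)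
    {G : Set (Cov k → ℝ)} {L₀ M₀ : ℝ≥0} (hG : ∀ g ∈ G, IsRegularFun L₀ M₀ g) :
    ∃ gs : ℕ → Cov k → ℝ, (∀ j, IsRegularFun L₀ M₀ (gs j)) ∧
      ∀ g ∈ G, ∀ δ : ℝ≥0∞, 0 < δ → ∃ j, regDist D (gs j) g ≤ δ := by
  rcases G.eq_empty_or_nonempty with rfl | ⟨g₀, hg₀⟩
  · exact ⟨fun _ _ => 0, fun _ => isRegularFun_zero L₀ M₀, by simp⟩
  have hmem : ∀ g ∈ G, MemLp g 2 D := by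
    intro g hg
    refine MemLp.of_bound (hG g hg).lipschitz.continuous.measurable.aestronglyMeasurable 1 ?_
    filter_upwards [hD] with z hz using (hG g hg).bound z hz
  have : Fact ((2 : ℝ≥0∞) ≠ ∞) := ⟨by norm_num⟩
  set T : Set (Lp ℝ 2 D) := {f | ∃ g, ∃ hg : g ∈ G, f = (hmem g hg).toLp g} with hT
  have hTne : Nonempty T := ⟨⟨_, g₀, hg₀, rfl⟩⟩
  have hch : ∀ t : T, ∃ g, ∃ hg : g ∈ G, (t : Lp ℝ 2 D) = (hmem g hg).toLp g := fun t => t.2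
  choose r hrG hr using hch
  refine ⟨fun j => r (TopologicalSpace.denseSeq T j), fun j => hG _ (hrG _), fun g hg δ hδ => ?_⟩
  obtain ⟨_, ⟨j, rfl⟩, hy⟩ := EMetric.mem_closure_iff.1
    (TopologicalSpace.denseRange_denseSeq T ⟨_, g, hg, rfl⟩) δ hδ
  refine ⟨j, ?_⟩
  rw [Subtype.edist_eq, hr (TopologicalSpace.denseSeq T j), Lp.edist_toLp_toLp,
    ← regDist_eq_eLpNorm, regDist_comm] at hy
  exact hy.le

/-- An almost closest function of a dense sequence is, up to the factor `2`, as good an estimate as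
the regression algorithm itself. -/
theorem exists_measurable_selector {m : ℕ} (D : Measure (Cov k)) [IsProbabilityMeasure D]
    (a : RegAlg k m) {gs : ℕ → Cov k → ℝ} (hgs : ∀ j, Measurable (gs j)) {δ : ℝ≥0∞}
    (hδ : 0 < δ) :
    ∃ J : (Fin m → Cov k × ℝ) → ℕ, Measurable J ∧ ∀ s, ∀ g, Measurable g →
      (∃ j, regDist D (gs j) g ≤ δ) →
        regDist D (gs (J s)) g ≤ 2 * regDist D (a.1 s) g + 2 * δ := by
  classical
  set e : (Fin m → Cov k × ℝ) → ℕ → ℝ≥0∞ := fun s j => regDist D (a.1 s) (gs j) with he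
  have hem : ∀ j, Measurable fun s => e s j := by
    intro j
    have h : Measurable fun q : (Fin m → Cov k × ℝ) × Cov k => ‖a.1 q.1 q.2 - gs j q.2‖ₑ ^ 2 :=
      ((a.2.sub ((hgs j).comp measurable_snd)).enorm).pow_const 2
    exact h.lintegral_prod_right'.pow_const _
  have hex : ∀ s, ∃ j, e s j ≤ (⨅ i, e s i) + δ := by
    intro s
    by_cases h : (⨅ i, e s i) = ⊤
    · exact ⟨0, by simp [h]⟩
    · obtain ⟨j, hj⟩ := iInf_lt_iff.1 (ENNReal.lt_add_right h hδ.ne')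
      exact ⟨j, hj.le⟩
  refine ⟨fun s => Nat.find (hex s), measurable_find hex fun j =>
    measurableSet_le (hem j) ((Measurable.iInf hem).add_const δ), fun s g hg ⟨j, hj⟩ => ?_⟩
  have has : Measurable (a.1 s) := a.2.comp measurable_prodMk_left
  have h1 : e s j ≤ regDist D (a.1 s) g + δ :=
    (regDist_triangle D has hg (hgs j)).trans (by gcongr; rwa [regDist_comm])
  have h2 : e s (Nat.find (hex s)) ≤ regDist D (a.1 s) g + δ + δ :=
    (Nat.find_spec (hex s)).trans (by gcongr; exact (iInf_le _ j).trans h1)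
  calc regDist D (gs (Nat.find (hex s))) g
      ≤ regDist D (gs (Nat.find (hex s))) (a.1 s) + regDist D (a.1 s) g :=
        regDist_triangle D (hgs _) has hg
    _ ≤ (regDist D (a.1 s) g + δ + δ) + regDist D (a.1 s) g := by
        gcongr
        rwa [regDist_comm]
    _ = 2 * regDist D (a.1 s) g + 2 * δ := by ring

end Regression

/-! ### The initial law and the dynamics of the construction -/

section Geometry

variable {k : ℕ}

/-- The state (or input) with the first two coordinates `p`, `q`, all others being `0`. -/
noncomputable def plane (p q : ℝ) : St k := WithLp.toLp 2 (Sum.elim ![p, q] 0)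

@[simp] theorem plane_inl_zero (p q : ℝ) : (plane p q : St k) (Sum.inl 0) = p := rfl
@[simp] theorem plane_inl_one (p q : ℝ) : (plane p q : St k) (Sum.inl 1) = q := rfl
@[simp] theorem plane_inr (p q : ℝ) (j : Fin k) : (plane p q : St k) (Sum.inr j) = 0 := rfl

theorem ext_St {x y : St k} (h₀ : x (Sum.inl 0) = y (Sum.inl 0))
    (h₁ : x (Sum.inl 1) = y (Sum.inl 1))
    (h₂ : ∀ j, x (Sum.inr j) = y (Sum.inr j)) : x = y := by
  ext i
  rcases i with i | j
  · fin_cases i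
    · exact h₀
    · exact h₁
  · exact h₂ j

theorem plane_add (p q p' q' : ℝ) : (plane p q + plane p' q' : St k) = plane (p + p') (q + q') := by
  apply ext_St <;> simp

theorem plane_sub (p q p' q' : ℝ) : (plane p q - plane p' q' : St k) = plane (p - p') (q - q') := by
  apply ext_St <;> simp

theorem smul_plane (c p q : ℝ) : (c • plane p q : St k) = plane (c * p) (c * q) := by
  apply ext_St <;> simp

theorem plane_zero : (plane 0 0 : St k) = 0 := by
  apply ext_St <;> simp

theorem e₁_eq_plane : (e₁ : St k) = plane 1 0 := by
  apply ext_St <;> simp [e₁]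

theorem inner_e₁ (x : St k) : inner ℝ e₁ x = x (Sum.inl 0) := by
  simp [e₁, EuclideanSpace.inner_single_left]

theorem norm_e₁ : ‖(e₁ : St k)‖ = 1 := by simp [e₁]

theorem norm_plane_le (p q : ℝ) : ‖(plane p q : St k)‖ ≤ |p| + |q| := by
  have : (plane p q : St k)
      = EuclideanSpace.single (Sum.inl 0) p + EuclideanSpace.single (Sum.inl 1) q := by
    apply ext_St <;> simp
  rw [this]
  refine (norm_add_le _ _).trans (by simp)

theorem embMat_eq_plane (B : Matrix (Fin 2) (Fin 2) ℝ) (x : St k) :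
    embMat B x = plane (B 0 0 * x (Sum.inl 0) + B 0 1 * x (Sum.inl 1))
      (B 1 0 * x (Sum.inl 0) + B 1 1 * x (Sum.inl 1)) := by
  apply ext_St <;>
    simp [embMat, Matrix.toLpLin_apply, Matrix.mulVec, dotProduct, Fintype.sum_sum_type,
      Fin.sum_univ_two]

theorem continuous_bump {E : Type} [NormedAddCommGroup E] : Continuous (bump : E → ℝ) :=
  Real.smoothTransition.continuous.comp (by fun_prop)

theorem norm_projTail_le (x : St k) : ‖projTail x‖ ≤ ‖x‖ := by
  rw [EuclideanSpace.norm_eq, EuclideanSpace.norm_eq]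
  refine Real.sqrt_le_sqrt ?_
  rw [Fintype.sum_sum_type]
  simp only [projTail]
  exact le_add_of_nonneg_left (Finset.sum_nonneg fun _ _ => by positivity)

theorem norm_embTail (z : Cov k) : ‖(embTail z : St k)‖ = ‖z‖ := by
  rw [EuclideanSpace.norm_eq, EuclideanSpace.norm_eq, Fintype.sum_sum_type]
  simp [embTail]

@[simp] theorem projTail_embTail (z : Cov k) : projTail (embTail z) = z := rfl
@[simp] theorem embTail_inl (z : Cov k) (i : Fin 2) : (embTail z : St k) (Sum.inl i) = 0 := rfl

theorem continuous_projTail : Continuous (projTail : St k → Cov k) := by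
  unfold projTail; fun_prop

theorem continuous_embTail : Continuous (embTail : Cov k → St k) := by
  refine (PiLp.continuous_toLp 2 _).comp (continuous_pi fun i => ?_)
  rcases i with i | j
  · exact continuous_const
  · simp only [Sum.elim_inr]; fun_prop

theorem continuous_plane_comp {Y : Type} [TopologicalSpace Y] {p q : Y → ℝ} (hp : Continuous p)
    (hq : Continuous q) : Continuous fun y => (plane (p y) (q y) : St k) := by
  refine (PiLp.continuous_toLp 2 _).comp (continuous_pi fun i => ?_)
  rcases i with i | j
  · fin_cases i
    · exact hp
    · exact hq
  · exact continuous_const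

theorem continuous_embMat (B : Matrix (Fin 2) (Fin 2) ℝ) :
    Continuous (embMat B : St k → St k) := by
  simp only [funext (embMat_eq_plane (k := k) B)]
  exact continuous_plane_comp (by fun_prop) (by fun_prop)

instance isProbabilityMeasure_lawY : IsProbabilityMeasure lawY := by
  constructor
  have h := (hasSum_nat_add_iff' 1).2 hasSum_zeta_two
  have h2 : HasSum (fun j : ℕ => 3 / (Real.pi ^ 2 * ((j : ℝ) + 1) ^ 2)) (1 / 2) := by
    have h' := h.mul_left (3 / Real.pi ^ 2)
    have hπ := Real.pi_pos
    have e1 : (1 / 2 : ℝ) = 3 / Real.pi ^ 2 *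
        (Real.pi ^ 2 / 6 - ∑ i ∈ Finset.range 1, 1 / (i : ℝ) ^ 2) := by
      simp
      field_simp
      norm_num
    rw [e1]
    refine h'.congr_fun fun j => ?_
    push_cast
    field_simp
  have h3 : ∑' j : ℕ, ENNReal.ofReal (3 / (Real.pi ^ 2 * ((j : ℝ) + 1) ^ 2)) = 1 / 2 := by
    rw [← ENNReal.ofReal_tsum_of_nonneg (fun j => by positivity) h2.summable, h2.tsum_eq]
    rw [ENNReal.ofReal_div_of_pos (by norm_num)]
    simp
  rw [lawY, Measure.add_apply, Measure.smul_apply, Measure.sum_apply _ MeasurableSet.univ]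
  simp only [Measure.smul_apply, measure_univ, smul_eq_mul, mul_one, h3]
  exact ENNReal.add_halves 1

theorem ae_lawY : ∀ᵐ y ∂lawY, |y| ≤ 1 := by
  have hm : MeasurableSet {y : ℝ | |y| ≤ 1} := measurableSet_le (by fun_prop) (by fun_prop)
  rw [lawY, ae_add_measure_iff, Measure.ae_sum_iff]
  refine ⟨Measure.ae_smul_measure ((ae_dirac_iff hm).2 (by simp)) _, fun j =>
    Measure.ae_smul_measure ((ae_dirac_iff hm).2 ?_) _⟩
  rw [abs_of_nonneg (by positivity)]
  exact pow_le_one₀ (by norm_num) (by norm_num)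

instance isProbabilityMeasure_unifPerp : IsProbabilityMeasure (unifPerp k) :=
  cond_isProbabilityMeasure_of_finite (Metric.measure_closedBall_pos _ _ one_pos).ne'
    measure_closedBall_lt_top.ne

theorem ae_unifPerp : ∀ᵐ w ∂(unifPerp k), ‖w‖ ≤ 1 := by
  have := ae_cond_mem (μ := (volume : Measure (Perp k))) (s := Metric.closedBall 0 1)
    Metric.isClosed_closedBall.measurableSet
  filter_upwards [this] with w hw
  simpa using hw

theorem norm_embPerp_le (w : Perp k) : ‖(embPerp w : St k)‖ ≤ ‖w‖ := by
  rw [EuclideanSpace.norm_eq, EuclideanSpace.norm_eq]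
  refine Real.sqrt_le_sqrt (le_of_eq ?_)
  rw [← Fintype.sum_subtype_add_sum_subtype (fun i : Fin 2 ⊕ Fin k => i ≠ Sum.inl 0)]
  have h1 : ∀ i : {i : Fin 2 ⊕ Fin k // i ≠ Sum.inl 0}, (embPerp w : St k) i = w i := by
    rintro ⟨i, hi⟩
    simp [embPerp, hi]
  have h2 : ∀ i : {i : Fin 2 ⊕ Fin k // ¬ i ≠ Sum.inl 0}, (embPerp w : St k) i = 0 := by
    rintro ⟨i, hi⟩
    simp only [embPerp, dif_neg hi]
  simp only [h1, h2]
  simp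

theorem continuous_embPerp : Continuous (embPerp : Perp k → St k) := by
  refine (PiLp.continuous_toLp 2 _).comp (continuous_pi fun i => ?_)
  by_cases h : i ≠ Sum.inl 0
  · simp only [h, dif_pos, ne_eq, not_false_eq_true]
    fun_prop
  · simp only [h, dif_neg, not_false_eq_true]
    exact continuous_const

/-- The law of the initial state in the case that it is close to the origin. -/
noncomputable def nearLaw (k : ℕ) (Δ : ℝ) : Measure (St k) :=
  (lawY.prod (unifPerp k)).map fun q => (Δ * q.1) • embPerp q.2

theorem measurable_near (Δ : ℝ) : Measurable fun q : ℝ × Perp k => (Δ * q.1) • embPerp q.2 := by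
  have := continuous_embPerp (k := k)
  exact Continuous.measurable (by fun_prop)

instance isProbabilityMeasure_nearLaw (Δ : ℝ) : IsProbabilityMeasure (nearLaw k Δ) :=
  Measure.isProbabilityMeasure_map (measurable_near Δ).aemeasurable

theorem ae_nearLaw {Δ : ℝ} (h₀ : 0 < Δ) (h₁ : Δ < 1) :
    ∀ᵐ x ∂(nearLaw k Δ), x (Sum.inl 0) = 0 ∧ ‖x‖ ≤ 1 := by
  rw [nearLaw, ae_map_iff (measurable_near Δ).aemeasurable]
  · filter_upwards [(Measure.quasiMeasurePreserving_fst (μ := lawY) (ν := unifPerp k)).ae ae_lawY,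
      (Measure.quasiMeasurePreserving_snd (μ := lawY) (ν := unifPerp k)).ae ae_unifPerp]
      with q hq₁ hq₂
    refine ⟨by simp [embPerp], ?_⟩
    rw [norm_smul, Real.norm_eq_abs, abs_mul, abs_of_pos h₀]
    have := (norm_embPerp_le q.2).trans hq₂
    have h2 : Δ * |q.1| ≤ 1 := by nlinarith [abs_nonneg q.1]
    nlinarith [norm_nonneg (embPerp q.2), abs_nonneg q.1]
  · exact (measurableSet_eq_fun (by fun_prop) measurable_const).inter
      (measurableSet_le measurable_norm measurable_const)

variable [NeZero k]

@[simp] theorem xOffset_inl (i : Fin 2) : (xOffset : St k) (Sum.inl i) = 0 := by simp [xOffset]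

theorem norm_xOffset : ‖(xOffset : St k)‖ = 3 := by simp [xOffset]

theorem bump_sub_xOffset_of_norm_le {x : St k} (hx : ‖x‖ ≤ 1) : bump (x - xOffset) = 0 := by
  rw [bump_eq_zero_iff, norm_sub_rev]
  have := norm_sub_norm_le (xOffset : St k) x
  rw [norm_xOffset] at this
  linarith

theorem bump_plane_sub_xOffset (p q : ℝ) : bump ((plane p q : St k) - xOffset) = 0 := by
  rw [bump_eq_zero_iff]
  have := PiLp.norm_apply_le ((plane p q : St k) - xOffset) (Sum.inr 0)
  simp only [PiLp.sub_apply, plane_inr, xOffset, PiLp.single_apply] at this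
  norm_num at this
  rw [xOffset]
  linarith

theorem localized_of_bump_eq_zero (g : Cov k → ℝ) {x : St k} (h : bump (x - xOffset) = 0) :
    localized g x = 0 := by simp [localized, h]

theorem localized_offset (g : Cov k → ℝ) {z : Cov k} (hz : ‖z‖ ≤ 1) :
    localized g (xOffset + embTail z) = g z := by
  have : bump (embTail z : St k) = 1 := (bump_eq_one_iff _).2 (by rwa [norm_embTail])
  simp [localized, this]

theorem continuous_localized {g : Cov k → ℝ} (hg : Continuous g) :
    Continuous (localized g : St k → ℝ) := by
  unfold localized
  exact (continuous_bump.comp (by fun_prop)).mul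
    (hg.comp (continuous_projTail.comp (by fun_prop)))

theorem continuous_expertPolicy (τ : ℝ) {g : Cov k → ℝ} (hg : Continuous g) (i : Fin 2) :
    Continuous (expertPolicy τ g i : St k → St k) := by
  unfold expertPolicy
  exact (continuous_embMat _).add ((continuous_const.mul (continuous_localized hg)).smul
    continuous_const)

theorem continuous_dynamics (τ : ℝ) {g : Cov k → ℝ} (hg : Continuous g) (i : Fin 2) (ω : ℝ) :
    Continuous (Function.uncurry (dynamics τ g i ω : St k → St k → St k)) := by
  have h1 := (continuous_embMat (k := k) (chalA (1 / 4) i)).comp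
    (continuous_fst (X := St k) (Y := St k))
  have h2 := (continuous_localized hg).comp (continuous_fst (X := St k) (Y := St k))
  have h3 : Continuous fun q : St k × St k => bump (q.1 - xOffset) :=
    continuous_bump.comp (by fun_prop)
  have h4 : Continuous fun q : St k × St k => g (projTail (q.1 - xOffset)) :=
    hg.comp (continuous_projTail.comp (by fun_prop))
  have h5 : Continuous fun q : St k × St k => bump q.2 := continuous_bump.comp (by fun_prop)
  simp only [Function.comp_def] at h1 h2
  unfold dynamics Function.uncurry
  exact ((h1.add continuous_snd).sub ((continuous_const.mul h2).smul continuous_const)).add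
    (((continuous_const.mul h3).mul (h4.sub (((continuous_const.inner continuous_snd).mul
      h5).div_const _))).smul continuous_const)

theorem dynamics_of_bump_eq_zero (τ : ℝ) (g : Cov k → ℝ) (i : Fin 2) (ω : ℝ) {x : St k}
    (hx : bump (x - xOffset) = 0) (u : St k) :
    dynamics τ g i ω x u = embMat (chalA (1 / 4) i) x + u := by
  simp [dynamics, localized_of_bump_eq_zero g hx, hx]

/-- The planar dynamics of the instances with `i = 1`. -/
theorem dynamics_plane_zero (τ : ℝ) (g : Cov k → ℝ) (ω a b p q : ℝ) :
    dynamics τ g 0 ω (plane a b) (plane p q)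
      = plane (5 / 4 * a + 3 / 8 * b + p) (-(3 / 8) * a + 1 / 2 * b + q) := by
  rw [dynamics_of_bump_eq_zero _ _ _ _ (bump_plane_sub_xOffset a b), embMat_eq_plane, plane_add]
  simp only [chalA, plane_inl_zero, plane_inl_one]
  congr 1 <;> simp <;> ring

/-- The planar dynamics of the instances with `i = 2`. -/
theorem dynamics_plane_one (τ : ℝ) (g : Cov k → ℝ) (ω a b p q : ℝ) :
    dynamics τ g 1 ω (plane a b) (plane p q)
      = plane (-(15 / 16) * a + 3 / 8 * b + p) (1 / 2 * b + q) := by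
  rw [dynamics_of_bump_eq_zero _ _ _ _ (bump_plane_sub_xOffset a b), embMat_eq_plane, plane_add]
  simp only [chalA, plane_inl_zero, plane_inl_one]
  congr 1 <;> simp <;> first | ring1 | norm_num

/-- On the hyperplane `x₁ = 0`, away from the offset, all instances have the same expert. -/
theorem expertPolicy_of_fst_eq_zero (τ : ℝ) (g : Cov k → ℝ) (i : Fin 2) {x : St k}
    (h₀ : x (Sum.inl 0) = 0) (hx : bump (x - xOffset) = 0) :
    expertPolicy τ g i x = plane (-(3 / 8) * x (Sum.inl 1)) 0 := by
  rw [expertPolicy, localized_of_bump_eq_zero g hx, embMat_eq_plane, h₀]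
  simp only [mul_zero, zero_smul, add_zero, zero_add]
  fin_cases i <;> simp [chalK] <;> congr 1 <;> ring

/-- On the hyperplane `x₁ = 0`, away from the offset, all instances have the same closed loop. -/
theorem dynamics_of_fst_eq_zero (τ : ℝ) (g : Cov k → ℝ) (i : Fin 2) (ω : ℝ) {x : St k}
    (h₀ : x (Sum.inl 0) = 0) (hx : bump (x - xOffset) = 0) :
    dynamics τ g i ω x (plane (-(3 / 8) * x (Sum.inl 1)) 0) = plane 0 (x (Sum.inl 1) / 2) := by
  rw [dynamics_of_bump_eq_zero _ _ _ _ hx, embMat_eq_plane, h₀, plane_add]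
  fin_cases i <;> simp [chalA] <;> congr 1 <;> ring

theorem expertPolicy_offset (τ : ℝ) (g : Cov k → ℝ) (i : Fin 2) {z : Cov k} (hz : ‖z‖ ≤ 1) :
    expertPolicy τ g i (xOffset + embTail z) = plane (τ * g z) 0 := by
  rw [expertPolicy, localized_offset g hz, embMat_eq_plane, e₁_eq_plane, smul_plane, plane_add]
  simp

/-- Playing `τ y` instead of the expert's `τ g(z)` at the offset results in a small deviation. -/
theorem dynamics_offset {τ : ℝ} (hτ₀ : τ ≠ 0) (g : Cov k → ℝ) (i : Fin 2) (ω : ℝ) {z : Cov k}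
    (hz : ‖z‖ ≤ 1) {y : ℝ} (hy : |τ * y| ≤ 1) :
    dynamics τ g i ω (xOffset + embTail z) (plane (τ * y) 0)
      = plane (τ * (1 - ω * τ) * (y - g z)) 0 := by
  have h1 : bump (embTail z : St k) = 1 := (bump_eq_one_iff _).2 (by rwa [norm_embTail])
  have h2 : bump (plane (τ * y) 0 : St k) = 1 :=
    (bump_eq_one_iff _).2 ((norm_plane_le _ _).trans (by simpa using hy))
  rw [dynamics, localized_offset g hz, embMat_eq_plane, inner_e₁, h2]
  simp only [add_sub_cancel_left, h1, projTail_embTail, PiLp.add_apply, xOffset_inl, embTail_inl,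
    add_zero, mul_zero, plane_zero, zero_add, plane_inl_zero, e₁_eq_plane, smul_plane, plane_add,
    plane_sub]
  congr 1 <;> field_simp <;> ring

theorem initLaw_eq (D : Measure (Cov k)) (Δ : ℝ) :
    initLaw D Δ = (1 / 2 : ℝ≥0∞) • D.map (fun z => xOffset + embTail z)
      + (1 / 2 : ℝ≥0∞) • nearLaw k Δ := rfl

end Geometry

/-! ### Reduction to policies that depend on a regression function -/

section Reduction

theorem lintegral_rpow_le_rpow_lintegral {Ω : Type} [MeasurableSpace Ω] (μ : Measure Ω)
    [IsProbabilityMeasure μ] {f : Ω → ℝ≥0∞} (hf : Measurable f) {θ : ℝ} (h₀ : 0 < θ) (h₁ : θ ≤ 1) :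
    ∫⁻ x, f x ^ θ ∂μ ≤ (∫⁻ x, f x ∂μ) ^ θ := by
  have h := eLpNorm'_le_eLpNorm'_of_exponent_le (f := f) h₀ h₁ μ hf.aestronglyMeasurable
  simp only [eLpNorm', enorm_eq_self, ENNReal.rpow_one, div_one] at h
  have h2 := ENNReal.rpow_le_rpow h h₀.le
  rwa [← ENNReal.rpow_mul, one_div, inv_mul_cancel₀ h₀.ne', ENNReal.rpow_one] at h2

theorem measurable_expertTraj {X U : Type} [MeasurableSpace X] [MeasurableSpace U] {π : X → U}
    {f : X → U → X} (hπ : Measurable π) (hf : Measurable (Function.uncurry f)) (H : ℕ) :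
    Measurable (expertTraj π f H) ∧ ∀ t, Measurable fun x => expertState π f x t := by
  have h : ∀ t, Measurable fun x => expertState π f x t := by
    intro t
    induction t with
    | zero => exact measurable_id
    | succ t ih =>
      exact hf.comp (ih.prodMk (hπ.comp ih))
  exact ⟨measurable_pi_lambda _ fun t => (h t).prodMk (hπ.comp (h t)), h⟩

variable {k : ℕ} [NeZero k]

/-- The coins by which a sample shows which of its trajectories start near the offset. -/
noncomputable def sampleCoins {n H : ℕ} (S : Sample (St k) (St k) n (H + 1)) (l : Fin n) : Bool :=
  decide (‖(S l 0).1 - xOffset‖ ≤ 1)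

/-- The labelled point for the regression problem that a trajectory provides. -/
noncomputable def labelledPoint (τ : ℝ) (y : St k × St k) : Cov k × ℝ :=
  (projTail (y.1 - xOffset), y.2 (Sum.inl 0) / τ)

theorem measurable_labelledPoint (τ : ℝ) :
    Measurable (labelledPoint τ : St k × St k → Cov k × ℝ) := by
  refine Measurable.prodMk ?_ ?_
  · exact (continuous_projTail.comp (by fun_prop : Continuous fun y : St k × St k =>
      y.1 - xOffset)).measurable
  · exact Measurable.div_const (by fun_prop) _

open Classical in
/-- The statistic that applies `J` to the labelled points of the first `m` trajectories that start
near the offset (and is `0` if there are fewer). -/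
noncomputable def sampleIndex (τ : ℝ) {m n H : ℕ} (J : (Fin m → Cov k × ℝ) → ℕ)
    (S : Sample (St k) (St k) n (H + 1)) : ℕ :=
  if h : m ≤ (heads (sampleCoins S)).card then
    J fun i => labelledPoint τ (S ((heads (sampleCoins S)).orderEmbOfCardLe h i) 0)
  else 0

theorem measurable_sampleIndex (τ : ℝ) {m n H : ℕ} {J : (Fin m → Cov k × ℝ) → ℕ}
    (hJ : Measurable J) :
    Measurable (sampleIndex τ J : Sample (St k) (St k) n (H + 1) → ℕ) := by
  classical
  have hc : Measurable (sampleCoins : Sample (St k) (St k) n (H + 1) → Fin n → Bool) := by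
    refine measurable_pi_lambda _ fun l => measurable_to_bool ?_
    have : (fun S : Sample (St k) (St k) n (H + 1) => sampleCoins S l) ⁻¹' {true}
        = {S | ‖(S l 0).1 - xOffset‖ ≤ 1} := by
      ext S; simp [sampleCoins]
    rw [this]
    exact measurableSet_le (by fun_prop) measurable_const
  have h : Measurable fun q : (Fin n → Bool) × Sample (St k) (St k) n (H + 1) =>
      if h : m ≤ (heads q.1).card then
        J fun i => labelledPoint τ (q.2 ((heads q.1).orderEmbOfCardLe h i) 0)
      else 0 := by
    refine measurable_from_prod_countable_right fun c => ?_
    by_cases h : m ≤ (heads c).card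
    · simp only [h, dif_pos]
      refine hJ.comp (measurable_pi_lambda _ fun i => (measurable_labelledPoint τ).comp ?_)
      exact (measurable_pi_apply 0).comp (measurable_pi_apply ((heads c).orderEmbOfCardLe h i))
    · simp only [h, dif_neg, not_false_eq_true]
      exact measurable_const
  exact h.comp (hc.prodMk measurable_id)

/-- The risk of policies with the index `j` selected from the sample by `sampleIndex`,
is bounded by the probability that few trajectories start near the offset and the risk in the
regression problem. -/
theorem lintegral_sampleIndex_le {D : Measure (Cov k)} [IsProbabilityMeasure D]
    (hD : ∀ᵐ z ∂D, ‖z‖ ≤ 1) {τ Δ : ℝ} (hτ : τ ≠ 0) (hΔ₀ : 0 < Δ) (hΔ₁ : Δ < 1) {n H : ℕ}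
    {J : (Fin ⌈(n : ℝ) / 3⌉₊ → Cov k × ℝ) → ℕ} (hJ : Measurable J)
    {g : Cov k → ℝ} (hg : Continuous g) (i : Fin 2) (ω : ℝ) {Ψ : ℕ → ℝ≥0∞} {B : ℝ≥0∞}
    (hB : ∀ j, Ψ j ≤ B) :
    ∫⁻ S, Ψ (sampleIndex τ J S) ∂(sampleLaw (expertPolicy τ g i) (dynamics τ g i ω)
        (initLaw D Δ) n (H + 1))
      ≤ B * ENNReal.ofReal (Real.exp (-(headsRate * n)))
        + ∫⁻ z, Ψ (J fun l => (z l, g (z l))) ∂(Measure.pi fun _ => D) := by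
  have hT := (measurable_expertTraj (continuous_expertPolicy τ hg i).measurable
    (continuous_dynamics τ hg i ω).measurable (H + 1)).1
  have hoff : Measurable fun z : Cov k => (xOffset + embTail z : St k) :=
    (continuous_const.add continuous_embTail).measurable
  have hlaw : (initLaw D Δ).map (expertTraj (expertPolicy τ g i) (dynamics τ g i ω) (H + 1))
      = (1 / 2 : ℝ≥0∞) • D.map (fun z => expertTraj (expertPolicy τ g i) (dynamics τ g i ω) (H + 1)
          (xOffset + embTail z))
        + (1 / 2 : ℝ≥0∞) • (nearLaw k Δ).map
          (expertTraj (expertPolicy τ g i) (dynamics τ g i ω) (H + 1)) := by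
    rw [initLaw_eq, Measure.map_add _ _ hT, Measure.map_smul, Measure.map_smul,
      Measure.map_map hT hoff]
    rfl
  have hΨ : Measurable Ψ := measurable_of_countable Ψ
  rw [sampleLaw, hlaw]
  refine lintegral_pi_mixture_le D (nearLaw k Δ) (hT.comp hoff) hT hD (ae_nearLaw hΔ₀ hΔ₁)
    (hΨ.comp (measurable_sampleIndex τ hJ)) (fun S => hB _) ?_ ?_
  · refine hΨ.comp (hJ.comp (measurable_pi_lambda _ fun l => ?_))
    exact (measurable_pi_apply l).prodMk (hg.measurable.comp (measurable_pi_apply l))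
  · intro c w hw₁ hw₂ h
    set S : Sample (St k) (St k) n (H + 1) := fun l => if c l
      then expertTraj (expertPolicy τ g i) (dynamics τ g i ω) (H + 1) (xOffset + embTail (w l).1)
      else expertTraj (expertPolicy τ g i) (dynamics τ g i ω) (H + 1) (w l).2 with hS
    have hcoins : sampleCoins S = c := by
      funext l
      rw [sampleCoins]
      cases hcl : c l
      · have h0 : S l 0 = ((w l).2, expertPolicy τ g i (w l).2) := by
          simp [hS, hcl, expertTraj, expertState]
        rw [h0, decide_eq_false_iff_not]
        intro hle
        have h1 := (bump_eq_one_iff ((w l).2 - xOffset)).2 hle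
        rw [bump_sub_xOffset_of_norm_le (hw₂ l).2] at h1
        exact zero_ne_one h1
      · have h0 : S l 0 = (xOffset + embTail (w l).1,
            expertPolicy τ g i (xOffset + embTail (w l).1)) := by
          simp [hS, hcl, expertTraj, expertState]
        rw [h0, decide_eq_true_iff]
        simpa [norm_embTail] using hw₁ l
    have hpt : ∀ l, c l = true → labelledPoint τ (S l 0) = ((w l).1, g (w l).1) := by
      intro l hcl
      have h0 : S l 0 = (xOffset + embTail (w l).1,
          expertPolicy τ g i (xOffset + embTail (w l).1)) := by
        simp [hS, hcl, expertTraj, expertState]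
      rw [h0, labelledPoint, expertPolicy_offset τ g i (hw₁ l)]
      simp [hτ]
    refine le_of_eq ?_
    change Ψ (sampleIndex τ J S) = _
    congr 1
    have hidx : sampleIndex τ J S
        = J fun i => labelledPoint τ (S ((heads c).orderEmbOfCardLe h i) 0) := by
      unfold sampleIndex
      simp only [hcoins]
      rw [dif_pos h]
    rw [hidx]
    congr 1
    funext l
    refine hpt _ ?_
    have := Finset.orderEmbOfCardLe_mem (heads c) h l
    simpa [heads] using this

/-- If every regular regression function `g` gives rise to a policy with a risk of the order of
`‖g - g'‖_{L₂} ^ θ` on the instances of `g'`, then the minimax risk is of the order of the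
regression risk to the power `θ`, up to an exponentially small term. -/
theorem trajMinimax_le_of_policies {L₀ M₀ : ℝ≥0} {G : Set (Cov k → ℝ)} {D : Measure (Cov k)}
    [IsProbabilityMeasure D] (hreg : IsRegularReg G D 1 L₀ M₀) {τ Δ : ℝ} (hτ : τ ≠ 0)
    (hΔ₀ : 0 < Δ) (hΔ₁ : Δ < 1) {n H : ℕ} {Q : HistPolicy (St k) (St k) → Prop} (K : ℝ≥0) {θ : ℝ}
    (hθ₀ : 0 < θ) (hθ₁ : θ ≤ 1)
    (hP : ∀ η : ℝ≥0, 0 < η → ∀ g, IsRegularFun L₀ M₀ g → ∃ P : HistPolicy (St k) (St k),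
      Q P ∧ ∀ g', IsRegularFun L₀ M₀ g' → ∀ i,
        ∀ ω ∈ ({-1, 1} : Set ℝ),
          trajRisk 2 P (expertPolicy τ g' i) (dynamics τ g' i ω) (initLaw D Δ) H
            ≤ K * regDist D g g' ^ θ + η) :
    trajMinimax (algClass n H Q) G D τ Δ
      ≤ 2 * K * (ENNReal.ofReal (Real.exp (-(headsRate * n)))
          + regMinimax ⌈(n : ℝ) / 3⌉₊ G D ^ θ) := by
  obtain ⟨gs, hgs, hdense⟩ := exists_dense_seq hreg.support_bound fun g hg => hreg.isRegularFun hg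
  rcases H with _ | H
  · choose P hPQ using fun j => hP 1 one_pos (gs j) (hgs j)
    refine (minimaxRisk_le_of_select _ _ _ P (fun j => (hPQ j).1)
      (fun _ => 0) measurable_const 0 fun p hp => ?_).trans bot_le
    simp [trajRisk]
  refine ENNReal.le_of_forall_pos_le_add fun t ht _ => ?_
  set η : ℝ≥0 := t / 3 with hη
  have hη₀ : 0 < η := by positivity
  choose P hPQ using fun j => hP η hη₀ (gs j) (hgs j)
  -- With this accuracy of the approximation, `K * (4 * δ) ^ θ ≤ η`.
  set δ : ℝ≥0 := (η / (K + 1)) ^ (1 / θ) / 4 with hδ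
  have hδ₀ : 0 < δ := div_pos (NNReal.rpow_pos (by positivity)) (by norm_num)
  have hKδ : (K : ℝ≥0∞) * (4 * δ) ^ θ ≤ η := by
    have h1 : (4 * δ) ^ θ = η / (K + 1) := by
      rw [hδ, mul_div_cancel₀ _ (by norm_num), ← NNReal.rpow_mul, one_div,
        inv_mul_cancel₀ hθ₀.ne', NNReal.rpow_one]
    have h2 : K * (4 * δ) ^ θ ≤ η := by
      rw [h1, mul_div_assoc', div_le_iff₀ (by positivity), mul_comm]
      gcongr
      exact le_self_add
    have h3 := ENNReal.coe_le_coe.2 h2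
    rw [ENNReal.coe_mul, ENNReal.coe_rpow_of_nonneg _ hθ₀.le, ENNReal.coe_mul] at h3
    exact h3
  obtain ⟨a, ha⟩ : ∃ a : RegAlg k ⌈(n : ℝ) / 3⌉₊, ∀ g ∈ G,
      ∫⁻ s, regDist D (a.1 fun l => (s l, g (s l))) g ∂(Measure.pi fun _ => D)
        ≤ regMinimax ⌈(n : ℝ) / 3⌉₊ G D + δ := by
    by_cases h : regMinimax ⌈(n : ℝ) / 3⌉₊ G D = ⊤
    · exact ⟨⟨fun _ _ => 0, measurable_const⟩, fun g _ => by simp [h]⟩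
    · obtain ⟨a, ha⟩ := iInf_lt_iff.1 (ENNReal.lt_add_right h (ENNReal.coe_pos.2 hδ₀).ne')
      refine ⟨a, fun g hg => le_trans (le_iSup₂ (f := fun g (_ : g ∈ G) =>
        ∫⁻ s, regDist D (a.1 fun l => (s l, g (s l))) g ∂(Measure.pi fun _ => D)) g hg) ?_⟩
      exact ha.le
  obtain ⟨J, hJm, hJ⟩ := exists_measurable_selector D a
    (fun j => (hgs j).lipschitz.continuous.measurable) (ENNReal.coe_pos.2 hδ₀)
  refine minimaxRisk_le_of_select _ _ _ P (fun j => (hPQ j).1)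
    (sampleIndex τ J) (measurable_sampleIndex τ hJm) _ ?_
  rintro _ ⟨g, hg, i, ω, hω, rfl⟩
  have hgr := hreg.isRegularFun hg
  have hgc := hgr.lipschitz.continuous
  have h2θ : (2 : ℝ≥0∞) ^ θ ≤ 2 := by
    calc (2 : ℝ≥0∞) ^ θ ≤ 2 ^ (1 : ℝ) := ENNReal.rpow_le_rpow_of_exponent_le (by norm_num) hθ₁
      _ = 2 := ENNReal.rpow_one 2
  have hB : ∀ j, (K : ℝ≥0∞) * regDist D (gs j) g ^ θ + η ≤ K * 2 + η := by
    intro j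
    gcongr
    refine (ENNReal.rpow_le_rpow ?_ hθ₀.le).trans h2θ
    exact regDist_le_two hreg.support_bound (hgs j).bound hgr.bound
  set e : ℝ≥0∞ := ENNReal.ofReal (Real.exp (-(headsRate * n))) with he
  have he1 : e ≤ 1 := by
    rw [he, ENNReal.ofReal_le_one, Real.exp_le_one_iff]
    have := mul_nonneg headsRate_pos.le (Nat.cast_nonneg (α := ℝ) n)
    linarith
  set r : (Fin ⌈(n : ℝ) / 3⌉₊ → Cov k) → ℝ≥0∞ := fun z =>
    regDist D (a.1 fun l => (z l, g (z l))) g with hr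
  have hrm : Measurable r := by
    have h1 : Measurable fun q : (Fin ⌈(n : ℝ) / 3⌉₊ → Cov k) × Cov k =>
        ‖a.1 (fun l => (q.1 l, g (q.1 l))) q.2 - g q.2‖ₑ ^ 2 := by
      have h3 : Measurable fun q : (Fin ⌈(n : ℝ) / 3⌉₊ → Cov k) × Cov k =>
          ((fun l => (q.1 l, g (q.1 l))), q.2) := by
        refine Measurable.prodMk (measurable_pi_lambda _ fun l => ?_) measurable_snd
        have h4 : Measurable fun q : (Fin ⌈(n : ℝ) / 3⌉₊ → Cov k) × Cov k => q.1 l := by fun_prop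
        exact h4.prodMk (hgc.measurable.comp h4)
      exact (((a.2.comp h3).sub (hgc.measurable.comp measurable_snd)).enorm).pow_const 2
    exact h1.lintegral_prod_right'.pow_const _
  have hreg1 : ∫⁻ z, (K * regDist D (gs (J fun l => (z l, g (z l)))) g ^ θ + η)
      ∂(Measure.pi fun _ => D)
      ≤ K * (2 * regMinimax ⌈(n : ℝ) / 3⌉₊ G D ^ θ) + η + η := by
    calc _ ≤ ∫⁻ z, (K * (2 * r z + 2 * δ) ^ θ + η) ∂(Measure.pi fun _ => D) := by
          refine lintegral_mono fun z => ?_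
          gcongr
          exact hJ _ _ hgc.measurable (hdense g hg δ (ENNReal.coe_pos.2 hδ₀))
      _ = K * ∫⁻ z, (2 * r z + 2 * δ) ^ θ ∂(Measure.pi fun _ => D) + η := by
          rw [lintegral_add_right _ measurable_const, lintegral_const_mul _ (by fun_prop)]
          simp
      _ ≤ K * (∫⁻ z, (2 * r z + 2 * δ) ∂(Measure.pi fun _ => D)) ^ θ + η := by
          gcongr
          exact lintegral_rpow_le_rpow_lintegral _ (by fun_prop) hθ₀ hθ₁
      _ ≤ K * (2 * regMinimax ⌈(n : ℝ) / 3⌉₊ G D + 4 * δ) ^ θ + η := by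
          gcongr
          rw [lintegral_add_right _ measurable_const, lintegral_const_mul _ hrm]
          simp only [lintegral_const, measure_univ, mul_one]
          calc _ ≤ 2 * (regMinimax ⌈(n : ℝ) / 3⌉₊ G D + δ) + 2 * (δ : ℝ≥0∞) := by
                gcongr
                exact ha g hg
            _ = _ := by ring
      _ ≤ K * (2 ^ θ * regMinimax ⌈(n : ℝ) / 3⌉₊ G D ^ θ + (4 * δ) ^ θ) + η := by
          gcongr
          rw [← ENNReal.mul_rpow_of_nonneg _ _ hθ₀.le]
          exact ENNReal.rpow_add_le_add_rpow _ _ hθ₀.le hθ₁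
      _ ≤ _ := by
          rw [mul_add]
          gcongr
  calc _ ≤ ∫⁻ S, (K * regDist D (gs (sampleIndex τ J S)) g ^ θ + η)
        ∂(sampleLaw (expertPolicy τ g i) (dynamics τ g i ω) (initLaw D Δ) n (H + 1)) :=
        lintegral_mono fun S => (hPQ _).2 g hgr i ω hω
    _ ≤ (K * 2 + η) * e + ∫⁻ z, (K * regDist D (gs (J fun l => (z l, g (z l)))) g ^ θ + η)
          ∂(Measure.pi fun _ => D) :=
        lintegral_sampleIndex_le hreg.support_bound hτ hΔ₀ hΔ₁ hJm hgc i ω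
          (Ψ := fun j => (K : ℝ≥0∞) * regDist D (gs j) g ^ θ + η) hB
    _ ≤ (K * 2 * e + η * 1) + (K * (2 * regMinimax ⌈(n : ℝ) / 3⌉₊ G D ^ θ) + η + η) := by
        rw [add_mul]
        gcongr
    _ = 2 * K * (e + regMinimax ⌈(n : ℝ) / 3⌉₊ G D ^ θ) + (η + η + η) := by ring
    _ = _ := by
        congr 1
        rw [← ENNReal.coe_add, ← ENNReal.coe_add]
        congr 1
        rw [hη]
        ring

end Reduction

/-! ### Dimension-free bounds for the derivatives of the localized regression functions -/

section Smoothness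

variable {E F : Type} [NormedAddCommGroup E] [NormedSpace ℝ E] [NormedAddCommGroup F]
  [InnerProductSpace ℝ F]

theorem norm_iteratedFDeriv_two_clm {V W : Type} [NormedAddCommGroup V] [NormedSpace ℝ V]
    [NormedAddCommGroup W] [NormedSpace ℝ W] (l : V →L[ℝ] W) (x : V) :
    ‖iteratedFDeriv ℝ 2 l x‖ = 0 := by
  rw [← norm_iteratedFDeriv_fderiv, norm_iteratedFDeriv_one]
  have : fderiv ℝ (l : V → W) = fun _ => l := by ext1 y; exact l.fderiv
  rw [this, fderiv_fun_const]
  simp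

theorem norm_iteratedFDeriv_sq_le {y : F} (hy : ‖y‖ ≤ 2) {i : ℕ}
    (hi₁ : 1 ≤ i) (hi₂ : i ≤ 2) :
    ‖iteratedFDeriv ℝ i (fun y : F => (4 - ‖y‖ ^ 2) / 3) y‖ ≤ 2 ^ i := by
  have hd : fderiv ℝ (fun y : F => (4 - ‖y‖ ^ 2) / 3)
      = fun y => ((-(2 / 3) : ℝ) • innerSL ℝ : F →L[ℝ] F →L[ℝ] ℝ) y := by
    funext y
    have h1 := (hasStrictFDerivAt_norm_sq y).hasFDerivAt
    have h2 := (h1.const_sub 4).mul_const (3⁻¹ : ℝ)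
    simp only [← div_eq_mul_inv] at h2
    rw [h2.fderiv]
    ext v
    simp
    ring
  have hn : ‖((-(2 / 3) : ℝ) • innerSL ℝ : F →L[ℝ] F →L[ℝ] ℝ)‖ ≤ 1 := by
    refine ContinuousLinearMap.opNorm_le_bound _ zero_le_one fun v => ?_
    rw [smul_apply, norm_smul, innerSL_apply_norm]
    norm_num
    linarith [norm_nonneg v]
  interval_cases i
  · rw [norm_iteratedFDeriv_one, hd]
    refine (ContinuousLinearMap.le_of_opNorm_le _ hn y).trans ?_
    linarith
  · rw [← norm_iteratedFDeriv_fderiv, hd, norm_iteratedFDeriv_one, ContinuousLinearMap.fderiv]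
    refine hn.trans (by norm_num)

theorem exists_smoothTransition_bound :
    ∃ B : ℝ, 1 ≤ B ∧ ∀ s ∈ Set.Icc (0 : ℝ) (4 / 3), ∀ i ≤ 2,
      ‖iteratedFDeriv ℝ i Real.smoothTransition s‖ ≤ B := by
  have h : ∀ i : ℕ, ∃ B, ∀ s ∈ Set.Icc (0 : ℝ) (4 / 3),
      ‖iteratedFDeriv ℝ i Real.smoothTransition s‖ ≤ B := by
    intro i
    have hc : Continuous (iteratedFDeriv ℝ i Real.smoothTransition) :=
      (Real.smoothTransition.contDiff (n := ⊤)).continuous_iteratedFDeriv (by exact_mod_cast le_top)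
    exact isCompact_Icc.exists_bound_of_continuousOn hc.continuousOn
  choose B hB using h
  refine ⟨1 + |B 0| + |B 1| + |B 2|,
    by linarith [abs_nonneg (B 0), abs_nonneg (B 1), abs_nonneg (B 2)], fun s hs i hi =>
    (hB i s hs).trans ?_⟩
  interval_cases i <;> linarith [le_abs_self (B 0), le_abs_self (B 1), le_abs_self (B 2),
    abs_nonneg (B 0), abs_nonneg (B 1), abs_nonneg (B 2)]

theorem norm_iteratedFDeriv_bump_le {B : ℝ} (hB₁ : 1 ≤ B)
    (hB : ∀ s ∈ Set.Icc (0 : ℝ) (4 / 3), ∀ i ≤ 2,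
      ‖iteratedFDeriv ℝ i Real.smoothTransition s‖ ≤ B)
    {y : F} (hy : ‖y‖ ≤ 2) {i : ℕ} (hi : i ≤ 2) :
    ‖iteratedFDeriv ℝ i (bump : F → ℝ) y‖ ≤ 8 * B := by
  have hq : ContDiff ℝ 2 (fun y : F => (4 - ‖y‖ ^ 2) / 3) :=
    (contDiff_const.sub (contDiff_norm_sq ℝ)).div_const 3
  have hmem : (4 - ‖y‖ ^ 2) / 3 ∈ Set.Icc (0 : ℝ) (4 / 3) := by
    constructor <;> nlinarith [norm_nonneg y]
  have h := norm_iteratedFDeriv_comp_le (g := Real.smoothTransition)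
    (Real.smoothTransition.contDiff (n := 2)) hq (n := i) (by exact_mod_cast hi) y (C := B) (D := 2)
    (fun j hj => hB _ hmem j (hj.trans hi))
    (fun j hj₁ hj₂ => norm_iteratedFDeriv_sq_le hy hj₁ (hj₂.trans hi))
  refine h.trans ?_
  interval_cases i <;> norm_num [Nat.factorial] <;> linarith

variable {k : ℕ}

/-- `projTail` as a continuous linear map. -/
noncomputable def projTailL : St k →L[ℝ] Cov k :=
  LinearMap.mkContinuous
    { toFun := projTail
      map_add' := fun x y => by ext j; simp [projTail]
      map_smul' := fun c x => by ext j; simp [projTail] } 1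
    fun x => by simpa using norm_projTail_le x

theorem norm_projTailL_le : ‖(projTailL : St k →L[ℝ] Cov k)‖ ≤ 1 :=
  LinearMap.mkContinuous_norm_le _ zero_le_one _

theorem IsRegularFun.contDiff {L₀ M₀ : ℝ≥0} {g : Cov k → ℝ} (hg : IsRegularFun L₀ M₀ g) :
    ContDiff ℝ 2 g ∧ ∀ z, ‖iteratedFDeriv ℝ 2 g z‖ ≤ M₀ := by
  have h := hg.smooth 1 (by simp)
  have e : (fun x => inner ℝ (1 : ℝ) (g x)) = g := by funext x; simp
  rw [e] at h
  exact ⟨h.1, fun z => by exact_mod_cast h.2 z⟩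

/-- The derivatives up to order two of `g ∘ projTail` on the ball of radius two. -/
theorem IsRegularFun.norm_iteratedFDeriv_comp_le {L₀ M₀ : ℝ≥0} {g : Cov k → ℝ}
    (hg : IsRegularFun L₀ M₀ g) {y : St k} (hy : ‖y‖ ≤ 2) {i : ℕ} (hi : i ≤ 2) :
    ‖iteratedFDeriv ℝ i (fun y => g (projTail y)) y‖ ≤ 1 + 2 * L₀ + M₀ := by
  obtain ⟨hc, hM⟩ := hg.contDiff
  have hL₀ : (0 : ℝ) ≤ L₀ := L₀.2
  have hM₀ : (0 : ℝ) ≤ M₀ := M₀.2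
  have hz : ∀ z : Cov k, ‖z‖ ≤ 2 → ∀ i ≤ 2, ‖iteratedFDeriv ℝ i g z‖ ≤ 1 + 2 * L₀ + M₀ := by
    intro z hz i hi
    interval_cases i
    · rw [norm_iteratedFDeriv_zero]
      have h1 := hg.lipschitz.norm_sub_le z 0
      have h2 := hg.bound 0 (by simp)
      have h3 := norm_sub_norm_le (g z) (g 0)
      rw [Real.norm_eq_abs (g 0)] at h3
      rw [sub_zero] at h1
      have := mul_le_mul_of_nonneg_left hz hL₀
      linarith
    · rw [norm_iteratedFDeriv_one]
      have := norm_fderiv_le_of_lipschitz ℝ hg.lipschitz (x₀ := z)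
      linarith
    · have := hM z
      linarith
  have e : (fun y : St k => g (projTail y)) = g ∘ (projTailL : St k →L[ℝ] Cov k) := rfl
  rw [e, ContinuousLinearMap.iteratedFDeriv_comp_right _ hc _ (by exact_mod_cast hi)]
  refine (ContinuousMultilinearMap.norm_compContinuousLinearMap_le _ _).trans ?_
  calc _ ≤ ‖iteratedFDeriv ℝ i g (projTailL y)‖ * 1 := by
        gcongr
        exact Finset.prod_le_one (fun _ _ => norm_nonneg _) fun _ _ => norm_projTailL_le
    _ ≤ _ := by
        rw [mul_one]
        exact hz _ ((norm_projTail_le y).trans hy) i hi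

variable [NeZero k]

/-- The localized regression functions are Lipschitz and smooth, with constants that do not depend
on the dimension. -/
theorem exists_localized_bound : ∃ C : ℝ≥0, ∀ (k : ℕ) [NeZero k] (L₀ M₀ : ℝ≥0) (g : Cov k → ℝ),
    IsRegularFun L₀ M₀ g → ContDiff ℝ 2 (localized g) ∧
      LipschitzWith (C * (1 + 2 * L₀ + M₀)) (localized g) ∧
      ∀ x, ‖iteratedFDeriv ℝ 2 (localized g) x‖ ≤ (C * (1 + 2 * L₀ + M₀) : ℝ≥0) := by
  obtain ⟨B, hB₁, hB⟩ := exists_smoothTransition_bound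
  refine ⟨⟨32 * B, by linarith⟩, fun k _ L₀ M₀ g hg => ?_⟩
  have hL₀ : (0 : ℝ) ≤ L₀ := L₀.2
  have hM₀ : (0 : ℝ) ≤ M₀ := M₀.2
  set A : ℝ := 1 + 2 * L₀ + M₀ with hA
  have hA₀ : 0 ≤ A := by positivity
  have hb : ContDiff ℝ 2 (bump : St k → ℝ) := contDiff_bump (n := 2)
  have hp : ContDiff ℝ 2 (fun y : St k => g (projTail y)) :=
    hg.contDiff.1.comp (projTailL (k := k)).contDiff
  set m : St k → ℝ := fun y => bump y * g (projTail y) with hm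
  have hmc : ContDiff ℝ 2 m := hb.mul hp
  have hmb : ∀ y : St k, ∀ i, 1 ≤ i → i ≤ 2 → ‖iteratedFDeriv ℝ i m y‖ ≤ 32 * B * A := by
    intro y i hi₁ hi
    by_cases hy : ‖y‖ ≤ 2
    · refine (norm_iteratedFDeriv_mul_le hb hp y (n := i) (by exact_mod_cast hi)).trans ?_
      have h1 : ∀ j ∈ Finset.range (i + 1), (i.choose j : ℝ) * ‖iteratedFDeriv ℝ j bump y‖ *
          ‖iteratedFDeriv ℝ (i - j) (fun y => g (projTail y)) y‖
            ≤ i.choose j * (8 * B * A) := by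
        intro j hj
        have hj : j ≤ i := by simpa [Nat.lt_succ_iff] using hj
        rw [mul_assoc]
        refine mul_le_mul_of_nonneg_left ?_ (by positivity)
        exact mul_le_mul (norm_iteratedFDeriv_bump_le hB₁ hB hy (hj.trans hi))
          (hg.norm_iteratedFDeriv_comp_le hy ((Nat.sub_le i j).trans hi)) (norm_nonneg _)
          (by linarith)
      refine (Finset.sum_le_sum h1).trans ?_
      rw [← Finset.sum_mul]
      have h2 : ∑ j ∈ Finset.range (i + 1), (i.choose j : ℝ) = 2 ^ i := by
        exact_mod_cast Nat.sum_range_choose i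
      have h3 : (2 : ℝ) ^ i ≤ 4 := by interval_cases i <;> norm_num
      rw [h2]
      have : 0 ≤ 8 * B * A := by positivity
      nlinarith
    · have h0 : m =ᶠ[nhds y] fun _ => 0 := by
        filter_upwards [(isOpen_lt continuous_const continuous_norm).mem_nhds (not_le.1 hy)]
          with w hw
        have : bump w = 0 := (bump_eq_zero_iff w).2 (le_of_lt hw)
        simp [hm, this]
      rw [(h0.iteratedFDeriv ℝ i).eq_of_nhds, iteratedFDeriv_const_of_ne (by omega)]
      simp only [Pi.zero_apply, norm_zero]
      positivity
  have e : localized g = fun x => m (x - xOffset) := rfl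
  have hcd : ContDiff ℝ 2 (localized g) := hmc.comp (contDiff_id.sub contDiff_const)
  have hall : ∀ x, ∀ i, 1 ≤ i → i ≤ 2 → ‖iteratedFDeriv ℝ i (localized g) x‖ ≤ 32 * B * A := by
    intro x i hi₁ hi
    rw [e, iteratedFDeriv_comp_sub]
    exact hmb _ i hi₁ hi
  refine ⟨hcd, ?_, fun x => hall x 2 (by norm_num) le_rfl⟩
  refine lipschitzWith_of_nnnorm_fderiv_le (hcd.differentiable (by norm_num)) fun x => ?_
  have := hall x 1 le_rfl (by norm_num)
  rw [norm_iteratedFDeriv_one] at this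
  exact this

/-- Adding a small multiple of a smooth scalar function to a linear map. -/
theorem lipschitz_smooth_linear_add {K Λ : ℝ≥0} {φ : E → ℝ} (hφ : ContDiff ℝ 2 φ)
    (hL : LipschitzWith K φ) (hM : ∀ x, ‖iteratedFDeriv ℝ 2 φ x‖ ≤ K) {τ : ℝ} (hτ : |τ| ≤ 1)
    (l : E →L[ℝ] F) (hl : ‖l‖ ≤ Λ) {w : F} (hw : ‖w‖ ≤ 1) :
    LipschitzWith (Λ + K) (fun x => l x + (τ * φ x) • w) ∧
      IsSmoothWith (K : ℝ≥0∞) (fun x => l x + (τ * φ x) • w) := by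
  constructor
  · refine (l.lipschitz.weaken hl).add ?_
    refine LipschitzWith.of_dist_le_mul fun x y => ?_
    rw [dist_eq_norm, ← sub_smul, ← mul_sub, norm_smul, norm_mul, Real.norm_eq_abs τ]
    have h1 := hL.norm_sub_le x y
    rw [dist_eq_norm]
    have h3 : |τ| * ‖φ x - φ y‖ ≤ 1 * ‖φ x - φ y‖ := by gcongr
    calc |τ| * ‖φ x - φ y‖ * ‖w‖ ≤ (1 * ‖φ x - φ y‖) * 1 := by gcongr
      _ ≤ _ := by simpa using h1
  · intro v hv
    have e : (fun x => inner ℝ v (l x + (τ * φ x) • w))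
        = fun x => ((innerSL ℝ v).comp l) x + (τ * inner ℝ v w) • φ x := by
      funext x
      simp [inner_add_right, inner_smul_right]
      ring
    rw [e]
    refine ⟨(ContinuousLinearMap.contDiff _).add (hφ.const_smul _), fun x => ?_⟩
    have h1 : iteratedFDeriv ℝ 2 (fun x => ((innerSL ℝ v).comp l) x + (τ * inner ℝ v w) • φ x) x
        = iteratedFDeriv ℝ 2 ((innerSL ℝ v).comp l) x
          + (τ * inner ℝ v w) • iteratedFDeriv ℝ 2 φ x := by
      rw [← iteratedFDeriv_const_smul_apply hφ.contDiffAt]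
      exact iteratedFDeriv_add_apply (ContinuousLinearMap.contDiff _).contDiffAt
        (hφ.const_smul _).contDiffAt
    have h2 : |τ * inner ℝ v w| ≤ 1 := by
      rw [abs_mul]
      have h := abs_real_inner_le_norm v w
      rw [hv, one_mul] at h
      exact mul_le_one₀ hτ (abs_nonneg _) (h.trans hw)
    have h3 : ‖iteratedFDeriv ℝ 2 (fun x => ((innerSL ℝ v).comp l) x
        + (τ * inner ℝ v w) • φ x) x‖ ≤ K := by
      rw [h1]
      refine (norm_add_le _ _).trans ?_
      rw [norm_iteratedFDeriv_two_clm, zero_add, norm_smul, Real.norm_eq_abs]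
      calc |τ * inner ℝ v w| * ‖iteratedFDeriv ℝ 2 φ x‖ ≤ 1 * K := by
            gcongr
            exact hM x
        _ = K := one_mul _
    exact_mod_cast h3

end Smoothness

/-! ### The trajectory risk of policies that agree with the expert near the origin -/

section Risk

/-- The squared cost of a history up to (and excluding) time `t`. -/
noncomputable def trajCost {X U : Type} [NormedAddCommGroup X] [NormedAddCommGroup U] (π : X → U)
    (f : X → U → X) (t : ℕ) (h : Hist X U t) : ℝ≥0∞ :=
  ∑ s : Fin t, (min (‖expertState π f (h.1 0) s - h.1 s.castSucc‖ₑ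
    + ‖π (expertState π f (h.1 0) s) - h.2 s‖ₑ) 1) ^ (2 : ℝ)

theorem trajCost_zero {X U : Type} [NormedAddCommGroup X] [NormedAddCommGroup U] (π : X → U)
    (f : X → U → X) (h : Hist X U 0) : trajCost π f 0 h = 0 := by
  simp [trajCost]

theorem trajCost_stepHist {X U : Type} [NormedAddCommGroup X] [NormedAddCommGroup U] (π : X → U)
    (f : X → U → X) (t : ℕ) (h : Hist X U t) (u : U) :
    trajCost π f (t + 1) (stepHist f h u) = trajCost π f t h
      + (min (‖expertState π f (h.1 0) t - h.1 (Fin.last t)‖ₑ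
        + ‖π (expertState π f (h.1 0) t) - u‖ₑ) 1) ^ (2 : ℝ) := by
  rw [trajCost, Fin.sum_univ_castSucc, trajCost]
  simp only [stepHist_fst_zero]
  simp [stepHist]

theorem trajCost_seqHist {X U : Type} [NormedAddCommGroup X] [NormedAddCommGroup U] (π : X → U)
    (f : X → U → X) (xs : ℕ → X) (us : ℕ → U) (t : ℕ) :
    trajCost π f t (seqHist xs us t) = ∑ s ∈ Finset.range t,
      (min (‖expertState π f (xs 0) s - xs s‖ₑ + ‖π (expertState π f (xs 0) s) - us s‖ₑ) 1)
        ^ (2 : ℝ) := by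
  rw [trajCost, ← Fin.sum_univ_eq_sum_range (fun s => (min (‖expertState π f (xs 0) s - xs s‖ₑ
    + ‖π (expertState π f (xs 0) s) - us s‖ₑ) 1) ^ (2 : ℝ))]
  simp [seqHist]

/-- An upper bound for an expectation by a potential that does not increase in expectation along the
histories with a property that is preserved almost surely. -/
theorem startExp_le_of_potential {X U : Type} [MeasurableSpace X] [MeasurableSpace U]
    (P : HistPolicy X U) (f : X → U → X) (x : X) (Good : ∀ t, Hist X U t → Prop)
    (h₀ : Good 0 (initHist x))
    (hs : ∀ t h, Good t h → ∀ᵐ u ∂(P.kernel t h), Good (t + 1) (stepHist f h u))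
    (G : ∀ t, Hist X U t → ℝ≥0∞)
    (hG : ∀ t h, Good t h → ∫⁻ u, G (t + 1) (stepHist f h u) ∂(P.kernel t h) ≤ G t h) (t : ℕ) :
    startExp P f t (G t) x ≤ G 0 (initHist x) := by
  have hmono : ∀ t, ∀ F F' : Hist X U t → ℝ≥0∞, (∀ h, Good t h → F h ≤ F' h) →
      startExp P f t F x ≤ startExp P f t F' x := by
    intro t
    induction t with
    | zero => exact fun F F' h => h _ h₀
    | succ t ih =>
      intro F F' h
      refine ih _ _ fun h' hh' => lintegral_mono_ae ?_
      filter_upwards [hs t h' hh'] with u hu using h _ hu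
  induction t with
  | zero => exact le_rfl
  | succ t ih => exact (hmono t _ _ fun h hh => hG t h hh).trans ih

theorem min_one_rpow_two_le {A : ℝ≥0∞} {c : ℝ} (hc : 0 ≤ c) (h : A ≤ ENNReal.ofReal c) :
    (min A 1) ^ (2 : ℝ) ≤ ENNReal.ofReal (c ^ 2) := by
  rw [ENNReal.ofReal_pow hc, ← ENNReal.rpow_two]
  exact ENNReal.rpow_le_rpow ((min_le_left _ _).trans h) (by norm_num)

variable {k : ℕ}

theorem abs_snd_le_norm (x : St k) : |x (Sum.inl 1)| ≤ ‖x‖ := PiLp.norm_apply_le x (Sum.inl 1)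

theorem enorm_plane_le {p q b : ℝ} (h : |p| + |q| ≤ b) :
    ‖(plane p q : St k)‖ₑ ≤ ENNReal.ofReal b := by
  rw [← ofReal_norm]
  exact ENNReal.ofReal_le_ofReal ((norm_plane_le p q).trans h)

theorem measurable_trajCost {π : St k → St k} {f : St k → St k → St k} (hπm : Measurable π)
    (hfm : Measurable (Function.uncurry f)) (H : ℕ) : Measurable (trajCost π f H) := by
  refine Finset.measurable_sum _ fun s _ => ?_
  have h1 : Measurable fun h : Hist (St k) (St k) H => expertState π f (h.1 0) s :=
    ((measurable_expertTraj hπm hfm H).2 s).comp (by fun_prop)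
  have h2 : Measurable fun h : Hist (St k) (St k) H => π (expertState π f (h.1 0) s) :=
    hπm.comp h1
  have h3 : Measurable fun h : Hist (St k) (St k) H => h.1 s.castSucc := by fun_prop
  have h4 : Measurable fun h : Hist (St k) (St k) H => h.2 s := by fun_prop
  exact ((((h1.sub h3).enorm).add (h2.sub h4).enorm).min measurable_const).pow_const _

variable [NeZero k]

/-- The properties of the initial states near the origin: on them, all experts are the same. -/
def IsNear (x : St k) : Prop := x (Sum.inl 0) = 0 ∧ ‖x‖ ≤ 1

theorem expertState_of_isNear (τ : ℝ) (g : Cov k → ℝ) (i : Fin 2) (ω : ℝ) {x : St k}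
    (hx : IsNear x) (t : ℕ) :
    IsNear (expertState (expertPolicy τ g i) (dynamics τ g i ω) x t) ∧
      expertState (expertPolicy τ g i) (dynamics τ g i ω) x t (Sum.inl 1)
        = x (Sum.inl 1) / 2 ^ t := by
  induction t with
  | zero => exact ⟨hx, by simp [expertState]⟩
  | succ t ih =>
    obtain ⟨⟨ih₁, ih₂⟩, ih₃⟩ := ih
    have hb := bump_sub_xOffset_of_norm_le ih₂
    rw [expertState, expertPolicy_of_fst_eq_zero τ g i ih₁ hb,
      dynamics_of_fst_eq_zero τ g i ω ih₁ hb]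
    refine ⟨⟨rfl, (norm_plane_le _ _).trans ?_⟩, ?_⟩
    · have := (abs_snd_le_norm _).trans ih₂
      rw [abs_zero, zero_add, abs_div, abs_two]
      linarith
    · rw [plane_inl_one, ih₃, pow_succ]
      field_simp

theorem IsNear.expertPolicy_eq (τ : ℝ) (g : Cov k → ℝ) (i : Fin 2) {x : St k} (hx : IsNear x) :
    expertPolicy τ g i x = plane (-(3 / 8) * x (Sum.inl 1)) 0 :=
  expertPolicy_of_fst_eq_zero τ g i hx.1 (bump_sub_xOffset_of_norm_le hx.2)

/-- If a policy plays the expert's inputs on the expert trajectories from near the origin, then its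
risk is determined by the trajectories from near the offset. -/
theorem trajRisk_le_of_near {D : Measure (Cov k)} [IsProbabilityMeasure D] {τ Δ : ℝ}
    (hΔ₀ : 0 < Δ) (hΔ₁ : Δ < 1) (H : ℕ) (P : HistPolicy (St k) (St k)) {g : Cov k → ℝ}
    (hg : Continuous g) (i : Fin 2) (ω : ℝ)
    (hP : ∀ xs : ℕ → St k, (∀ t, IsNear (xs t)) →
      (∀ t, xs t (Sum.inl 1) = xs 0 (Sum.inl 1) / 2 ^ t) → ∀ us : ℕ → St k,
      ∀ t, P.kernel t (seqHist xs us t) = Measure.dirac (plane (-(3 / 8) * xs t (Sum.inl 1)) 0)) :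
    trajRisk 2 P (expertPolicy τ g i) (dynamics τ g i ω) (initLaw D Δ) H
      ≤ (∫⁻ z, startExp P (dynamics τ g i ω) H (trajCost (expertPolicy τ g i) (dynamics τ g i ω) H)
          (xOffset + embTail z) ∂D) ^ (1 / 2 : ℝ) := by
  set π := expertPolicy τ g i with hπ
  set f := dynamics τ g i ω with hf
  have hπm : Measurable π := (continuous_expertPolicy τ hg i).measurable
  have hfm : Measurable (Function.uncurry f) := (continuous_dynamics τ hg i ω).measurable
  have hcost : Measurable (trajCost π f H) := measurable_trajCost hπm hfm H
  have hoff : Measurable fun z : Cov k => (xOffset + embTail z : St k) :=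
    (continuous_const.add continuous_embTail).measurable
  have : IsProbabilityMeasure (initLaw D Δ) := by
    constructor
    have := Measure.isProbabilityMeasure_map (μ := D) hoff.aemeasurable
    rw [initLaw_eq]
    simp [ENNReal.inv_two_add_inv_two]
  have hnear : ∀ x, IsNear x → startExp P f H (trajCost π f H) x = 0 := by
    intro x hx
    have h := startExp_eq_of_dirac P f (expertState π f x) (fun t => π (expertState π f x t))
      (fun t => rfl) (fun t => ?_) H hcost hfm
    · rw [expertState] at h
      rw [h, trajCost_seqHist]
      simp [expertState]
    · rw [hP _ (fun t => (expertState_of_isNear τ g i ω hx t).1)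
        (fun t => (expertState_of_isNear τ g i ω hx t).2)]
      rw [hπ, (expertState_of_isNear τ g i ω hx t).1.expertPolicy_eq]
  have e : trajRisk 2 P π f (initLaw D Δ) H
      = (∫⁻ x, startExp P f H (trajCost π f H) x ∂(initLaw D Δ)) ^ (1 / 2 : ℝ) := by
    rw [← (lintegral_trajLaw P hfm (initLaw D Δ) H).2 _ hcost]
    rfl
  rw [e]
  refine ENNReal.rpow_le_rpow ?_ (by norm_num)
  rw [initLaw_eq, lintegral_add_measure, lintegral_smul_measure, lintegral_smul_measure]
  have h0 : ∫⁻ x, startExp P f H (trajCost π f H) x ∂(nearLaw k Δ) = 0 := by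
    rw [lintegral_congr_ae (g := fun _ => 0), lintegral_zero]
    filter_upwards [ae_nearLaw hΔ₀ hΔ₁] with x hx using hnear x hx
  rw [h0, smul_zero, add_zero, smul_eq_mul]
  calc _ ≤ 1 * ∫⁻ x, startExp P f H (trajCost π f H) x ∂(D.map fun z => xOffset + embTail z) := by
        gcongr
        exact ENNReal.half_le_self
    _ ≤ _ := by
        rw [one_mul]
        exact lintegral_map_le _ _

/-- From the offset, the expert returns to the origin in one step. -/
theorem expertState_offset {τ : ℝ} (hτ₀ : 0 < τ) (hτ₁ : τ < 1) {g : Cov k → ℝ}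
    (hg : ∀ z, ‖z‖ ≤ 1 → |g z| ≤ 1) (i : Fin 2) (ω : ℝ) {z : Cov k} (hz : ‖z‖ ≤ 1) (t : ℕ) :
    expertState (expertPolicy τ g i) (dynamics τ g i ω) (xOffset + embTail z) (t + 1) = 0 := by
  have hτg : |τ * g z| ≤ 1 := by
    rw [abs_mul, abs_of_pos hτ₀]
    exact mul_le_one₀ hτ₁.le (abs_nonneg _) (hg z hz)
  induction t with
  | zero =>
    rw [expertState, expertState, expertPolicy_offset τ g i hz,
      dynamics_offset hτ₀.ne' g i ω hz hτg]
    simp [plane_zero]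
  | succ t ih =>
    have h0 : IsNear (0 : St k) := ⟨rfl, by simp⟩
    rw [expertState, ih, h0.expertPolicy_eq,
      dynamics_of_fst_eq_zero τ g i ω h0.1 (bump_sub_xOffset_of_norm_le h0.2)]
    simp [plane_zero]

theorem expertPolicy_zero (τ : ℝ) (g : Cov k → ℝ) (i : Fin 2) :
    expertPolicy τ g i (0 : St k) = 0 := by
  have h0 : IsNear (0 : St k) := ⟨rfl, by simp⟩
  rw [h0.expertPolicy_eq]
  simp [plane_zero]

/-- Sequences of states and inputs that follow the planar dynamics `A_i`. -/
def IsPlanarTraj (i : Fin 2) (α β p q : ℕ → ℝ) : Prop :=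
  ∀ t, α (t + 1) = ![5 / 4, -(15 / 16)] i * α t + 3 / 8 * β t + p t ∧
    β (t + 1) = ![-(3 / 8), 0] i * α t + 1 / 2 * β t + q t

/-- A state sequence that leaves the offset for the plane. -/
noncomputable def offState (z : Cov k) (α β : ℕ → ℝ) : ℕ → St k
  | 0 => xOffset + embTail z
  | t + 1 => plane (α t) (β t)

/-- An input sequence with first input `v`. -/
noncomputable def offInput (v : ℝ) (p q : ℕ → ℝ) : ℕ → St k
  | 0 => plane v 0
  | t + 1 => plane (p t) (q t)

theorem IsPlanarTraj.dynamics_eq {i : Fin 2} {α β p q : ℕ → ℝ} (h : IsPlanarTraj i α β p q)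
    (τ : ℝ) (g : Cov k → ℝ) (ω : ℝ) (t : ℕ) :
    dynamics τ g i ω (plane (α t) (β t)) (plane (p t) (q t))
      = (plane (α (t + 1)) (β (t + 1)) : St k) := by
  obtain ⟨h1, h2⟩ := h t
  fin_cases i
  · simp only [Fin.zero_eta, Matrix.cons_val_zero] at h1 h2 ⊢
    rw [dynamics_plane_zero, h1, h2]
  · simp only [Fin.mk_one, Matrix.cons_val_one, Matrix.cons_val_fin_one, zero_mul, zero_add]
      at h1 h2 ⊢
    rw [dynamics_plane_one, h1, h2]

/-- The cost of a trajectory from the offset that a policy follows with probability one. -/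
theorem startExp_offset_le {τ : ℝ} (hτ₀ : 0 < τ) (hτ₁ : τ < 1) {g : Cov k → ℝ}
    (hgc : Continuous g) (hg : ∀ z, ‖z‖ ≤ 1 → |g z| ≤ 1) {i : Fin 2} {ω : ℝ} {z : Cov k}
    (hz : ‖z‖ ≤ 1) (P : HistPolicy (St k) (St k)) (H : ℕ) {y : ℝ} (hy : |y| ≤ 1)
    {α β p q : ℕ → ℝ} (hα : α 0 = τ * (1 - ω * τ) * (y - g z)) (hβ : β 0 = 0)
    (htraj : IsPlanarTraj i α β p q)
    (hP : ∀ t, P.kernel t (seqHist (offState z α β) (offInput (τ * y) p q) t)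
      = Measure.dirac (offInput (τ * y) p q t))
    {b : ℕ → ℝ} (hb : ∀ t, |α t| + |β t| + (|p t| + |q t|) ≤ b t) :
    startExp P (dynamics τ g i ω) H (trajCost (expertPolicy τ g i) (dynamics τ g i ω) H)
        (xOffset + embTail z)
      ≤ ENNReal.ofReal ((τ * (y - g z)) ^ 2 + ∑ t ∈ Finset.range H, b t ^ 2) := by
  have hτy : |τ * y| ≤ 1 := by
    rw [abs_mul, abs_of_pos hτ₀]
    exact mul_le_one₀ hτ₁.le (abs_nonneg _) hy
  have hfm : Measurable (Function.uncurry (dynamics τ g i ω)) :=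
    (continuous_dynamics τ hgc i ω).measurable
  have hπm := (continuous_expertPolicy (k := k) τ hgc i).measurable
  set π := expertPolicy τ g i with hπ
  set f := dynamics τ g i ω with hf
  have hcost : Measurable (trajCost π f H) := measurable_trajCost hπm hfm H
  have h := startExp_eq_of_dirac P f (offState z α β) (offInput (τ * y) p q) (fun t => ?_) hP H
    hcost hfm
  · have h0 : offState z α β 0 = xOffset + embTail z := rfl
    rw [h0] at h
    rw [h, trajCost_seqHist, h0]
    have hb0 : ∀ t, 0 ≤ b t := fun t => le_trans (by positivity) (hb t)
    have hterm : ∀ t, (min (‖expertState π f (xOffset + embTail z) t - offState z α β t‖ₑ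
        + ‖π (expertState π f (xOffset + embTail z) t) - offInput (τ * y) p q t‖ₑ) 1) ^ (2 : ℝ)
        ≤ ENNReal.ofReal (match t with
          | 0 => (τ * (y - g z)) ^ 2
          | t + 1 => b t ^ 2) := by
      intro t
      rcases t with _ | t
      · simp only [expertState, offState, offInput, sub_self, enorm_zero, zero_add]
        rw [hπ, expertPolicy_offset τ g i hz, plane_sub, sub_zero,
          ← sq_abs]
        refine min_one_rpow_two_le (abs_nonneg _) (enorm_plane_le ?_)
        rw [← mul_sub, abs_zero, add_zero, ← abs_neg, ← mul_neg, neg_sub]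
      · rw [expertState_offset hτ₀ hτ₁ hg i ω hz, hπ, expertPolicy_zero, zero_sub, zero_sub,
          enorm_neg, enorm_neg]
        refine min_one_rpow_two_le (hb0 t) ?_
        refine (add_le_add (enorm_plane_le le_rfl) (enorm_plane_le le_rfl)).trans ?_
        rw [← ENNReal.ofReal_add (by positivity) (by positivity)]
        exact ENNReal.ofReal_le_ofReal (hb t)
    refine (Finset.sum_le_sum fun t _ => hterm t).trans ?_
    rw [← ENNReal.ofReal_sum_of_nonneg]
    · refine ENNReal.ofReal_le_ofReal ?_
      refine (Finset.sum_le_sum_of_subset_of_nonneg (Finset.range_subset_range.2 H.le_succ)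
        fun t _ _ => ?_).trans ?_
      · rcases t with _ | t <;> simp only <;> positivity
      · rw [Finset.sum_range_succ', add_comm]
    · intro t _
      rcases t with _ | t <;> simp only <;> positivity
  · rcases t with _ | t
    · rw [offState, offState, offInput, hf, dynamics_offset hτ₀.ne' g i ω hz hτy, hα, hβ]
    · exact (htraj.dynamics_eq τ g ω t).symm

theorem trajRisk_le_of_sq {D : Measure (Cov k)} [IsProbabilityMeasure D]
    (hD : ∀ᵐ z ∂D, ‖z‖ ≤ 1) {τ Δ : ℝ} (hΔ₀ : 0 < Δ) (hΔ₁ : Δ < 1) (H : ℕ)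
    (P : HistPolicy (St k) (St k)) {g y : Cov k → ℝ} (hg : Continuous g) (hy : Continuous y)
    (i : Fin 2) (ω : ℝ)
    (hP : ∀ xs : ℕ → St k, (∀ t, IsNear (xs t)) →
      (∀ t, xs t (Sum.inl 1) = xs 0 (Sum.inl 1) / 2 ^ t) → ∀ us : ℕ → St k,
      ∀ t, P.kernel t (seqHist xs us t) = Measure.dirac (plane (-(3 / 8) * xs t (Sum.inl 1)) 0))
    {K η : ℝ≥0}
    (h : ∀ z, ‖z‖ ≤ 1 → startExp P (dynamics τ g i ω) H
        (trajCost (expertPolicy τ g i) (dynamics τ g i ω) H) (xOffset + embTail z)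
      ≤ ENNReal.ofReal ((K * (y z - g z)) ^ 2 + (η : ℝ) ^ 2)) :
    trajRisk 2 P (expertPolicy τ g i) (dynamics τ g i ω) (initLaw D Δ) H
      ≤ K * regDist D y g + η := by
  refine (trajRisk_le_of_near hΔ₀ hΔ₁ H P hg i ω hP).trans ?_
  have h1 : ∀ z, ENNReal.ofReal ((K * (y z - g z)) ^ 2 + (η : ℝ) ^ 2)
      = (K : ℝ≥0∞) ^ 2 * ‖y z - g z‖ₑ ^ 2 + (η : ℝ≥0∞) ^ 2 := by
    intro z
    rw [ENNReal.ofReal_add (by positivity) (by positivity), ← sq_abs, abs_mul, mul_pow,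
      ENNReal.ofReal_mul (by positivity), ENNReal.ofReal_pow (abs_nonneg _),
      ENNReal.ofReal_pow (abs_nonneg _), ENNReal.ofReal_pow η.coe_nonneg,
      ← Real.norm_eq_abs (y z - g z), ofReal_norm, abs_of_nonneg K.coe_nonneg,
      ENNReal.ofReal_coe_nnreal, ENNReal.ofReal_coe_nnreal]
  have hm : Measurable fun z => ‖y z - g z‖ₑ ^ 2 := ((hy.sub hg).measurable.enorm).pow_const 2
  calc _ ≤ (∫⁻ z, ((K : ℝ≥0∞) ^ 2 * ‖y z - g z‖ₑ ^ 2 + (η : ℝ≥0∞) ^ 2) ∂D) ^ (1 / 2 : ℝ) := by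
        refine ENNReal.rpow_le_rpow (lintegral_mono_ae ?_) (by norm_num)
        filter_upwards [hD] with z hz
        exact (h z hz).trans (h1 z).le
    _ = ((K : ℝ≥0∞) ^ 2 * ∫⁻ z, ‖y z - g z‖ₑ ^ 2 ∂D + (η : ℝ≥0∞) ^ 2) ^ (1 / 2 : ℝ) := by
        rw [lintegral_add_right _ measurable_const, lintegral_const_mul _ hm]
        simp
    _ ≤ ((K : ℝ≥0∞) ^ 2 * ∫⁻ z, ‖y z - g z‖ₑ ^ 2 ∂D) ^ (1 / 2 : ℝ)
          + ((η : ℝ≥0∞) ^ 2) ^ (1 / 2 : ℝ) :=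
        ENNReal.rpow_add_le_add_rpow _ _ (by norm_num) (by norm_num)
    _ = _ := by
        have h2 : ∀ c : ℝ≥0∞, (c ^ 2) ^ (1 / 2 : ℝ) = c := by
          intro c
          rw [← ENNReal.rpow_two, ← ENNReal.rpow_mul]
          norm_num
        rw [ENNReal.mul_rpow_of_nonneg _ _ (by norm_num), h2, h2, regDist]

end Risk

/-! ### Linear feedback with a localized correction -/

section Feedback

/-- The policy that plays `φ t h` at time `t` after the history `h`. -/
noncomputable def detPolicy {X U : Type} [MeasurableSpace X] [MeasurableSpace U]
    (φ : ∀ t, Hist X U t → U) (hφ : ∀ t, Measurable (φ t)) : HistPolicy X U where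
  kernel t := Kernel.deterministic (φ t) (hφ t)
  isMarkov _ := inferInstance

theorem detPolicy_apply {X U : Type} [MeasurableSpace X] [MeasurableSpace U]
    (φ : ∀ t, Hist X U t → U) (hφ : ∀ t, Measurable (φ t)) (t : ℕ) (h : Hist X U t) :
    (detPolicy φ hφ).kernel t h = Measure.dirac (φ t h) :=
  Kernel.deterministic_apply (hφ t) h

variable {k : ℕ}

/-- The linear map `x ↦ (p x₁ + q x₂, r x₁ + s x₂, 0)`. -/
noncomputable def planeL (p q r s : ℝ) : St k →L[ℝ] St k :=
  LinearMap.mkContinuous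
    { toFun := fun x => plane (p * x (Sum.inl 0) + q * x (Sum.inl 1))
        (r * x (Sum.inl 0) + s * x (Sum.inl 1))
      map_add' := fun x y => by
        rw [plane_add]
        congr 1 <;> simp <;> ring
      map_smul' := fun c x => by
        rw [smul_plane]
        congr 1 <;> simp <;> ring } (|p| + |q| + |r| + |s|)
    fun x => by
      have h0 : |x (Sum.inl 0)| ≤ ‖x‖ := PiLp.norm_apply_le x (Sum.inl 0)
      have h1 := abs_snd_le_norm x
      refine (norm_plane_le _ _).trans ?_
      calc _ ≤ (|p| * |x (Sum.inl 0)| + |q| * |x (Sum.inl 1)|)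
            + (|r| * |x (Sum.inl 0)| + |s| * |x (Sum.inl 1)|) := by
            rw [← abs_mul, ← abs_mul, ← abs_mul, ← abs_mul]
            exact add_le_add (abs_add_le _ _) (abs_add_le _ _)
        _ ≤ (|p| * ‖x‖ + |q| * ‖x‖) + (|r| * ‖x‖ + |s| * ‖x‖) := by gcongr
        _ = _ := by ring

theorem planeL_apply (p q r s : ℝ) (x : St k) :
    planeL p q r s x = plane (p * x (Sum.inl 0) + q * x (Sum.inl 1))
      (r * x (Sum.inl 0) + s * x (Sum.inl 1)) := rfl

theorem norm_planeL_le (p q r s : ℝ) :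
    ‖(planeL p q r s : St k →L[ℝ] St k)‖ ≤ |p| + |q| + |r| + |s| :=
  LinearMap.mkContinuous_norm_le _ (by positivity) _

variable [NeZero k]

/-- The linear feedback `c` in the first coordinate and `s` in the second, with the localized
correction that imitates the expert near the offset. -/
noncomputable def feedback (τ : ℝ) (g : Cov k → ℝ) (c s : ℝ) (x : St k) : St k :=
  planeL c s 0 0 x + (τ * localized g x) • e₁

theorem continuous_feedback (τ : ℝ) {g : Cov k → ℝ} (hg : Continuous g) (c s : ℝ) :
    Continuous (feedback τ g c s) :=
  (planeL c s 0 0).continuous.add ((continuous_const.mul (continuous_localized hg)).smul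
    continuous_const)

theorem feedback_offset (τ : ℝ) (g : Cov k → ℝ) (c s : ℝ) {z : Cov k} (hz : ‖z‖ ≤ 1) :
    feedback τ g c s (xOffset + embTail z) = plane (τ * g z) 0 := by
  rw [feedback, localized_offset g hz, planeL_apply, e₁_eq_plane, smul_plane, plane_add]
  simp

theorem feedback_plane (τ : ℝ) (g : Cov k → ℝ) (c s a b : ℝ) :
    feedback τ g c s (plane a b) = plane (c * a + s * b) 0 := by
  rw [feedback, localized_of_bump_eq_zero g (bump_plane_sub_xOffset a b), planeL_apply]
  simp

theorem feedback_of_isNear (τ : ℝ) (g : Cov k → ℝ) (c s : ℝ) {x : St k} (hx : IsNear x) :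
    feedback τ g c s x = plane (s * x (Sum.inl 1)) 0 := by
  rw [feedback, localized_of_bump_eq_zero g (bump_sub_xOffset_of_norm_le hx.2), planeL_apply, hx.1]
  simp

/-! ### Periodic and chunked policies -/

theorem sum_sq_div_two_pow_le (c : ℝ) (H : ℕ) :
    ∑ t ∈ Finset.range H, (c / 2 ^ t) ^ 2 ≤ 2 * c ^ 2 := by
  have h : ∀ H : ℕ, ∑ t ∈ Finset.range H, (c / 2 ^ t) ^ 2 ≤ 2 * c ^ 2 * (1 - (1 / 4) ^ H) := by
    intro H
    induction H with
    | zero => simp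
    | succ H ih =>
      rw [Finset.sum_range_succ]
      have e : (c / 2 ^ H) ^ 2 = c ^ 2 * (1 / 4) ^ H := by
        rw [div_pow, ← pow_mul, mul_comm H 2, pow_mul, one_div, inv_pow, div_eq_mul_inv]
        norm_num
      rw [e]
      have : 0 ≤ c ^ 2 * (1 / 4 : ℝ) ^ H := by positivity
      rw [pow_succ (1 / 4 : ℝ) H]
      nlinarith
  refine (h H).trans ?_
  have : 0 ≤ c ^ 2 * (1 / 4 : ℝ) ^ H := by positivity
  nlinarith

/-- The deviation after the first step is at most twice the error of the first input. -/
theorem abs_deviation_le {τ ω : ℝ} (hτ₀ : 0 < τ) (hτ₁ : τ < 1) (hω : ω ∈ ({-1, 1} : Set ℝ))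
    (d : ℝ) :
    |τ * (1 - ω * τ) * d| ≤ 2 * (τ * |d|) := by
  have h : |1 - ω * τ| ≤ 2 := by
    rcases hω with rfl | rfl <;> rw [abs_le] <;> constructor <;> linarith
  rw [abs_mul, abs_mul, abs_of_pos hτ₀]
  have : 0 ≤ τ * |d| := by positivity
  nlinarith

theorem cost_le_of_geometric {τ ω : ℝ} (hτ₀ : 0 < τ) (hτ₁ : τ < 1) (hω : ω ∈ ({-1, 1} : Set ℝ))
    (d : ℝ) (H : ℕ) :
    (τ * d) ^ 2 + ∑ t ∈ Finset.range H, (64 * |τ * (1 - ω * τ) * d| / 2 ^ t) ^ 2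
      ≤ (200 * τ * d) ^ 2 := by
  have h1 := abs_deviation_le hτ₀ hτ₁ hω d
  have h2 := sum_sq_div_two_pow_le (64 * |τ * (1 - ω * τ) * d|) H
  have h3 : (64 * |τ * (1 - ω * τ) * d|) ^ 2 ≤ (128 * (τ * |d|)) ^ 2 :=
    pow_le_pow_left₀ (by positivity) (by linarith) 2
  have h4 : (128 * (τ * |d|)) ^ 2 = 16384 * (τ * d) ^ 2 := by
    rw [mul_pow, mul_pow, sq_abs]; ring
  have h5 : 0 ≤ (τ * d) ^ 2 := sq_nonneg _
  nlinarith

/-- The gains of the periodic policy: after one step, it eliminates the first coordinate if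
`i = 1`, and in the next step it does so if `i = 2`. -/
noncomputable def periodGain : Fin 3 → ℝ := ![0, -(5 / 4), 15 / 16]

/-- The deterministic policy of period three with these gains. At the first step of a period, the
first coordinate is always zero, so that any gain would do there. -/
noncomputable def periodPolicy (τ : ℝ) {g : Cov k → ℝ} (hg : Continuous g) :
    HistPolicy (St k) (St k) :=
  detPolicy (fun t h => feedback τ g (periodGain (Fin.ofNat 3 t)) (-(3 / 8)) (h.1 (Fin.last t)))
    fun t => (continuous_feedback τ hg _ _).measurable.comp (by fun_prop)

/-- On the planar trajectory of the periodic policy, the first coordinate vanishes after one step if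
`i = 1` and after two steps if `i = 2`, and the second coordinate decays. -/
theorem exists_period_traj (i : Fin 2) (a : ℝ) : ∃ α β p : ℕ → ℝ, α 0 = a ∧ β 0 = 0 ∧
    IsPlanarTraj i α β p (fun _ => 0) ∧
    (∀ t, p t = periodGain (Fin.ofNat 3 (t + 1)) * α t + -(3 / 8) * β t) ∧
    ∀ t, |α t| + |β t| + (|p t| + |(0 : ℝ)|) ≤ 64 * |a| / 2 ^ t := by
  have ha := abs_nonneg a
  fin_cases i
  · refine ⟨fun t => if t = 0 then a else 0, fun t => match t with
        | 0 => 0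
        | t + 1 => -(3 / 8) * a / 2 ^ t, fun t => match t with
        | 0 => -(5 / 4) * a
        | t + 1 => 9 / 64 * a / 2 ^ t, by simp, rfl, ?_, ?_, ?_⟩
    · rintro (_ | t)
      · refine ⟨?_, ?_⟩ <;> simp
      · refine ⟨?_, ?_⟩ <;> simp [pow_succ] <;> ring
    · rintro (_ | t)
      · change -(5 / 4) * a = -(5 / 4) * a + -(3 / 8) * 0
        ring
      · simp; ring
    · rintro (_ | t)
      · simp [abs_mul, abs_div]; norm_num; linarith
      · simp only [Nat.add_eq_zero_iff, one_ne_zero, and_false, if_false, abs_zero, zero_add,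
          add_zero, abs_mul, abs_div, abs_neg, abs_pow, abs_two]
        have h2 : (0 : ℝ) ≤ |a| / 2 ^ t := by positivity
        have e : 64 * |a| / 2 ^ (t + 1) = 32 * (|a| / 2 ^ t) := by rw [pow_succ]; field_simp; ring
        rw [e, mul_div_assoc, mul_div_assoc]
        norm_num
        linarith
  · refine ⟨fun t => match t with
        | 0 => a
        | 1 => -(35 / 16) * a
        | _ => 0, fun _ => 0, fun t => match t with
        | 0 => -(5 / 4) * a
        | 1 => -(525 / 256) * a
        | _ => 0, rfl, rfl, ?_, ?_, ?_⟩
    · rintro (_ | _ | t)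
      · refine ⟨?_, by simp⟩
        simp
        ring
      · refine ⟨?_, by simp⟩
        simp
        ring
      · simp
    · rintro (_ | _ | t)
      · change -(5 / 4) * a = -(5 / 4) * a + -(3 / 8) * 0
        ring
      · simp [periodGain, Fin.ofNat]; ring
      · simp
    · rintro (_ | _ | t)
      · simp [abs_mul, abs_div]; norm_num; linarith
      · simp [abs_mul, abs_div]; norm_num; linarith
      · simp; positivity

theorem trajRisk_periodPolicy_le {D : Measure (Cov k)} [IsProbabilityMeasure D]
    (hD : ∀ᵐ z ∂D, ‖z‖ ≤ 1) {τ Δ : ℝ} (hτ₀ : 0 < τ) (hτ₁ : τ < 1) (hΔ₀ : 0 < Δ) (hΔ₁ : Δ < 1)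
    (H : ℕ) {L₀ M₀ : ℝ≥0} {y g : Cov k → ℝ} (hy : IsRegularFun L₀ M₀ y)
    (hg : IsRegularFun L₀ M₀ g) (i : Fin 2) {ω : ℝ} (hω : ω ∈ ({-1, 1} : Set ℝ)) :
    trajRisk 2 (periodPolicy τ hy.lipschitz.continuous) (expertPolicy τ g i) (dynamics τ g i ω)
        (initLaw D Δ) H
      ≤ (200 * τ.toNNReal : ℝ≥0) * regDist D y g + (0 : ℝ≥0) := by
  refine trajRisk_le_of_sq hD hΔ₀ hΔ₁ H _ hg.lipschitz.continuous hy.lipschitz.continuous i ω ?_ ?_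
  · intro xs hxs _ us t
    rw [periodPolicy, detPolicy_apply]
    simp only [seqHist, Fin.val_last]
    rw [feedback_of_isNear _ _ _ _ (hxs t)]
  · intro z hz
    obtain ⟨α, β, p, hα, hβ, htraj, hp, hb⟩ := exists_period_traj i (τ * (1 - ω * τ) * (y z - g z))
    refine (startExp_offset_le hτ₀ hτ₁ hg.lipschitz.continuous hg.bound hz _ H (hy.bound z hz)
      hα hβ htraj ?_ hb).trans (ENNReal.ofReal_le_ofReal ?_)
    · rintro (_ | t)
      · rw [periodPolicy, detPolicy_apply]
        simp only [seqHist, Fin.val_last, offState, offInput]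
        rw [feedback_offset _ _ _ _ hz]
      · rw [periodPolicy, detPolicy_apply]
        simp only [seqHist, Fin.val_last, offState, offInput]
        rw [feedback_plane, hp]
    · refine (cost_le_of_geometric hτ₀ hτ₁ hω _ H).trans (le_of_eq ?_)
      push_cast
      rw [Real.coe_toNNReal _ hτ₀.le]
      ring

end Feedback

section Chunk

variable {k : ℕ}

/-- The gains of the chunked policy.  Three steps of open-loop inputs with these gains, together
with those that reproduce the expert's inputs for the second coordinate, eliminate the first
coordinate for both values of `i`. -/
noncomputable def chunkGain : Fin 3 → ℝ := ![-(5 / 4), -(981 / 1280), 1233 / 1024]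

/-- The linear part of the chunked policy. -/
noncomputable def chunkL : St k →L[ℝ] PiLp 2 (fun _ : Fin 3 => St k) :=
  ((PiLp.continuousLinearEquiv 2 ℝ (fun _ : Fin 3 => St k)).symm : _ →L[ℝ] _).comp
    (ContinuousLinearMap.pi fun j : Fin 3 => planeL (chunkGain j) (-(3 / 8) / 2 ^ (j : ℕ)) 0 0)

theorem chunkL_apply (x : St k) (j : Fin 3) :
    chunkL x j = planeL (chunkGain j) (-(3 / 8) / 2 ^ (j : ℕ)) 0 0 x := rfl

theorem norm_chunkL_le : ‖(chunkL : St k →L[ℝ] _)‖ ≤ 6 := by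
  refine ContinuousLinearMap.opNorm_le_bound _ (by norm_num) fun x => ?_
  have e : chunkL x = ∑ j : Fin 3, PiLp.single 2 j (chunkL x j) := by
    ext1 i
    simp
  have h : ∀ j : Fin 3, ‖chunkL x j‖ ≤ 2 * ‖x‖ := by
    intro j
    rw [chunkL_apply]
    refine ContinuousLinearMap.le_of_opNorm_le _ ((norm_planeL_le _ _ _ _).trans ?_) x
    fin_cases j <;> norm_num [chunkGain, abs_of_pos, abs_of_neg]
  rw [e]
  refine (norm_sum_le _ _).trans ?_
  simp only [PiLp.norm_single]
  refine (Finset.sum_le_sum fun j _ => h j).trans ?_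
  simp
  linarith

/-- The direction of the localized correction of the chunked policy: the first input of a chunk. -/
noncomputable def chunkDir : PiLp 2 (fun _ : Fin 3 => St k) := PiLp.single 2 0 e₁

theorem norm_chunkDir_le : ‖(chunkDir : PiLp 2 (fun _ : Fin 3 => St k))‖ ≤ 1 := by
  rw [chunkDir, PiLp.norm_single, norm_e₁]

variable [NeZero k]

/-- The chunk of inputs that is selected in a state. -/
noncomputable def chunkMap (τ : ℝ) (g : Cov k → ℝ) (x : St k) : PiLp 2 (fun _ : Fin 3 => St k) :=
  chunkL x + (τ * localized g x) • chunkDir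

theorem continuous_chunkMap (τ : ℝ) {g : Cov k → ℝ} (hg : Continuous g) :
    Continuous (chunkMap τ g) :=
  chunkL.continuous.add ((continuous_const.mul (continuous_localized hg)).smul continuous_const)

theorem chunkMap_of_bump_eq_zero (τ : ℝ) (g : Cov k → ℝ) {x : St k} (hx : bump (x - xOffset) = 0)
    (j : Fin 3) : chunkMap τ g x j
      = plane (chunkGain j * x (Sum.inl 0) + -(3 / 8) / 2 ^ (j : ℕ) * x (Sum.inl 1)) 0 := by
  rw [chunkMap, localized_of_bump_eq_zero g hx, mul_zero, zero_smul, add_zero, chunkL_apply,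
    planeL_apply]
  simp

theorem chunkMap_offset (τ : ℝ) (g : Cov k → ℝ) {z : Cov k} (hz : ‖z‖ ≤ 1) (j : Fin 3) :
    chunkMap τ g (xOffset + embTail z) j = plane (if j = 0 then τ * g z else 0) 0 := by
  rw [chunkMap, localized_offset g hz, PiLp.add_apply, chunkL_apply, planeL_apply, chunkDir]
  simp only [PiLp.smul_apply, PiLp.single_apply]
  split_ifs with h
  · rw [e₁_eq_plane, smul_plane, plane_add]
    simp
  · simp [plane_zero]

/-- The deterministic policy that executes the chunks of `chunkMap` in open loop. -/
noncomputable def chunkPolicy (τ : ℝ) {g : Cov k → ℝ} (hg : Continuous g) :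
    HistPolicy (St k) (St k) :=
  detPolicy (fun t h => chunkMap τ g
      (h.1 ⟨3 * (t / 3), Nat.lt_succ_of_le (Nat.mul_div_le t 3)⟩) (Fin.ofNat 3 t))
    fun t => by
      have h1 : Measurable fun x : St k => chunkMap τ g x (Fin.ofNat 3 t) :=
        Continuous.measurable ((PiLp.continuous_apply 2 _ _).comp (continuous_chunkMap τ hg))
      exact h1.comp (by fun_prop)

/-- On the planar trajectory of the chunked policy, the first coordinate vanishes at the end of the
first chunk that starts in the plane. Index `t` is the time `t + 1`, so that the remaining two
inputs of the chunk that starts at the offset come first; they are zero. -/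
theorem exists_chunk_traj (i : Fin 2) (a : ℝ) : ∃ α β p : ℕ → ℝ, α 0 = a ∧ β 0 = 0 ∧
    IsPlanarTraj i α β p (fun _ => 0) ∧ p 0 = 0 ∧ p 1 = 0 ∧
    (∀ m, ∀ j : Fin 3, p (3 * m + 2 + j)
      = chunkGain j * α (3 * m + 2) + -(3 / 8) / 2 ^ (j : ℕ) * β (3 * m + 2)) ∧
    ∀ t, |α t| + |β t| + (|p t| + |(0 : ℝ)|) ≤ 64 * |a| / 2 ^ t := by
  have ha := abs_nonneg a
  fin_cases i
  · refine ⟨fun t => match t with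
        | 0 => a
        | 1 => 5 / 4 * a
        | 2 => 91 / 64 * a
        | 4 => -(105651 / 81920) * a
        | _ => 0, fun t => match t with
        | 0 => 0
        | 1 => -(3 / 8) * a
        | 2 => -(21 / 32) * a
        | 3 => -(441 / 512) * a
        | 4 => -(441 / 1024) * a
        | t + 5 => 175833 / 655360 * a / 2 ^ t, fun t => match t with
        | 0 => 0
        | 1 => 0
        | 2 => -(49 / 32) * a
        | 3 => -(79191 / 81920) * a
        | 4 => 116235 / 65536 * a
        | t + 5 => -(3 / 8) * (175833 / 655360 * a / 2 ^ t), rfl, rfl, ?_, rfl, rfl, ?_, ?_⟩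
    · rintro (_ | _ | _ | _ | _ | t) <;> refine ⟨?_, ?_⟩ <;>
        simp only [Fin.zero_eta, Matrix.cons_val_zero, zero_add, Nat.reduceAdd, pow_succ] <;> ring
    · rintro (_ | m) j
      · fin_cases j <;> simp [chunkGain] <;> ring
      · have e : 3 * (m + 1) + 2 = 3 * m + 5 := by ring
        have e' : 3 * m + 5 + (j : ℕ) = (3 * m + j) + 5 := by ring
        rw [e, e']
        simp only [pow_add]
        field_simp
        ring
    · rintro (_ | _ | _ | _ | _ | t)
      iterate 5
        · simp only [abs_mul, abs_neg, abs_zero, zero_add, Nat.reduceAdd]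
          norm_num [abs_of_pos]
          linarith
      · simp only [abs_mul, abs_neg, abs_zero, abs_div, abs_pow, abs_two, zero_add, add_zero]
        have h2 : (0 : ℝ) ≤ |a| / 2 ^ t := by positivity
        have e : 64 * |a| / 2 ^ (t + 5) = 2 * (|a| / 2 ^ t) := by rw [pow_add]; field_simp; ring
        rw [e, mul_div_assoc]
        norm_num [abs_of_pos]
        linarith
  · refine ⟨fun t => match t with
        | 0 => a
        | 1 => -(15 / 16) * a
        | 2 => 225 / 256 * a
        | 3 => -(7875 / 4096) * a
        | 4 => 18495 / 16384 * a
        | _ => 0, fun _ => 0, fun t => match t with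
        | 0 => 0
        | 1 => 0
        | 2 => -(1125 / 1024) * a
        | 3 => -(44145 / 65536) * a
        | 4 => 277425 / 262144 * a
        | _ => 0, rfl, rfl, ?_, rfl, rfl, ?_, ?_⟩
    · rintro (_ | _ | _ | _ | _ | t) <;> refine ⟨?_, ?_⟩ <;>
        simp only [Fin.mk_one, Matrix.cons_val_one, Matrix.cons_val_fin_one, zero_add,
          Nat.reduceAdd] <;> ring
    · rintro (_ | m) j
      · fin_cases j <;> simp [chunkGain] <;> ring
      · have e : 3 * (m + 1) + 2 = 3 * m + 5 := by ring
        have e' : 3 * m + 5 + (j : ℕ) = (3 * m + j) + 5 := by ring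
        rw [e, e']
        simp
    · rintro (_ | _ | _ | _ | _ | t)
      iterate 5
        · simp only [abs_mul, abs_neg, abs_zero, zero_add, Nat.reduceAdd]
          norm_num [abs_of_pos]
          linarith
      · simp only [abs_zero, add_zero]
        positivity

theorem trajRisk_chunkPolicy_le {D : Measure (Cov k)} [IsProbabilityMeasure D]
    (hD : ∀ᵐ z ∂D, ‖z‖ ≤ 1) {τ Δ : ℝ} (hτ₀ : 0 < τ) (hτ₁ : τ < 1) (hΔ₀ : 0 < Δ) (hΔ₁ : Δ < 1)
    (H : ℕ) {L₀ M₀ : ℝ≥0} {y g : Cov k → ℝ} (hy : IsRegularFun L₀ M₀ y)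
    (hg : IsRegularFun L₀ M₀ g) (i : Fin 2) {ω : ℝ} (hω : ω ∈ ({-1, 1} : Set ℝ)) :
    trajRisk 2 (chunkPolicy τ hy.lipschitz.continuous) (expertPolicy τ g i) (dynamics τ g i ω)
        (initLaw D Δ) H
      ≤ (200 * τ.toNNReal : ℝ≥0) * regDist D y g + (0 : ℝ≥0) := by
  refine trajRisk_le_of_sq hD hΔ₀ hΔ₁ H _ hg.lipschitz.continuous hy.lipschitz.continuous i ω ?_ ?_
  · intro xs hxs hxb us t
    rw [chunkPolicy, detPolicy_apply]
    simp only [seqHist]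
    rw [chunkMap_of_bump_eq_zero _ _ (bump_sub_xOffset_of_norm_le (hxs _).2), (hxs _).1,
      hxb (3 * (t / 3)), hxb t]
    congr 2
    have ht : (2 : ℝ) ^ t = 2 ^ (3 * (t / 3)) * 2 ^ (t % 3) := by
      rw [← pow_add, Nat.div_add_mod]
    rw [ht, Fin.val_ofNat]
    field_simp
    ring
  · intro z hz
    obtain ⟨α, β, p, hα, hβ, htraj, hp₀, hp₁, hp, hb⟩ :=
      exists_chunk_traj i (τ * (1 - ω * τ) * (y z - g z))
    refine (startExp_offset_le hτ₀ hτ₁ hg.lipschitz.continuous hg.bound hz _ H (hy.bound z hz)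
      hα hβ htraj ?_ hb).trans (ENNReal.ofReal_le_ofReal ?_)
    · intro t
      rw [chunkPolicy, detPolicy_apply]
      simp only [seqHist]
      congr 1
      obtain ⟨m, j, hj, rfl⟩ : ∃ m j, j < 3 ∧ t = 3 * m + j :=
        ⟨t / 3, t % 3, Nat.mod_lt _ (by norm_num), (Nat.div_add_mod t 3).symm⟩
      have hdiv : 3 * ((3 * m + j) / 3) = 3 * m := by omega
      have hmod : Fin.ofNat 3 (3 * m + j) = ⟨j, hj⟩ := by
        ext
        simp only [Fin.val_ofNat]
        omega
      rw [hdiv, hmod]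
      rcases m with _ | m
      · simp only [mul_zero, zero_add, offState]
        rw [chunkMap_offset _ _ hz]
        interval_cases j
        · rfl
        · simp [offInput, hp₀]
        · simp [offInput, hp₁]
      · have e1 : 3 * (m + 1) = (3 * m + 2) + 1 := by ring
        have e2 : (3 * m + 2) + 1 + j = (3 * m + 2 + j) + 1 := by ring
        rw [e1, e2]
        simp only [offState, offInput]
        rw [chunkMap_of_bump_eq_zero _ _ (bump_plane_sub_xOffset _ _)]
        have := hp m ⟨j, hj⟩
        simp only at this
        rw [this]
        rfl
    · refine (cost_le_of_geometric hτ₀ hτ₁ hω _ H).trans (le_of_eq ?_)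
      push_cast
      rw [Real.coe_toNNReal _ hτ₀.le]
      ring

end Chunk

/-! ### Simple policies with means of unbounded curvature -/

section Simple

/-- A `C²` function on the plane that is Lipschitz uniformly in `δ`.  It vanishes on both axes, and
equals `a` where `a ^ 2 + δ ^ 2 ≤ b ^ 2`. -/
noncomputable def switch (δ a b : ℝ) : ℝ := a * Real.smoothTransition (b ^ 2 / (a ^ 2 + δ ^ 2))

theorem switch_zero_left (δ b : ℝ) : switch δ 0 b = 0 := by simp [switch]

theorem switch_zero_right (δ a : ℝ) : switch δ a 0 = 0 := by simp [switch]

theorem switch_eq {δ a b : ℝ} (hδ : 0 < δ) (h : a ^ 2 + δ ^ 2 ≤ b ^ 2) : switch δ a b = a := by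
  rw [switch, Real.smoothTransition.one_of_one_le, mul_one]
  rwa [one_le_div (by positivity)]

theorem abs_switch_le (δ a b : ℝ) : |switch δ a b| ≤ |a| := by
  rw [switch, abs_mul, abs_of_nonneg (Real.smoothTransition.nonneg _)]
  exact mul_le_of_le_one_right (abs_nonneg _) (Real.smoothTransition.le_one _)

theorem deriv_smoothTransition_of_one_lt {s : ℝ} (hs : 1 < s) :
    deriv Real.smoothTransition s = 0 := by
  have h : Real.smoothTransition =ᶠ[nhds s] fun _ => 1 := by
    filter_upwards [lt_mem_nhds hs] with r hr using Real.smoothTransition.one_of_one_le hr.le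
  rw [h.deriv_eq, deriv_const]

/-- The partial derivatives of the switch are bounded because `b ^ 2 / (a ^ 2 + δ ^ 2)` is
homogeneous up to the regularization, and the switch is equal to `a` where this quotient is at least
`1`. -/
theorem exists_switch_lipschitz : ∃ S : ℝ≥0, ∀ δ : ℝ, 0 < δ → ∀ a b a' b' : ℝ,
    |switch δ a b - switch δ a' b'| ≤ S * |a - a'| + S * |b - b'| := by
  obtain ⟨B, hB₁, hB⟩ := exists_smoothTransition_bound
  have hd : ∀ s, 0 ≤ s → s ≤ 1 → |deriv Real.smoothTransition s| ≤ B := by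
    intro s h₀ h₁
    have := hB s ⟨h₀, by linarith⟩ 1 (by norm_num)
    rwa [norm_iteratedFDeriv_one, ← norm_deriv_eq_norm_fderiv] at this
  have hσ : ∀ s, HasDerivAt Real.smoothTransition (deriv Real.smoothTransition s) s := fun s =>
    ((Real.smoothTransition.contDiff (n := 1)).differentiable (by norm_num) s).hasDerivAt
  refine ⟨⟨1 + 2 * B, by linarith⟩, fun δ hδ a b a' b' => ?_⟩
  have hq : ∀ a : ℝ, 0 < a ^ 2 + δ ^ 2 := fun a => by positivity
  -- The derivative of the transition function vanishes unless `b ^ 2 ≤ a ^ 2 + δ ^ 2`.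
  have key : ∀ a b m : ℝ, (b ^ 2 ≤ a ^ 2 + δ ^ 2 → |m| ≤ 2) →
      |deriv Real.smoothTransition (b ^ 2 / (a ^ 2 + δ ^ 2)) * m| ≤ 2 * B := by
    intro a b m hm
    rcases le_or_gt (b ^ 2) (a ^ 2 + δ ^ 2) with h | h
    · rw [abs_mul]
      have h1 := hd _ (by positivity) ((div_le_one (hq a)).2 h)
      calc _ ≤ B * 2 := mul_le_mul h1 (hm h) (abs_nonneg _) (by linarith)
        _ = 2 * B := mul_comm _ _
    · rw [deriv_smoothTransition_of_one_lt ((one_lt_div (hq a)).2 h), zero_mul, abs_zero]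
      linarith
  have hb : ∀ a b, HasDerivAt (fun b => switch δ a b)
      (deriv Real.smoothTransition (b ^ 2 / (a ^ 2 + δ ^ 2))
        * (2 * (a * b) / (a ^ 2 + δ ^ 2))) b := by
    intro a b
    have h1 : HasDerivAt (fun b : ℝ => b ^ 2 / (a ^ 2 + δ ^ 2)) (2 * b / (a ^ 2 + δ ^ 2)) b := by
      simpa using (hasDerivAt_pow 2 b).div_const (a ^ 2 + δ ^ 2)
    have h2 := ((hσ (b ^ 2 / (a ^ 2 + δ ^ 2))).comp b h1).const_mul a
    refine h2.congr_deriv ?_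
    ring
  have ha : ∀ a b, HasDerivAt (fun a => switch δ a b)
      (Real.smoothTransition (b ^ 2 / (a ^ 2 + δ ^ 2))
        + deriv Real.smoothTransition (b ^ 2 / (a ^ 2 + δ ^ 2))
          * (-(2 * (a ^ 2 * b ^ 2) / (a ^ 2 + δ ^ 2) ^ 2))) a := by
    intro a b
    have h1 : HasDerivAt (fun a : ℝ => b ^ 2 / (a ^ 2 + δ ^ 2))
        (-(b ^ 2 * (2 * a)) / (a ^ 2 + δ ^ 2) ^ 2) a := by
      have h0 : HasDerivAt (fun a : ℝ => a ^ 2 + δ ^ 2) (2 * a) a := by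
        simpa using (hasDerivAt_pow 2 a).add_const (δ ^ 2)
      simpa using (hasDerivAt_const a (b ^ 2)).fun_div h0 (hq a).ne'
    have h2 := (hasDerivAt_id a).mul ((hσ (b ^ 2 / (a ^ 2 + δ ^ 2))).comp a h1)
    refine h2.congr_deriv ?_
    simp
    ring
  have hLb : ∀ a, LipschitzWith ⟨1 + 2 * B, by linarith⟩ (fun b => switch δ a b) := by
    intro a
    refine lipschitzWith_of_nnnorm_deriv_le (fun b => (hb a b).differentiableAt) fun b => ?_
    rw [(hb a b).deriv]
    refine (key a b _ fun h => ?_).trans (by linarith : 2 * B ≤ 1 + 2 * B)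
    rw [abs_div, abs_of_pos (hq a), div_le_iff₀ (hq a), abs_le]
    constructor <;> nlinarith [sq_nonneg (a - b), sq_nonneg (a + b), sq_nonneg δ]
  have hLa : ∀ b, LipschitzWith ⟨1 + 2 * B, by linarith⟩ (fun a => switch δ a b) := by
    intro b
    refine lipschitzWith_of_nnnorm_deriv_le (fun a => (ha a b).differentiableAt) fun a => ?_
    rw [(ha a b).deriv]
    refine (abs_add_le _ _).trans (add_le_add ?_ (key a b _ fun h => ?_))
    · rw [abs_of_nonneg (Real.smoothTransition.nonneg _)]
      exact Real.smoothTransition.le_one _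
    · have h3 : 0 < (a ^ 2 + δ ^ 2) ^ 2 := by have := hq a; positivity
      rw [abs_neg, abs_div, abs_of_pos h3, div_le_iff₀ h3, abs_of_nonneg (by positivity)]
      have : a ^ 2 * b ^ 2 ≤ (a ^ 2 + δ ^ 2) * (a ^ 2 + δ ^ 2) := by
        gcongr
        nlinarith [sq_nonneg δ]
      nlinarith
  have h1 := (hLa b).norm_sub_le a a'
  have h2 := (hLb a').norm_sub_le b b'
  simp only [Real.norm_eq_abs] at h1 h2
  calc |switch δ a b - switch δ a' b'|
      ≤ |switch δ a b - switch δ a' b| + |switch δ a' b - switch δ a' b'| := abs_sub_le _ _ _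
    _ ≤ _ := add_le_add h1 h2

variable {k : ℕ}

theorem contDiff_switch {δ : ℝ} (hδ : 0 < δ) :
    ContDiff ℝ 2 fun x : St k => switch δ (x (Sum.inl 0)) (x (Sum.inl 1)) := by
  have h0 : ContDiff ℝ 2 fun x : St k => x (Sum.inl 0) := contDiff_piLp_apply 2
  have h1 : ContDiff ℝ 2 fun x : St k => x (Sum.inl 1) := contDiff_piLp_apply 2
  unfold switch
  refine h0.mul (Real.smoothTransition.contDiff.comp ((h1.pow 2).div ((h0.pow 2).add contDiff_const)
    fun x => ?_))
  positivity

variable [NeZero k]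

/-- A feedback that eliminates the first coordinate in one step if `i = 1`, and marks the state in
the second coordinate.  In marked states it eliminates the first coordinate if `i = 2`. -/
noncomputable def switchFeedback (δ τ : ℝ) (g : Cov k → ℝ) (x : St k) : St k :=
  (planeL (-(5 / 4)) (-(3 / 8)) 3 0 x + (τ * localized g x) • e₁)
    + (35 / 16 * switch δ (x (Sum.inl 0)) (x (Sum.inl 1))) • e₁

theorem continuous_switchFeedback {δ : ℝ} (hδ : 0 < δ) (τ : ℝ) {g : Cov k → ℝ}
    (hg : Continuous g) : Continuous (switchFeedback δ τ g) :=
  ((planeL _ _ _ _).continuous.add ((continuous_const.mul (continuous_localized hg)).smul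
    continuous_const)).add ((continuous_const.mul (contDiff_switch hδ).continuous).smul
    continuous_const)

theorem switchFeedback_offset (δ τ : ℝ) (g : Cov k → ℝ) {z : Cov k} (hz : ‖z‖ ≤ 1) :
    switchFeedback δ τ g (xOffset + embTail z) = plane (τ * g z) 0 := by
  rw [switchFeedback, localized_offset g hz, planeL_apply, e₁_eq_plane, smul_plane, plane_add,
    smul_plane, plane_add]
  simp [switch]

theorem switchFeedback_plane (δ τ : ℝ) (g : Cov k → ℝ) (a b : ℝ) :
    switchFeedback δ τ g (plane a b)
      = plane (-(5 / 4) * a + -(3 / 8) * b + 35 / 16 * switch δ a b) (3 * a) := by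
  rw [switchFeedback, localized_of_bump_eq_zero g (bump_plane_sub_xOffset a b), planeL_apply,
    e₁_eq_plane, smul_plane, plane_add, smul_plane, plane_add]
  simp

theorem switchFeedback_of_isNear (δ τ : ℝ) (g : Cov k → ℝ) {x : St k} (hx : IsNear x) :
    switchFeedback δ τ g x = plane (-(3 / 8) * x (Sum.inl 1)) 0 := by
  rw [switchFeedback, localized_of_bump_eq_zero g (bump_sub_xOffset_of_norm_le hx.2), planeL_apply,
    hx.1, switch_zero_left]
  simp

/-- The deterministic time-invariant policy with the feedback `switchFeedback`. -/
noncomputable def switchPolicy {δ : ℝ} (hδ : 0 < δ) (τ : ℝ) {g : Cov k → ℝ} (hg : Continuous g) :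
    HistPolicy (St k) (St k) :=
  detPolicy (fun t h => switchFeedback δ τ g (h.1 (Fin.last t)))
    fun t => (continuous_switchFeedback hδ τ hg).measurable.comp (by fun_prop)

/-- A deviation that is large compared with the scale of the switch is eliminated after one step if
`i = 1` and after two steps if `i = 2`. -/
theorem exists_switch_traj_of_le {δ : ℝ} (hδ : 0 < δ) (i : Fin 2) {a : ℝ} (ha : δ ≤ |a|) :
    ∃ α β p q : ℕ → ℝ, α 0 = a ∧ β 0 = 0 ∧ IsPlanarTraj i α β p q ∧
    (∀ t, p t = -(5 / 4) * α t + -(3 / 8) * β t + 35 / 16 * switch δ (α t) (β t)) ∧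
    (∀ t, q t = 3 * α t) ∧
    ∀ t, |α t| + |β t| + (|p t| + |q t|) ≤ 64 * |a| / 2 ^ t := by
  have ha0 := abs_nonneg a
  fin_cases i
  · refine ⟨fun t => match t with
        | 0 => a
        | _ => 0, fun t => match t with
        | 0 => 0
        | t + 1 => 21 / 8 * a / 2 ^ t, fun t => match t with
        | 0 => -(5 / 4) * a
        | t + 1 => -(3 / 8) * (21 / 8 * a / 2 ^ t), fun t => match t with
        | 0 => 3 * a
        | _ => 0, rfl, rfl, ?_, ?_, ?_, ?_⟩
    · rintro (_ | t) <;> refine ⟨?_, ?_⟩ <;>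
        simp only [Fin.zero_eta, Matrix.cons_val_zero, pow_zero, pow_succ] <;> ring
    · rintro (_ | t)
      · simp [switch_zero_right]
      · simp [switch_zero_left]
    · rintro (_ | t) <;> simp
    · rintro (_ | t)
      · simp only [abs_mul, abs_neg, abs_zero]
        norm_num [abs_of_pos]
        linarith
      · simp only [abs_mul, abs_neg, abs_zero, abs_div, abs_pow, abs_two, zero_add, add_zero]
        have h2 : (0 : ℝ) ≤ |a| / 2 ^ t := by positivity
        have e : 64 * |a| / 2 ^ (t + 1) = 32 * (|a| / 2 ^ t) := by rw [pow_add]; field_simp; ring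
        rw [e, mul_div_assoc]
        norm_num [abs_of_pos]
        linarith
  · have hsw : switch δ (-(35 / 16) * a) (3 * a) = -(35 / 16) * a := by
      refine switch_eq hδ ?_
      have : δ ^ 2 ≤ a ^ 2 := by
        rw [← sq_abs a]
        exact pow_le_pow_left₀ hδ.le ha 2
      nlinarith
    refine ⟨fun t => match t with
        | 0 => a
        | 1 => -(35 / 16) * a
        | _ => 0, fun t => match t with
        | 0 => 0
        | 1 => 3 * a
        | t + 2 => -(81 / 16) * a / 2 ^ t, fun t => match t with
        | 0 => -(5 / 4) * a
        | 1 => -(813 / 256) * a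
        | t + 2 => -(3 / 8) * (-(81 / 16) * a / 2 ^ t), fun t => match t with
        | 0 => 3 * a
        | 1 => -(105 / 16) * a
        | _ => 0, rfl, rfl, ?_, ?_, ?_, ?_⟩
    · rintro (_ | _ | t) <;> refine ⟨?_, ?_⟩ <;>
        simp only [Fin.mk_one, Matrix.cons_val_one, Matrix.cons_val_fin_one, zero_add,
          Nat.reduceAdd, pow_zero, pow_succ] <;> ring
    · rintro (_ | _ | t)
      · simp [switch_zero_right]
      · simp only [zero_add, hsw]
        ring
      · simp [switch_zero_left]
    · rintro (_ | _ | t)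
      · simp
      · simp only [zero_add]
        ring
      · simp
    · rintro (_ | _ | t)
      iterate 2
        · simp only [abs_mul, abs_neg, abs_zero, zero_add]
          norm_num [abs_of_pos]
          linarith
      · simp only [abs_mul, abs_neg, abs_zero, abs_div, abs_pow, abs_two, zero_add, add_zero]
        have h2 : (0 : ℝ) ≤ |a| / 2 ^ t := by positivity
        have e : 64 * |a| / 2 ^ (t + 2) = 16 * (|a| / 2 ^ t) := by rw [pow_add]; field_simp; ring
        rw [e, mul_div_assoc]
        norm_num [abs_of_pos]
        linarith

/-- The planar closed loop of the simple policy. -/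
noncomputable def switchLoop (δ : ℝ) (i : Fin 2) (a : ℝ) : ℕ → ℝ × ℝ
  | 0 => (a, 0)
  | t + 1 =>
    let s := switchLoop δ i a t
    (![5 / 4, -(15 / 16)] i * s.1 + 3 / 8 * s.2
        + (-(5 / 4) * s.1 + -(3 / 8) * s.2 + 35 / 16 * switch δ s.1 s.2),
      ![-(3 / 8), 0] i * s.1 + 1 / 2 * s.2 + 3 * s.1)

/-- Without any assumption on its size, a deviation grows at most exponentially; this covers the
deviations below the scale of the switch, which can be chosen depending on the horizon. -/
theorem exists_switch_traj (δ : ℝ) (i : Fin 2) (a : ℝ) :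
    ∃ α β p q : ℕ → ℝ, α 0 = a ∧ β 0 = 0 ∧ IsPlanarTraj i α β p q ∧
    (∀ t, p t = -(5 / 4) * α t + -(3 / 8) * β t + 35 / 16 * switch δ (α t) (β t)) ∧
    (∀ t, q t = 3 * α t) ∧
    ∀ t, |α t| + |β t| + (|p t| + |q t|) ≤ 10 * (10 ^ t * |a|) := by
  have hsw : ∀ a b, |-(5 / 4) * a + -(3 / 8) * b + 35 / 16 * switch δ a b|
      ≤ 55 / 16 * |a| + 3 / 8 * |b| := by
    intro a b
    refine (abs_add_three _ _ _).trans ?_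
    simp only [abs_mul]
    norm_num [abs_of_pos]
    linarith [abs_switch_le δ a b]
  have hgrow : ∀ t, |(switchLoop δ i a t).1| + |(switchLoop δ i a t).2| ≤ 10 ^ t * |a| := by
    intro t
    induction t with
    | zero => simp [switchLoop]
    | succ t ih =>
      set s := switchLoop δ i a t with hs
      have h1 : |![5 / 4, -(15 / 16)] i * s.1 + 3 / 8 * s.2| ≤ 5 / 4 * |s.1| + 3 / 8 * |s.2| := by
        refine (abs_add_le _ _).trans ?_
        simp only [abs_mul]
        have := abs_nonneg s.1
        fin_cases i <;> norm_num [abs_of_pos]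
        linarith
      have h2 : |![-(3 / 8), 0] i * s.1 + 1 / 2 * s.2 + 3 * s.1|
          ≤ 27 / 8 * |s.1| + 1 / 2 * |s.2| := by
        refine (abs_add_three _ _ _).trans ?_
        simp only [abs_mul]
        have := abs_nonneg s.1
        fin_cases i <;> norm_num [abs_of_pos] <;> linarith
      have h3 : |(switchLoop δ i a (t + 1)).1| ≤ 75 / 16 * |s.1| + 3 / 4 * |s.2| := by
        refine (abs_add_le _ _).trans ?_
        have := hsw s.1 s.2
        linarith
      have h4 : |(switchLoop δ i a (t + 1)).2| ≤ 27 / 8 * |s.1| + 1 / 2 * |s.2| := h2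
      rw [pow_succ]
      linarith [abs_nonneg s.1, abs_nonneg s.2]
  refine ⟨fun t => (switchLoop δ i a t).1, fun t => (switchLoop δ i a t).2,
    fun t => -(5 / 4) * (switchLoop δ i a t).1 + -(3 / 8) * (switchLoop δ i a t).2
      + 35 / 16 * switch δ (switchLoop δ i a t).1 (switchLoop δ i a t).2,
    fun t => 3 * (switchLoop δ i a t).1, rfl, rfl, fun t => ⟨rfl, rfl⟩, fun t => rfl, fun t => rfl,
    fun t => ?_⟩
  have h1 := hgrow t
  have h2 := hsw (switchLoop δ i a t).1 (switchLoop δ i a t).2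
  simp only [abs_mul, Nat.abs_ofNat]
  linarith [abs_nonneg (switchLoop δ i a t).1, abs_nonneg (switchLoop δ i a t).2]

theorem trajRisk_switchPolicy_le {D : Measure (Cov k)} [IsProbabilityMeasure D]
    (hD : ∀ᵐ z ∂D, ‖z‖ ≤ 1) {τ Δ : ℝ} (hτ₀ : 0 < τ) (hτ₁ : τ < 1) (hΔ₀ : 0 < Δ) (hΔ₁ : Δ < 1)
    (H : ℕ) {L₀ M₀ : ℝ≥0} {η : ℝ≥0} {δ : ℝ} (hδ : 0 < δ) (hδη : 10 ^ (H + 1) * (H + 1) * δ ≤ η)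
    {y g : Cov k → ℝ} (hy : IsRegularFun L₀ M₀ y)
    (hg : IsRegularFun L₀ M₀ g) (i : Fin 2) {ω : ℝ} (hω : ω ∈ ({-1, 1} : Set ℝ)) :
    trajRisk 2 (switchPolicy hδ τ hy.lipschitz.continuous) (expertPolicy τ g i) (dynamics τ g i ω)
        (initLaw D Δ) H
      ≤ (200 * τ.toNNReal : ℝ≥0) * regDist D y g + η := by
  refine trajRisk_le_of_sq hD hΔ₀ hΔ₁ H _ hg.lipschitz.continuous hy.lipschitz.continuous i ω ?_ ?_
  · intro xs hxs _ us t
    rw [switchPolicy, detPolicy_apply]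
    simp only [seqHist, Fin.val_last]
    rw [switchFeedback_of_isNear _ _ _ (hxs t)]
  · intro z hz
    have hkernel : ∀ α β p q : ℕ → ℝ,
        (∀ t, p t = -(5 / 4) * α t + -(3 / 8) * β t + 35 / 16 * switch δ (α t) (β t)) →
        (∀ t, q t = 3 * α t) → ∀ t, (switchPolicy hδ τ hy.lipschitz.continuous).kernel t
          (seqHist (offState z α β) (offInput (τ * y z) p q) t)
            = Measure.dirac (offInput (τ * y z) p q t) := by
      rintro α β p q hp hq (_ | t)
      · rw [switchPolicy, detPolicy_apply]
        simp only [seqHist, Fin.val_last, offState, offInput]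
        rw [switchFeedback_offset _ _ _ hz]
      · rw [switchPolicy, detPolicy_apply]
        simp only [seqHist, Fin.val_last, offState, offInput]
        rw [switchFeedback_plane, hp, hq]
    have e : ((200 * τ.toNNReal : ℝ≥0) : ℝ) = 200 * τ := by
      push_cast
      rw [Real.coe_toNNReal _ hτ₀.le]
    rw [e]
    rcases le_or_gt δ |τ * (1 - ω * τ) * (y z - g z)| with ha | ha
    · obtain ⟨α, β, p, q, hα, hβ, htraj, hp, hq, hb⟩ := exists_switch_traj_of_le hδ i ha
      refine (startExp_offset_le hτ₀ hτ₁ hg.lipschitz.continuous hg.bound hz _ H (hy.bound z hz)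
        hα hβ htraj (hkernel α β p q hp hq) hb).trans (ENNReal.ofReal_le_ofReal ?_)
      have := cost_le_of_geometric hτ₀ hτ₁ hω (y z - g z) H
      have := sq_nonneg (η : ℝ)
      linarith
    · obtain ⟨α, β, p, q, hα, hβ, htraj, hp, hq, hb⟩ :=
        exists_switch_traj δ i (τ * (1 - ω * τ) * (y z - g z))
      refine (startExp_offset_le hτ₀ hτ₁ hg.lipschitz.continuous hg.bound hz _ H (hy.bound z hz)
        hα hβ htraj (hkernel α β p q hp hq) hb).trans (ENNReal.ofReal_le_ofReal ?_)
      set a := τ * (1 - ω * τ) * (y z - g z) with ha'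
      have h1 : ∀ t ∈ Finset.range H, (10 * (10 ^ t * |a|)) ^ 2 ≤ (10 ^ (H + 1) * δ) ^ 2 := by
        intro t ht
        refine pow_le_pow_left₀ (by positivity) ?_ 2
        have h2 : (10 : ℝ) ^ (t + 1) ≤ 10 ^ (H + 1) :=
          pow_le_pow_right₀ (by norm_num) (by have := Finset.mem_range.1 ht; omega)
        calc 10 * (10 ^ t * |a|) = 10 ^ (t + 1) * |a| := by rw [pow_succ]; ring
          _ ≤ _ := by gcongr
      have h2 : ∑ t ∈ Finset.range H, (10 * (10 ^ t * |a|)) ^ 2 ≤ (η : ℝ) ^ 2 := by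
        refine (Finset.sum_le_sum h1).trans ?_
        rw [Finset.sum_const, Finset.card_range, nsmul_eq_mul]
        have h3 : (10 ^ (H + 1) * (H + 1) * δ) ^ 2 ≤ (η : ℝ) ^ 2 :=
          pow_le_pow_left₀ (by positivity) hδη 2
        refine le_trans ?_ h3
        have h4 : (H : ℝ) ≤ ((H : ℝ) + 1) ^ 2 := by nlinarith [Nat.cast_nonneg (α := ℝ) H]
        have h5 : 0 ≤ (10 ^ (H + 1) * δ) ^ 2 := sq_nonneg _
        calc (H : ℝ) * (10 ^ (H + 1) * δ) ^ 2 ≤ ((H : ℝ) + 1) ^ 2 * (10 ^ (H + 1) * δ) ^ 2 := by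
              gcongr
          _ = _ := by ring
      have h3 : (τ * (y z - g z)) ^ 2 ≤ (200 * τ * (y z - g z)) ^ 2 := by
        have : (200 * τ * (y z - g z)) ^ 2 = 40000 * (τ * (y z - g z)) ^ 2 := by ring
        rw [this]
        nlinarith [sq_nonneg (τ * (y z - g z))]
      linarith

end Simple

/-! ### Policies that toss a coin -/

section Coin

section General

variable {X U : Type} [MeasurableSpace X] [MeasurableSpace U]

/-- Plays `φ true x` or `φ false x`, with probability one half each. -/
noncomputable def coinKernel (φ : Bool → X → U) (hφ : ∀ c, Measurable (φ c)) : Kernel X U where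
  toFun x := (1 / 2 : ℝ≥0∞) • Measure.dirac (φ true x) + (1 / 2 : ℝ≥0∞) • Measure.dirac (φ false x)
  measurable' := by
    refine Measure.measurable_of_measurable_coe _ fun s hs => ?_
    simp only [Measure.add_apply, Measure.smul_apply, Measure.dirac_apply' _ hs, smul_eq_mul]
    exact (((measurable_one.indicator hs).comp (hφ true)).const_mul _).add
      (((measurable_one.indicator hs).comp (hφ false)).const_mul _)

theorem coinKernel_apply (φ : Bool → X → U) (hφ : ∀ c, Measurable (φ c)) (x : X) :
    coinKernel φ hφ x = (1 / 2 : ℝ≥0∞) • Measure.dirac (φ true x)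
      + (1 / 2 : ℝ≥0∞) • Measure.dirac (φ false x) := rfl

instance isMarkovKernel_coinKernel (φ : Bool → X → U) (hφ : ∀ c, Measurable (φ c)) :
    IsMarkovKernel (coinKernel φ hφ) :=
  ⟨fun x => ⟨by simp [coinKernel_apply, ENNReal.inv_two_add_inv_two]⟩⟩

/-- The time-invariant Markovian policy with the given kernel. -/
noncomputable def staticPolicy (π : Kernel X U) [IsMarkovKernel π] : HistPolicy X U where
  kernel t := π.comap (fun h : Hist X U t => h.1 (Fin.last t)) (by fun_prop)
  isMarkov _ := inferInstance

theorem staticPolicy_apply (π : Kernel X U) [IsMarkovKernel π] (t : ℕ) (h : Hist X U t) :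
    (staticPolicy π).kernel t h = π (h.1 (Fin.last t)) := rfl

theorem lintegral_coinKernel [MeasurableSingletonClass U] (φ : Bool → X → U)
    (hφ : ∀ c, Measurable (φ c)) (x : X) (F : U → ℝ≥0∞) :
    ∫⁻ u, F u ∂(coinKernel φ hφ x)
      = (1 / 2 : ℝ≥0∞) * F (φ true x) + (1 / 2 : ℝ≥0∞) * F (φ false x) := by
  rw [coinKernel_apply, lintegral_add_measure, lintegral_smul_measure, lintegral_smul_measure,
    lintegral_dirac, lintegral_dirac]
  rfl

/-- A variable that takes two values with probability one half each always deviates from its mean by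
its standard deviation. -/
theorem isAntiConcentratedLaw_two_point (r s : ℝ) {α p : ℝ} (hα : α ≤ 1) (hp : p ≤ 1) :
    IsAntiConcentratedLaw ((1 / 2 : ℝ≥0∞) • Measure.dirac r + (1 / 2 : ℝ≥0∞) • Measure.dirac s)
      α p := by
  set ν : Measure ℝ := (1 / 2 : ℝ≥0∞) • Measure.dirac r + (1 / 2 : ℝ≥0∞) • Measure.dirac s with hν
  have hprob : IsProbabilityMeasure ν := ⟨by simp [hν, ENNReal.inv_two_add_inv_two]⟩
  have hae : ∀ q : ℝ → Prop, q r → q s → ∀ᵐ z ∂ν, q z := by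
    intro q hr hs
    rw [hν, ae_add_measure_iff]
    constructor
    · exact Measure.ae_smul_measure (by rw [ae_dirac_eq]; exact hr) _
    · exact Measure.ae_smul_measure (by rw [ae_dirac_eq]; exact hs) _
  have hmean : ∫ w, w ∂ν = (r + s) / 2 := by
    have h (b : ℝ) : Integrable (fun w => w) ((1 / 2 : ℝ≥0∞) • Measure.dirac b) :=
      (integrable_dirac (by simp)).smul_measure (by simp)
    rw [hν, integral_add_measure (h r) (h s), integral_smul_measure, integral_smul_measure]
    simp
    ring
  have e1 : |r - (r + s) / 2| = |r - s| / 2 := by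
    rw [show r - (r + s) / 2 = (r - s) / 2 by ring, abs_div, abs_two]
  have e2 : |s - (r + s) / 2| = |r - s| / 2 := by
    rw [show s - (r + s) / 2 = -((r - s) / 2) by ring, abs_neg, abs_div, abs_two]
  have hnorm : eLpNorm (fun y => y - (r + s) / 2) 2 ν ≤ ENNReal.ofReal (|r - s| / 2) := by
    refine (eLpNorm_le_of_ae_bound (C := |r - s| / 2) (hae _ ?_ ?_)).trans (by simp)
    · rw [Real.norm_eq_abs, e1]
    · rw [Real.norm_eq_abs, e2]
  have hone : ∀ᵐ z ∂ν, z ∈ {z : ℝ | ENNReal.ofReal α * eLpNorm (fun y => y - ∫ w, w ∂ν) 2 ν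
      ≤ ‖z - ∫ w, w ∂ν‖ₑ} := by
    have hle : ENNReal.ofReal α * eLpNorm (fun y => y - (r + s) / 2) 2 ν
        ≤ ENNReal.ofReal (|r - s| / 2) := by
      refine (mul_le_mul' (ENNReal.ofReal_le_one.2 hα) hnorm).trans ?_
      rw [one_mul]
    rw [hmean]
    refine hae _ ?_ ?_
    · rwa [Set.mem_ofPred_eq, ← ofReal_norm, Real.norm_eq_abs, e1]
    · rwa [Set.mem_ofPred_eq, ← ofReal_norm, Real.norm_eq_abs, e2]
  rw [IsAntiConcentratedLaw]
  calc ENNReal.ofReal p ≤ 1 := ENNReal.ofReal_le_one.2 hp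
    _ = ν Set.univ := measure_univ.symm
    _ ≤ _ := measure_mono_ae (by filter_upwards [hone] with z hz _ using hz)

theorem startExp_mono (P : HistPolicy X U) (f : X → U → X) {t : ℕ} {F F' : Hist X U t → ℝ≥0∞}
    (h : F ≤ F') (x : X) : startExp P f t F x ≤ startExp P f t F' x := by
  induction t with
  | zero => exact h _
  | succ t ih => exact ih fun h' => lintegral_mono fun u => h _

end General

variable {k : ℕ}

/-- The gains between which the coin decides: one of them eliminates the first coordinate if
`i = 2`, the other one if `i = 1`. -/
noncomputable def coinGain (c : Bool) : ℝ := if c then 15 / 16 else -(5 / 4)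

theorem min_one_rpow_two_le_of_sq {A : ℝ≥0∞} {c s : ℝ} (hs : 0 ≤ s) (hc : 0 ≤ c) (hcs : c ≤ s ^ 2)
    (h : A ≤ ENNReal.ofReal c) : (min A 1) ^ (2 : ℝ) ≤ ENNReal.ofReal s := by
  rcases le_total s 1 with h1 | h1
  · refine (min_one_rpow_two_le hc h).trans (ENNReal.ofReal_le_ofReal ?_)
    have h2 : c ^ 2 ≤ (s ^ 2) ^ 2 := pow_le_pow_left₀ hc hcs 2
    have h3 : s ^ 2 ≤ s := by nlinarith
    have h4 : (s ^ 2) ^ 2 ≤ s ^ 2 := by nlinarith [sq_nonneg s]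
    linarith
  · calc (min A 1) ^ (2 : ℝ) ≤ 1 ^ (2 : ℝ) := ENNReal.rpow_le_rpow (min_le_right _ _) (by norm_num)
      _ = 1 := ENNReal.one_rpow _
      _ ≤ _ := ENNReal.one_le_ofReal.2 h1

/-- The cost of one step in the plane, for either result of the coin. -/
theorem coin_step_cost_le (c : Bool) (a b : ℝ) :
    (min (‖(0 : St k) - plane a b‖ₑ + ‖(0 : St k) - plane (coinGain c * a + -(3 / 8) * b) 0‖ₑ) 1)
      ^ (2 : ℝ) ≤ ENNReal.ofReal (2 * √|a| + 2 * √|b|) := by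
  refine min_one_rpow_two_le_of_sq (c := 3 * (|a| + |b|)) (by positivity) (by positivity) ?_ ?_
  · have h1 := Real.sq_sqrt (abs_nonneg a)
    have h2 := Real.sq_sqrt (abs_nonneg b)
    have h3 : 0 ≤ √|a| * √|b| := by positivity
    nlinarith [abs_nonneg a, abs_nonneg b]
  · rw [zero_sub, zero_sub, enorm_neg, enorm_neg]
    refine (add_le_add (enorm_plane_le le_rfl) (enorm_plane_le le_rfl)).trans ?_
    rw [← ENNReal.ofReal_add (by positivity) (by positivity)]
    refine ENNReal.ofReal_le_ofReal ?_
    have h1 : |coinGain c * a + -(3 / 8) * b| ≤ 5 / 4 * |a| + 3 / 8 * |b| := by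
      refine (abs_add_le _ _).trans ?_
      simp only [abs_mul]
      have := abs_nonneg a
      cases c <;> norm_num [coinGain, abs_of_pos]
      linarith
    rw [abs_zero]
    linarith [abs_nonneg a, abs_nonneg b]

variable [NeZero k]

/-- The policy that decides between the two gains by a coin. On the data, both inputs are
those of the expert, so that the coin has no effect there. -/
noncomputable def coinFeedback (τ : ℝ) {g : Cov k → ℝ} (hg : Continuous g) : Kernel (St k) (St k) :=
  coinKernel (fun c => feedback τ g (coinGain c) (-(3 / 8)))
    fun _ => (continuous_feedback τ hg _ _).measurable

instance (τ : ℝ) {g : Cov k → ℝ} (hg : Continuous g) : IsMarkovKernel (coinFeedback τ hg) :=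
  isMarkovKernel_coinKernel _ _

theorem isAntiConcentrated_coinFeedback (τ : ℝ) {g : Cov k → ℝ} (hg : Continuous g) :
    IsAntiConcentrated (coinFeedback τ hg) (1 / 4) (1 / 4) := by
  intro x x'
  -- Both actions use the same coin.
  refine ⟨(1 / 2 : ℝ≥0∞) • Measure.dirac (feedback τ g (coinGain true) (-(3 / 8)) x,
      feedback τ g (coinGain true) (-(3 / 8)) x')
    + (1 / 2 : ℝ≥0∞) • Measure.dirac (feedback τ g (coinGain false) (-(3 / 8)) x,
      feedback τ g (coinGain false) (-(3 / 8)) x'), ?_, ?_, fun v => ?_⟩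
  · rw [Measure.map_add _ _ measurable_fst, Measure.map_smul, Measure.map_smul,
      Measure.map_dirac' measurable_fst, Measure.map_dirac' measurable_fst]
    rfl
  · rw [Measure.map_add _ _ measurable_snd, Measure.map_smul, Measure.map_smul,
      Measure.map_dirac' measurable_snd, Measure.map_dirac' measurable_snd]
    rfl
  · have hm : Measurable fun q : St k × St k => (inner ℝ v (q.1 - q.2) : ℝ) :=
      (by fun_prop : Continuous fun q : St k × St k => (inner ℝ v (q.1 - q.2) : ℝ)).measurable
    rw [Measure.map_add _ _ hm, Measure.map_smul, Measure.map_smul, Measure.map_dirac' hm,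
      Measure.map_dirac' hm]
    exact isAntiConcentratedLaw_two_point _ _ (by norm_num) (by norm_num)

theorem policyMean_coinFeedback (τ : ℝ) {g : Cov k → ℝ} (hg : Continuous g) :
    (∀ x, Integrable (fun u => u) (coinFeedback τ hg x)) ∧
      policyMean (coinFeedback τ hg) = feedback τ g (-(5 / 32)) (-(3 / 8)) := by
  have h (b : St k) : Integrable (fun w => w) ((1 / 2 : ℝ≥0∞) • Measure.dirac b) :=
    (integrable_dirac (by simp)).smul_measure (by simp)
  refine ⟨fun x => (h _).add_measure (h _), ?_⟩
  funext x
  rw [policyMean, coinFeedback, coinKernel_apply, integral_add_measure (h _) (h _),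
    integral_smul_measure, integral_smul_measure, integral_dirac, integral_dirac]
  simp only [feedback, planeL_apply, e₁_eq_plane, smul_plane, plane_add, coinGain]
  congr 1 <;> norm_num
  ring

/-- The potential that decreases in expectation along planar trajectories of the coin-tossing
policy. -/
noncomputable def coinPotential (x : St k) : ℝ :=
  32 * √|x (Sum.inl 0)| + 8 * √|x (Sum.inl 1)|

theorem sqrt_abs_mul_le {c d : ℝ} (hd : 0 ≤ d) (h : |c| ≤ d ^ 2) (a : ℝ) : √|c * a| ≤ d * √|a| := by
  rw [abs_mul, Real.sqrt_mul (abs_nonneg c)]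
  gcongr
  exact Real.sqrt_le_iff.2 ⟨hd, h⟩

theorem sqrt_abs_add_le (a b : ℝ) : √|a + b| ≤ √|a| + √|b| := by
  refine Real.sqrt_le_iff.2 ⟨by positivity, (abs_add_le a b).trans ?_⟩
  have h1 := Real.sq_sqrt (abs_nonneg a)
  have h2 := Real.sq_sqrt (abs_nonneg b)
  have h3 : 0 ≤ √|a| * √|b| := by positivity
  nlinarith

/-- In expectation over the coin, the potential decreases by more than the cost of a step. -/
theorem coin_potential_decrease (τ : ℝ) (g : Cov k → ℝ) (i : Fin 2) (ω a b : ℝ) :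
    (2 * √|a| + 2 * √|b|)
      + (coinPotential (dynamics τ g i ω (plane a b) (plane (coinGain true * a + -(3 / 8) * b) 0))
        + coinPotential (dynamics τ g i ω (plane a b)
          (plane (coinGain false * a + -(3 / 8) * b) 0))) / 2
      ≤ coinPotential (plane a b : St k) := by
  have hA := Real.sqrt_nonneg |a|
  have hB := Real.sqrt_nonneg |b|
  have h1 : √|35 / 16 * a| ≤ 3 / 2 * √|a| :=
    sqrt_abs_mul_le (by norm_num) (by norm_num [abs_of_pos]) a
  have h2 : √|-(35 / 16) * a| ≤ 3 / 2 * √|a| :=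
    sqrt_abs_mul_le (by norm_num) (by norm_num [abs_of_pos]) a
  have h3 : √|-(3 / 8) * a| ≤ 3 / 4 * √|a| :=
    sqrt_abs_mul_le (by norm_num) (by norm_num [abs_of_pos]) a
  have h4 : √|1 / 2 * b| ≤ 3 / 4 * √|b| :=
    sqrt_abs_mul_le (by norm_num) (by norm_num [abs_of_pos]) b
  have h5 := sqrt_abs_add_le (-(3 / 8) * a) (1 / 2 * b)
  fin_cases i
  · simp only [Fin.zero_eta, dynamics_plane_zero, coinPotential, plane_inl_zero, plane_inl_one,
      coinGain, if_true, Bool.false_eq_true, if_false, add_zero]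
    have e1 : 5 / 4 * a + 3 / 8 * b + (15 / 16 * a + -(3 / 8) * b) = 35 / 16 * a := by ring
    have e2 : 5 / 4 * a + 3 / 8 * b + (-(5 / 4) * a + -(3 / 8) * b) = 0 := by ring
    rw [e1, e2, abs_zero, Real.sqrt_zero]
    linarith
  · simp only [Fin.mk_one, dynamics_plane_one, coinPotential, plane_inl_zero, plane_inl_one,
      coinGain, if_true, Bool.false_eq_true, if_false, add_zero]
    have e1 : -(15 / 16) * a + 3 / 8 * b + (15 / 16 * a + -(3 / 8) * b) = 0 := by ring
    have e2 : -(15 / 16) * a + 3 / 8 * b + (-(5 / 4) * a + -(3 / 8) * b) = -(35 / 16) * a := by ring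
    rw [e1, e2, abs_zero, Real.sqrt_zero]
    linarith

theorem half_mul_ofReal (r : ℝ) : (1 / 2 : ℝ≥0∞) * ENNReal.ofReal r = ENNReal.ofReal (r / 2) := by
  rw [mul_comm, ENNReal.ofReal_div_of_pos two_pos, ENNReal.ofReal_ofNat, one_div, div_eq_mul_inv]

/-- The bound for the expected future cost of the coin-tossing policy, started at the offset with
regression error `d`. -/
noncomputable def coinBound (d : ℝ) : ∀ t, Hist (St k) (St k) t → ℝ≥0∞
  | 0, _ => ENNReal.ofReal (64 * √|d|)
  | t + 1, h => ENNReal.ofReal (coinPotential (h.1 (Fin.last (t + 1))))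

/-- The histories that start at `x` and are in the plane at positive times. -/
def IsCoinHist (x : St k) : ∀ t, Hist (St k) (St k) t → Prop
  | 0, h => h.1 0 = x
  | t + 1, h => h.1 0 = x ∧ ∃ a b : ℝ, h.1 (Fin.last (t + 1)) = plane a b

/-- The expected squared cost of the coin-tossing policy from the offset. -/
theorem startExp_coinFeedback_le {τ : ℝ} (hτ₀ : 0 < τ) (hτ₁ : τ < 1) (H : ℕ) {L₀ M₀ : ℝ≥0}
    {y g : Cov k → ℝ} (hy : IsRegularFun L₀ M₀ y) (hg : IsRegularFun L₀ M₀ g) (i : Fin 2) {ω : ℝ}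
    (hω : ω ∈ ({-1, 1} : Set ℝ)) {z : Cov k} (hz : ‖z‖ ≤ 1) :
    startExp (staticPolicy (coinFeedback τ hy.lipschitz.continuous)) (dynamics τ g i ω) H
        (trajCost (expertPolicy τ g i) (dynamics τ g i ω) H) (xOffset + embTail z)
      ≤ ENNReal.ofReal (64 * √|y z - g z|) := by
  have hpot : ∀ x : St k, 0 ≤ coinPotential x := fun x => by unfold coinPotential; positivity
  have hτy : |τ * y z| ≤ 1 := by
    rw [abs_mul, abs_of_pos hτ₀]
    exact mul_le_one₀ hτ₁.le (abs_nonneg _) (hy.bound z hz)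
  have hplane : ∀ a b p : ℝ, ∃ a' b' : ℝ,
      dynamics τ g i ω (plane a b) (plane p 0) = (plane a' b' : St k) := by
    intro a b p
    fin_cases i
    · exact ⟨_, _, dynamics_plane_zero _ _ _ _ _ _ _⟩
    · exact ⟨_, _, dynamics_plane_one _ _ _ _ _ _ _⟩
  refine (startExp_mono _ _ (F' := fun h => trajCost (expertPolicy τ g i) (dynamics τ g i ω) H h
    + coinBound (y z - g z) H h) (fun h => le_self_add) _).trans ?_
  refine (startExp_le_of_potential _ _ _ (IsCoinHist (xOffset + embTail z)) rfl ?_ (fun t h =>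
    trajCost (expertPolicy τ g i) (dynamics τ g i ω) t h + coinBound (y z - g z) t h) ?_ H).trans ?_
  · intro t h hh
    rw [staticPolicy_apply, coinFeedback, coinKernel_apply, ae_add_measure_iff]
    have hgood : ∀ c, IsCoinHist (xOffset + embTail z) (t + 1)
        (stepHist (dynamics τ g i ω) h
          (feedback τ y (coinGain c) (-(3 / 8)) (h.1 (Fin.last t)))) := by
      intro c
      rw [IsCoinHist, stepHist_fst_zero, stepHist_fst_last]
      rcases t with _ | t
      · have hh' : h.1 (Fin.last 0) = xOffset + embTail z := hh
        rw [hh', feedback_offset _ _ _ _ hz, dynamics_offset hτ₀.ne' g i ω hz hτy]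
        exact ⟨hh, _, _, rfl⟩
      · obtain ⟨h0, a, b, hab⟩ := hh
        rw [hab, feedback_plane]
        exact ⟨h0, hplane _ _ _⟩
    constructor
    · exact Measure.ae_smul_measure (by rw [ae_dirac_eq]; exact hgood true) _
    · exact Measure.ae_smul_measure (by rw [ae_dirac_eq]; exact hgood false) _
  · intro t h hh
    simp only
    rw [staticPolicy_apply, coinFeedback, lintegral_coinKernel, trajCost_stepHist,
      trajCost_stepHist]
    set A := trajCost (expertPolicy τ g i) (dynamics τ g i ω) t h
    rcases t with _ | t
    · have hh' : h.1 (Fin.last 0) = xOffset + embTail z := hh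
      have hh0 : h.1 0 = xOffset + embTail z := hh
      simp only [coinBound, stepHist_fst_last]
      rw [hh', hh0, feedback_offset _ _ _ _ hz, feedback_offset _ _ _ _ hz, expertState, sub_self,
        enorm_zero, zero_add, expertPolicy_offset τ g i hz, plane_sub, sub_zero,
        dynamics_offset hτ₀.ne' g i ω hz hτy, ← add_mul]
      have h1 : (min ‖(plane (τ * g z - τ * y z) 0 : St k)‖ₑ 1) ^ (2 : ℝ)
          ≤ ENNReal.ofReal (√|y z - g z|) := by
        refine min_one_rpow_two_le_of_sq (c := |y z - g z|) (by positivity) (by positivity)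
          (Real.sq_sqrt (abs_nonneg _)).ge (enorm_plane_le ?_)
        rw [← mul_sub, abs_zero, add_zero, abs_mul, abs_of_pos hτ₀, abs_sub_comm]
        exact mul_le_of_le_one_left (abs_nonneg _) hτ₁.le
      have h2 : coinPotential (plane (τ * (1 - ω * τ) * (y z - g z)) 0 : St k)
          ≤ 63 * √|y z - g z| := by
        have h3 := Real.sqrt_nonneg |y z - g z|
        have h4 : √|τ * (1 - ω * τ) * (y z - g z)| ≤ 3 / 2 * √|y z - g z| := by
          refine Real.sqrt_le_iff.2 ⟨by positivity, (abs_deviation_le hτ₀ hτ₁ hω _).trans ?_⟩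
          rw [mul_pow, Real.sq_sqrt (abs_nonneg _)]
          nlinarith [abs_nonneg (y z - g z)]
        simp only [coinPotential, plane_inl_zero, plane_inl_one, abs_zero, Real.sqrt_zero]
        linarith
      have h5 : (1 / 2 : ℝ≥0∞) + 1 / 2 = 1 := by simp [ENNReal.inv_two_add_inv_two]
      rw [h5, one_mul, add_assoc]
      gcongr
      refine (add_le_add h1 (ENNReal.ofReal_le_ofReal h2)).trans ?_
      rw [← ENNReal.ofReal_add (by positivity) (by positivity)]
      exact ENNReal.ofReal_le_ofReal (by linarith)
    · obtain ⟨h0, a, b, hab⟩ := hh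
      simp only [coinBound, stepHist_fst_last]
      rw [h0, expertState_offset hτ₀ hτ₁ hg.bound i ω hz, expertPolicy_zero, hab, feedback_plane,
        feedback_plane]
      have h5 : (1 / 2 : ℝ≥0∞) * A + 1 / 2 * A = A := by
        rw [← add_mul]; simp [ENNReal.inv_two_add_inv_two]
      have h6 : ∀ c, (1 / 2 : ℝ≥0∞) * (A + (min (‖(0 : St k) - plane a b‖ₑ
          + ‖(0 : St k) - plane (coinGain c * a + -(3 / 8) * b) 0‖ₑ) 1) ^ (2 : ℝ)
          + ENNReal.ofReal (coinPotential
            (dynamics τ g i ω (plane a b) (plane (coinGain c * a + -(3 / 8) * b) 0))))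
          ≤ 1 / 2 * A + ENNReal.ofReal ((2 * √|a| + 2 * √|b| + coinPotential
            (dynamics τ g i ω (plane a b) (plane (coinGain c * a + -(3 / 8) * b) 0))) / 2) := by
        intro c
        rw [add_assoc, mul_add]
        gcongr
        rw [← half_mul_ofReal, ENNReal.ofReal_add (by positivity) (hpot _)]
        gcongr
        exact coin_step_cost_le c a b
      refine (add_le_add (h6 true) (h6 false)).trans ?_
      have hp : ∀ c, 0 ≤ (2 * √|a| + 2 * √|b| + coinPotential
          (dynamics τ g i ω (plane a b) (plane (coinGain c * a + -(3 / 8) * b) 0))) / 2 := by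
        intro c
        have := hpot (dynamics τ g i ω (plane a b) (plane (coinGain c * a + -(3 / 8) * b) 0))
        positivity
      rw [add_add_add_comm, h5, ← ENNReal.ofReal_add (hp true) (hp false)]
      gcongr
      have := coin_potential_decrease τ g i ω a b
      linarith
  · simp only [trajCost_zero, zero_add]
    exact le_rfl

theorem trajRisk_coinFeedback_le {D : Measure (Cov k)} [IsProbabilityMeasure D]
    (hD : ∀ᵐ z ∂D, ‖z‖ ≤ 1) {τ Δ : ℝ} (hτ₀ : 0 < τ) (hτ₁ : τ < 1) (hΔ₀ : 0 < Δ) (hΔ₁ : Δ < 1)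
    (H : ℕ) {L₀ M₀ : ℝ≥0} {y g : Cov k → ℝ} (hy : IsRegularFun L₀ M₀ y)
    (hg : IsRegularFun L₀ M₀ g) (i : Fin 2) {ω : ℝ} (hω : ω ∈ ({-1, 1} : Set ℝ)) :
    trajRisk 2 (staticPolicy (coinFeedback τ hy.lipschitz.continuous)) (expertPolicy τ g i)
        (dynamics τ g i ω) (initLaw D Δ) H
      ≤ (8 : ℝ≥0) * regDist D y g ^ (1 / 4 : ℝ) := by
  refine (trajRisk_le_of_near hΔ₀ hΔ₁ H _ hg.lipschitz.continuous i ω ?_).trans ?_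
  · intro xs hxs _ us t
    rw [staticPolicy_apply, coinFeedback, coinKernel_apply]
    simp only [seqHist, Fin.val_last]
    rw [feedback_of_isNear _ _ _ _ (hxs t), feedback_of_isNear _ _ _ _ (hxs t), ← add_smul]
    simp [ENNReal.inv_two_add_inv_two]
  · have hm : Measurable fun z => ‖y z - g z‖ₑ ^ 2 :=
      ((hy.lipschitz.continuous.sub hg.lipschitz.continuous).measurable.enorm).pow_const 2
    have h1 : ∀ z, ENNReal.ofReal (64 * √|y z - g z|)
        = 64 * (‖y z - g z‖ₑ ^ 2) ^ (1 / 4 : ℝ) := by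
      intro z
      rw [ENNReal.ofReal_mul (by norm_num), Real.sqrt_eq_rpow,
        ← ENNReal.ofReal_rpow_of_nonneg (abs_nonneg _) (by norm_num), ← Real.norm_eq_abs,
        ofReal_norm, ENNReal.ofReal_ofNat, ← ENNReal.rpow_two, ← ENNReal.rpow_mul]
      norm_num
    calc _ ≤ (∫⁻ z, 64 * (‖y z - g z‖ₑ ^ 2) ^ (1 / 4 : ℝ) ∂D) ^ (1 / 2 : ℝ) := by
          refine ENNReal.rpow_le_rpow (lintegral_mono_ae ?_) (by norm_num)
          filter_upwards [hD] with z hz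
          exact (startExp_coinFeedback_le hτ₀ hτ₁ H hy hg i hω hz).trans (h1 z).le
      _ ≤ (64 * (∫⁻ z, ‖y z - g z‖ₑ ^ 2 ∂D) ^ (1 / 4 : ℝ)) ^ (1 / 2 : ℝ) := by
          rw [lintegral_const_mul _ (hm.pow_const _)]
          gcongr
          exact lintegral_rpow_le_rpow_lintegral D hm (by norm_num) (by norm_num)
      _ = _ := by
          have h64 : (64 : ℝ≥0∞) ^ (1 / 2 : ℝ) = (8 : ℝ≥0) := by
            rw [show (64 : ℝ≥0∞) = (8 : ℝ≥0∞) ^ (2 : ℝ) by norm_num, ← ENNReal.rpow_mul]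
            norm_num
          rw [ENNReal.mul_rpow_of_nonneg _ _ (by norm_num), h64, regDist, ← ENNReal.rpow_mul,
            ← ENNReal.rpow_mul]
          norm_num

end Coin

/-! ### The minimax risks -/

section Smoothness

variable {E F : Type} [NormedAddCommGroup E] [NormedSpace ℝ E] [NormedAddCommGroup F]
  [InnerProductSpace ℝ F]

theorem IsSmoothWith.mono {M M' : ℝ≥0∞} {φ : E → F} (h : IsSmoothWith M φ) (hM : M ≤ M') :
    IsSmoothWith M' φ :=
  fun v hv => ⟨(h v hv).1, fun x => ((h v hv).2 x).trans hM⟩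

theorem IsSmoothWith.add_top {M : ℝ≥0∞} {φ ψ : E → F} (h : IsSmoothWith M φ)
    (hψ : ContDiff ℝ 2 ψ) : IsSmoothWith ∞ (fun x => φ x + ψ x) := by
  refine fun v hv => ⟨?_, fun x => le_top⟩
  simp only [inner_add_right]
  exact (h v hv).1.add (contDiff_const.inner ℝ hψ)

end Smoothness

section Minimax

variable {k : ℕ}

theorem lipschitzWith_switch_coord {S : ℝ≥0} {δ : ℝ}
    (hS : ∀ a b a' b', |switch δ a b - switch δ a' b'| ≤ S * |a - a'| + S * |b - b'|) :
    LipschitzWith (5 * S)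
      (fun x : St k => (35 / 16 * switch δ (x (Sum.inl 0)) (x (Sum.inl 1))) • (e₁ : St k)) := by
  refine LipschitzWith.of_dist_le_mul fun x y => ?_
  rw [dist_eq_norm, dist_eq_norm, ← sub_smul, ← mul_sub, norm_smul, norm_e₁, mul_one, norm_mul,
    Real.norm_eq_abs (switch _ _ _ - _)]
  have h0 : |x (Sum.inl 0) - y (Sum.inl 0)| ≤ ‖x - y‖ := PiLp.norm_apply_le (x - y) (Sum.inl 0)
  have h1 : |x (Sum.inl 1) - y (Sum.inl 1)| ≤ ‖x - y‖ := PiLp.norm_apply_le (x - y) (Sum.inl 1)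
  have h2 := hS (x (Sum.inl 0)) (x (Sum.inl 1)) (y (Sum.inl 0)) (y (Sum.inl 1))
  have h3 : (S : ℝ) * |x (Sum.inl 0) - y (Sum.inl 0)| ≤ S * ‖x - y‖ := by gcongr
  have h4 : (S : ℝ) * |x (Sum.inl 1) - y (Sum.inl 1)| ≤ S * ‖x - y‖ := by gcongr
  have h5 : 0 ≤ (S : ℝ) * ‖x - y‖ := by positivity
  rw [Real.norm_of_nonneg (by norm_num), NNReal.coe_mul, NNReal.coe_ofNat]
  linarith

variable [NeZero k]

/-- The localized regression functions of the class are `K`-Lipschitz and `K`-smooth. -/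
def HasLocalizedBound (k : ℕ) [NeZero k] (L₀ M₀ K : ℝ≥0) : Prop :=
  ∀ g : Cov k → ℝ, IsRegularFun L₀ M₀ g → ContDiff ℝ 2 (localized g) ∧
    LipschitzWith K (localized g) ∧ ∀ x, ‖iteratedFDeriv ℝ 2 (localized g) x‖ ≤ K

variable {L₀ M₀ K : ℝ≥0}

theorem HasLocalizedBound.add_linear {F : Type} [NormedAddCommGroup F] [InnerProductSpace ℝ F]
    (hK : HasLocalizedBound k L₀ M₀ K) {τ : ℝ} (hτ₀ : 0 < τ) (hτ₁ : τ < 1) {g : Cov k → ℝ}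
    (hg : IsRegularFun L₀ M₀ g) {l : St k →L[ℝ] F} (hl : ‖l‖ ≤ 6) {w : F} (hw : ‖w‖ ≤ 1) :
    LipschitzWith (6 + K) (fun x => l x + (τ * localized g x) • w) ∧
      IsSmoothWith (K : ℝ≥0∞) (fun x => l x + (τ * localized g x) • w) := by
  obtain ⟨h1, h2, h3⟩ := hK g hg
  exact lipschitz_smooth_linear_add h1 h2 h3 (by rw [abs_of_pos hτ₀]; exact hτ₁.le) l
    (by exact_mod_cast hl) hw

theorem HasLocalizedBound.feedback (hK : HasLocalizedBound k L₀ M₀ K) {τ : ℝ} (hτ₀ : 0 < τ)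
    (hτ₁ : τ < 1) {g : Cov k → ℝ} (hg : IsRegularFun L₀ M₀ g) {L M : ℝ≥0} (hL : 6 + K ≤ L)
    (hM : K ≤ M) {c s : ℝ} (hcs : |c| + |s| ≤ 6) :
    LipschitzWith L (feedback τ g c s) ∧ IsSmoothWith (M : ℝ≥0∞) (feedback τ g c s) := by
  obtain ⟨h1, h2⟩ := hK.add_linear hτ₀ hτ₁ hg (l := planeL c s 0 0)
    ((norm_planeL_le _ _ _ _).trans (by simpa using hcs)) (w := e₁) norm_e₁.le
  exact ⟨h1.weaken hL, h2.mono (by exact_mod_cast hM)⟩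

variable {G : Set (Cov k → ℝ)} {D : Measure (Cov k)} [IsProbabilityMeasure D] {τ Δ : ℝ} {L M : ℝ≥0}

theorem trajMinimax_periodAlgs_le (hK : HasLocalizedBound k L₀ M₀ K)
    (hreg : IsRegularReg G D 1 L₀ M₀) (hL : 6 + K ≤ L) (hM : K ≤ M) (hτ₀ : 0 < τ) (hτ₁ : τ < 1)
    (hΔ₀ : 0 < Δ) (hΔ₁ : Δ < 1) (n H : ℕ) :
    trajMinimax (periodAlgs n H L M 3) G D τ Δ
      ≤ 2 * (200 * τ.toNNReal : ℝ≥0) * (ENNReal.ofReal (Real.exp (-(headsRate * n)))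
          + regMinimax ⌈(n : ℝ) / 3⌉₊ G D ^ (1 : ℝ)) := by
  refine trajMinimax_le_of_policies hreg hτ₀.ne' hΔ₀ hΔ₁ _ one_pos le_rfl fun η _ y hy =>
    ⟨periodPolicy τ hy.lipschitz.continuous,
      ⟨fun j => feedback τ y (periodGain j) (-(3 / 8)), fun j => ?_, fun t h => ?_⟩,
      fun g hg i ω hω => ?_⟩
  · refine hK.feedback hτ₀ hτ₁ hy hL hM ?_
    fin_cases j <;> norm_num [periodGain, abs_of_pos]
  · rw [periodPolicy, detPolicy_apply]
  · rw [ENNReal.rpow_one]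
    refine (trajRisk_periodPolicy_le hreg.support_bound hτ₀ hτ₁ hΔ₀ hΔ₁ H hy hg i hω).trans ?_
    gcongr

theorem trajMinimax_chunkAlgs_le (hK : HasLocalizedBound k L₀ M₀ K)
    (hreg : IsRegularReg G D 1 L₀ M₀) (hL : 6 + K ≤ L) (hM : K ≤ M) (hτ₀ : 0 < τ) (hτ₁ : τ < 1)
    (hΔ₀ : 0 < Δ) (hΔ₁ : Δ < 1) (n H : ℕ) :
    trajMinimax (chunkAlgs n H L M 3) G D τ Δ
      ≤ 2 * (200 * τ.toNNReal : ℝ≥0) * (ENNReal.ofReal (Real.exp (-(headsRate * n)))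
          + regMinimax ⌈(n : ℝ) / 3⌉₊ G D ^ (1 : ℝ)) := by
  refine trajMinimax_le_of_policies hreg hτ₀.ne' hΔ₀ hΔ₁ _ one_pos le_rfl fun η _ y hy =>
    ⟨chunkPolicy τ hy.lipschitz.continuous,
      ⟨chunkMap τ y, ?_, ?_, fun t h => ?_⟩, fun g hg i ω hω => ?_⟩
  · exact (hK.add_linear hτ₀ hτ₁ hy norm_chunkL_le norm_chunkDir_le).1.weaken hL
  · exact (hK.add_linear hτ₀ hτ₁ hy norm_chunkL_le norm_chunkDir_le).2.mono (by exact_mod_cast hM)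
  · rw [chunkPolicy, detPolicy_apply]
  · rw [ENNReal.rpow_one]
    refine (trajRisk_chunkPolicy_le hreg.support_bound hτ₀ hτ₁ hΔ₀ hΔ₁ H hy hg i hω).trans ?_
    gcongr

theorem trajMinimax_genSmoothAlgs_le (hK : HasLocalizedBound k L₀ M₀ K)
    (hreg : IsRegularReg G D 1 L₀ M₀) (hL : 6 + K ≤ L) (hM : K ≤ M) (hτ₀ : 0 < τ) (hτ₁ : τ < 1)
    (hΔ₀ : 0 < Δ) (hΔ₁ : Δ < 1) (n H : ℕ) :
    trajMinimax (genSmoothAlgs n H L M (1 / 4) (1 / 4)) G D τ Δ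
      ≤ 2 * (8 : ℝ≥0) * (ENNReal.ofReal (Real.exp (-(headsRate * n)))
          + regMinimax ⌈(n : ℝ) / 3⌉₊ G D ^ (1 / 4 : ℝ)) := by
  refine trajMinimax_le_of_policies hreg hτ₀.ne' hΔ₀ hΔ₁ _ (by norm_num) (by norm_num)
    fun η _ y hy => ⟨staticPolicy (coinFeedback τ hy.lipschitz.continuous),
      ⟨coinFeedback τ hy.lipschitz.continuous, fun _ _ => rfl,
        ⟨(policyMean_coinFeedback _ _).1, ?_⟩, isAntiConcentrated_coinFeedback _ _⟩,
      fun g hg i ω hω => ?_⟩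
  · rw [(policyMean_coinFeedback _ _).2]
    exact hK.feedback hτ₀ hτ₁ hy hL hM (by norm_num [abs_of_pos])
  · exact (trajRisk_coinFeedback_le hreg.support_bound hτ₀ hτ₁ hΔ₀ hΔ₁ H hy hg i hω).trans
      le_self_add

theorem trajMinimax_simpleAlgs_le (hK : HasLocalizedBound k L₀ M₀ K) {S : ℝ≥0}
    (hS : ∀ δ : ℝ, 0 < δ → ∀ a b a' b',
      |switch δ a b - switch δ a' b'| ≤ S * |a - a'| + S * |b - b'|)
    (hreg : IsRegularReg G D 1 L₀ M₀) (hL : 6 + K + 5 * S ≤ L) (hτ₀ : 0 < τ) (hτ₁ : τ < 1)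
    (hΔ₀ : 0 < Δ) (hΔ₁ : Δ < 1) (n H : ℕ) :
    trajMinimax (simpleAlgs n H L ∞) G D τ Δ
      ≤ 2 * (200 * τ.toNNReal : ℝ≥0) * (ENNReal.ofReal (Real.exp (-(headsRate * n)))
          + regMinimax ⌈(n : ℝ) / 3⌉₊ G D ^ (1 : ℝ)) := by
  refine trajMinimax_le_of_policies hreg hτ₀.ne' hΔ₀ hΔ₁ _ one_pos le_rfl fun η hη y hy => ?_
  set δ : ℝ := η / (10 ^ (H + 1) * (H + 1)) with hδ
  have hδ₀ : 0 < δ := by positivity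
  have hδη : 10 ^ (H + 1) * (H + 1) * δ ≤ η := by
    rw [hδ, mul_div_cancel₀ _ (by positivity)]
  have hm := (continuous_switchFeedback hδ₀ τ hy.lipschitz.continuous).measurable
  have hmean : policyMean (Kernel.deterministic (switchFeedback δ τ y) hm)
      = switchFeedback δ τ y := by
    funext x
    rw [policyMean, Kernel.deterministic_apply, integral_dirac]
  have hlin := hK.add_linear hτ₀ hτ₁ hy (l := planeL (-(5 / 4)) (-(3 / 8)) 3 0)
    ((norm_planeL_le _ _ _ _).trans (by norm_num [abs_of_pos])) (w := e₁) norm_e₁.le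
  refine ⟨switchPolicy hδ₀ τ hy.lipschitz.continuous,
    ⟨Kernel.deterministic (switchFeedback δ τ y) hm, fun t h => ?_, ⟨fun x => ?_, ?_, ?_⟩,
      fun x x' => ?_⟩, fun g hg i ω hω => ?_⟩
  · rw [switchPolicy, detPolicy_apply, Kernel.deterministic_apply]
  · rw [Kernel.deterministic_apply]
    exact integrable_dirac (by simp)
  · rw [hmean]
    exact (hlin.1.add (lipschitzWith_switch_coord (hS δ hδ₀))).weaken hL
  · rw [hmean]
    exact hlin.2.add_top ((contDiff_const.mul (contDiff_switch hδ₀)).smul contDiff_const)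
  · -- A deterministic policy has no deviation from its mean.
    rw [hmean, Kernel.deterministic_apply, Kernel.deterministic_apply,
      Measure.map_dirac' (by fun_prop), Measure.map_dirac' (by fun_prop), sub_self, sub_self]
  · rw [ENNReal.rpow_one]
    exact trajRisk_switchPolicy_le hreg.support_bound hτ₀ hτ₁ hΔ₀ hΔ₁ H hδ₀ hδη hy hg i hω

end Minimax

/-- The regression rate at `⌈n / 3⌉` points in terms of `n`. -/
theorem regMinimax_ceil_le {k : ℕ} {G : Set (Cov k → ℝ)} {D : Measure (Cov k)} {a : ℝ} (ha : 0 ≤ a)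
    {B : ℝ≥0} (h : ∀ m : ℕ, 1 ≤ m → regMinimax m G D ≤ B * ENNReal.ofReal ((m : ℝ) ^ (-a)))
    {n : ℕ} (hn : 1 ≤ n) :
    regMinimax ⌈(n : ℝ) / 3⌉₊ G D
      ≤ (1 + B * (3 ^ a : ℝ).toNNReal : ℝ≥0) * ENNReal.ofReal ((n : ℝ) ^ (-a)) := by
  have hn₀ : (0 : ℝ) < n := by exact_mod_cast hn
  have h1 : (⌈(n : ℝ) / 3⌉₊ : ℝ) ^ (-a) ≤ (3 ^ a : ℝ) * (n : ℝ) ^ (-a) := by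
    calc (⌈(n : ℝ) / 3⌉₊ : ℝ) ^ (-a) ≤ ((n : ℝ) / 3) ^ (-a) :=
          Real.rpow_le_rpow_of_nonpos (by positivity) (Nat.le_ceil _) (by linarith)
      _ = _ := by
          rw [Real.div_rpow hn₀.le (by norm_num), Real.rpow_neg (by norm_num : (0 : ℝ) ≤ 3),
            div_inv_eq_mul, mul_comm]
  calc _ ≤ (B : ℝ≥0∞) * ENNReal.ofReal ((⌈(n : ℝ) / 3⌉₊ : ℝ) ^ (-a)) :=
        h _ (Nat.ceil_pos.2 (by positivity))
    _ ≤ (B : ℝ≥0∞) * ENNReal.ofReal ((3 ^ a : ℝ) * (n : ℝ) ^ (-a)) := by gcongr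
    _ = (B * (3 ^ a : ℝ).toNNReal : ℝ≥0) * ENNReal.ofReal ((n : ℝ) ^ (-a)) := by
        rw [ENNReal.ofReal_mul (by positivity), ENNReal.coe_mul, mul_assoc]
        rfl
    _ ≤ _ := by
        gcongr
        exact le_add_self

/-- A bound in terms of the regression risk yields one in terms of a rate of the risk. -/
theorem mul_add_rpow_le {C A : ℝ≥0} (hA : 1 ≤ A) {e r ε : ℝ≥0∞} (h : ε ≤ A * r) {θ : ℝ}
    (hθ₀ : 0 < θ) (hθ₁ : θ ≤ 1) :
    (C : ℝ≥0∞) * (e + ε ^ θ) ≤ (C * A : ℝ≥0) * (e + r ^ θ) := by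
  have hA' : (1 : ℝ≥0∞) ≤ A := by exact_mod_cast hA
  rw [ENNReal.coe_mul, mul_assoc, mul_add (A : ℝ≥0∞)]
  gcongr
  · exact le_mul_of_one_le_left' hA'
  · calc ε ^ θ ≤ (A * r) ^ θ := ENNReal.rpow_le_rpow h hθ₀.le
      _ = (A : ℝ≥0∞) ^ θ * r ^ θ := ENNReal.mul_rpow_of_nonneg _ _ hθ₀.le
      _ ≤ _ := by
          gcongr
          calc (A : ℝ≥0∞) ^ θ ≤ (A : ℝ≥0∞) ^ (1 : ℝ) :=
                ENNReal.rpow_le_rpow_of_exponent_le hA' hθ₁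
            _ = A := ENNReal.rpow_one _

end CompoundingIL

theorem mainTheorem9 :
    ∃ (C : ℝ≥0) (c q τ₀ : ℝ) (L₁ M₁ : ℝ≥0 → ℝ≥0 → ℝ≥0),
      0 < c ∧ 0 < q ∧ q < 1 ∧ 0 < τ₀ ∧
      ∀ (k : ℕ) [NeZero k],
        -- the bounds in terms of the minimax regression risk
        (∀ (L₀ M₀ : ℝ≥0) (G : Set (Cov k → ℝ)) (D : Measure (Cov k)) [IsProbabilityMeasure D],
          IsRegularReg G D 1 L₀ M₀ →
          ∀ (L M : ℝ≥0), L₁ L₀ M₀ ≤ L → M₁ L₀ M₀ ≤ M →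
          ∀ (τ Δ : ℝ), 0 < τ → τ < 1 → 0 < Δ → Δ < 1 →
          ∀ (n H : ℕ),
            trajMinimax (simpleAlgs n H L ∞) G D τ Δ
              ≤ C * (ENNReal.ofReal (Real.exp (-(c * n))) + regMinimax ⌈(n : ℝ) / 3⌉₊ G D) ∧
            trajMinimax (genSmoothAlgs n H L M (1 / 4) (1 / 4)) G D τ Δ
              ≤ C * (ENNReal.ofReal (Real.exp (-(c * n)))
                  + regMinimax ⌈(n : ℝ) / 3⌉₊ G D ^ (1 - q)) ∧
            trajMinimax (chunkAlgs n H L M 3) G D τ Δ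
              ≤ C * (ENNReal.ofReal (Real.exp (-(c * n))) + regMinimax ⌈(n : ℝ) / 3⌉₊ G D) ∧
            trajMinimax (periodAlgs n H L M 3) G D τ Δ
              ≤ C * (ENNReal.ofReal (Real.exp (-(c * n))) + regMinimax ⌈(n : ℝ) / 3⌉₊ G D) ∧
            (τ ≤ τ₀ →
              trajMinimax (chunkAlgs n H L M 3) G D τ Δ
                ≤ ENNReal.ofReal (Real.exp (-(c * n))) + regMinimax ⌈(n : ℝ) / 3⌉₊ G D ∧
              trajMinimax (periodAlgs n H L M 3) G D τ Δ
                ≤ ENNReal.ofReal (Real.exp (-(c * n))) + regMinimax ⌈(n : ℝ) / 3⌉₊ G D)) ∧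
        -- the bounds for regression classes of rate `n^{-s/k}`
        (∀ (s : ℕ) (B : ℝ≥0), ∃ C' : ℝ≥0,
          ∀ (L₀ M₀ : ℝ≥0) (G : Set (Cov k → ℝ)) (D : Measure (Cov k)) [IsProbabilityMeasure D],
          IsRegularReg G D 1 L₀ M₀ →
          (∀ m : ℕ, 1 ≤ m → regMinimax m G D
            ≤ B * ENNReal.ofReal ((m : ℝ) ^ (-((s : ℝ) / k)))) →
          ∀ (L M : ℝ≥0), L₁ L₀ M₀ ≤ L → M₁ L₀ M₀ ≤ M →
          ∀ (τ Δ : ℝ), 0 < τ → τ < 1 → 0 < Δ → Δ < 1 →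
          ∀ (n H : ℕ), 1 ≤ n →
            trajMinimax (simpleAlgs n H L ∞) G D τ Δ
              ≤ C' * (ENNReal.ofReal (Real.exp (-(c * n)))
                  + ENNReal.ofReal ((n : ℝ) ^ (-((s : ℝ) / k)))) ∧
            trajMinimax (genSmoothAlgs n H L M (1 / 4) (1 / 4)) G D τ Δ
              ≤ C' * (ENNReal.ofReal (Real.exp (-(c * n)))
                  + ENNReal.ofReal ((n : ℝ) ^ (-((s : ℝ) / k))) ^ (1 - q)) ∧
            trajMinimax (chunkAlgs n H L M 3) G D τ Δ
              ≤ C' * (ENNReal.ofReal (Real.exp (-(c * n)))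
                  + ENNReal.ofReal ((n : ℝ) ^ (-((s : ℝ) / k)))) ∧
            trajMinimax (periodAlgs n H L M 3) G D τ Δ
              ≤ C' * (ENNReal.ofReal (Real.exp (-(c * n)))
                  + ENNReal.ofReal ((n : ℝ) ^ (-((s : ℝ) / k))))) := by
  obtain ⟨C, hC⟩ := exists_localized_bound
  obtain ⟨S, hS⟩ := exists_switch_lipschitz
  have hq : (1 : ℝ) - 3 / 4 = 1 / 4 := by norm_num
  have main : ∀ (k : ℕ) [NeZero k] (L₀ M₀ : ℝ≥0) (G : Set (Cov k → ℝ)) (D : Measure (Cov k))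
      [IsProbabilityMeasure D], IsRegularReg G D 1 L₀ M₀ →
      ∀ (L M : ℝ≥0), 6 + C * (1 + 2 * L₀ + M₀) + 5 * S ≤ L → C * (1 + 2 * L₀ + M₀) ≤ M →
      ∀ (τ Δ : ℝ), 0 < τ → τ < 1 → 0 < Δ → Δ < 1 → ∀ (n H : ℕ),
        trajMinimax (simpleAlgs n H L ∞) G D τ Δ
          ≤ (400 : ℝ≥0) * (ENNReal.ofReal (Real.exp (-(headsRate * n)))
            + regMinimax ⌈(n : ℝ) / 3⌉₊ G D ^ (1 : ℝ)) ∧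
        trajMinimax (genSmoothAlgs n H L M (1 / 4) (1 / 4)) G D τ Δ
          ≤ (400 : ℝ≥0) * (ENNReal.ofReal (Real.exp (-(headsRate * n)))
            + regMinimax ⌈(n : ℝ) / 3⌉₊ G D ^ (1 / 4 : ℝ)) ∧
        trajMinimax (chunkAlgs n H L M 3) G D τ Δ
          ≤ (400 : ℝ≥0) * (ENNReal.ofReal (Real.exp (-(headsRate * n)))
            + regMinimax ⌈(n : ℝ) / 3⌉₊ G D ^ (1 : ℝ)) ∧
        trajMinimax (periodAlgs n H L M 3) G D τ Δ
          ≤ (400 : ℝ≥0) * (ENNReal.ofReal (Real.exp (-(headsRate * n)))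
            + regMinimax ⌈(n : ℝ) / 3⌉₊ G D ^ (1 : ℝ)) ∧
        (τ ≤ 1 / 400 →
          trajMinimax (chunkAlgs n H L M 3) G D τ Δ
            ≤ ENNReal.ofReal (Real.exp (-(headsRate * n)))
              + regMinimax ⌈(n : ℝ) / 3⌉₊ G D ^ (1 : ℝ) ∧
          trajMinimax (periodAlgs n H L M 3) G D τ Δ
            ≤ ENNReal.ofReal (Real.exp (-(headsRate * n)))
              + regMinimax ⌈(n : ℝ) / 3⌉₊ G D ^ (1 : ℝ)) := by
    intro k _ L₀ M₀ G D _ hreg L M hL hM τ Δ hτ₀ hτ₁ hΔ₀ hΔ₁ n H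
    have hK : HasLocalizedBound k L₀ M₀ (C * (1 + 2 * L₀ + M₀)) := hC k L₀ M₀
    have hL' : 6 + C * (1 + 2 * L₀ + M₀) ≤ L := le_self_add.trans hL
    have hconst : ∀ r : ℝ≥0, 2 * (200 * τ.toNNReal) ≤ r →
        (2 : ℝ≥0∞) * (200 * τ.toNNReal : ℝ≥0) ≤ r := fun r hr => by exact_mod_cast hr
    have h400 : (2 : ℝ≥0∞) * (200 * τ.toNNReal : ℝ≥0) ≤ (400 : ℝ≥0) := by
      refine hconst _ (NNReal.coe_le_coe.1 ?_)
      push_cast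
      rw [Real.coe_toNNReal _ hτ₀.le]
      linarith
    have h8 : (2 : ℝ≥0∞) * (8 : ℝ≥0) ≤ (400 : ℝ≥0) := by norm_num
    refine ⟨?_, ?_, ?_, ?_, fun hτ => ?_⟩
    · exact (trajMinimax_simpleAlgs_le hK hS hreg hL hτ₀ hτ₁ hΔ₀ hΔ₁ n H).trans (by gcongr)
    · exact (trajMinimax_genSmoothAlgs_le hK hreg hL' hM hτ₀ hτ₁ hΔ₀ hΔ₁ n H).trans (by gcongr)
    · exact (trajMinimax_chunkAlgs_le hK hreg hL' hM hτ₀ hτ₁ hΔ₀ hΔ₁ n H).trans (by gcongr)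
    · exact (trajMinimax_periodAlgs_le hK hreg hL' hM hτ₀ hτ₁ hΔ₀ hΔ₁ n H).trans (by gcongr)
    · have h1 : (2 : ℝ≥0∞) * (200 * τ.toNNReal : ℝ≥0) ≤ (1 : ℝ≥0) := by
        refine hconst _ (NNReal.coe_le_coe.1 ?_)
        push_cast
        rw [Real.coe_toNNReal _ hτ₀.le]
        linarith
      rw [ENNReal.coe_one] at h1
      exact ⟨(trajMinimax_chunkAlgs_le hK hreg hL' hM hτ₀ hτ₁ hΔ₀ hΔ₁ n H).trans
          (mul_le_of_le_one_left' h1),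
        (trajMinimax_periodAlgs_le hK hreg hL' hM hτ₀ hτ₁ hΔ₀ hΔ₁ n H).trans
          (mul_le_of_le_one_left' h1)⟩
  -- The risk of the deterministic policies has the constant `200 τ`, and the selection of the index
  -- doubles it. The potential of square roots costs the exponent `q = 3/4`.
  refine ⟨400, headsRate, 3 / 4, 1 / 400, fun L₀ M₀ => 6 + C * (1 + 2 * L₀ + M₀) + 5 * S,
    fun L₀ M₀ => C * (1 + 2 * L₀ + M₀), headsRate_pos, by norm_num, by norm_num, by norm_num,
    fun k _ => ⟨fun L₀ M₀ G D _ hreg L M hL hM τ Δ hτ₀ hτ₁ hΔ₀ hΔ₁ n H => ?_, fun s B =>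
      ⟨400 * (1 + B * (3 ^ ((s : ℝ) / k) : ℝ).toNNReal),
        fun L₀ M₀ G D _ hreg hrate L M hL hM τ Δ hτ₀ hτ₁ hΔ₀ hΔ₁ n H hn => ?_⟩⟩⟩
  · have h := main k L₀ M₀ G D hreg L M hL hM τ Δ hτ₀ hτ₁ hΔ₀ hΔ₁ n H
    simpa only [ENNReal.rpow_one, hq] using h
  · obtain ⟨h1, h2, h3, h4, -⟩ := main k L₀ M₀ G D hreg L M hL hM τ Δ hτ₀ hτ₁ hΔ₀ hΔ₁ n H
    have hr := regMinimax_ceil_le (by positivity) hrate hn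
    have hθ {θ : ℝ} (hθ₀ : 0 < θ) (hθ₁ : θ ≤ 1) := mul_add_rpow_le (C := 400)
      (e := ENNReal.ofReal (Real.exp (-(headsRate * n)))) le_self_add hr hθ₀ hθ₁
    have hone := hθ one_pos le_rfl
    have hquarter := hθ (θ := 1 / 4) (by norm_num) (by norm_num)
    rw [hq]
    rw [ENNReal.rpow_one (ENNReal.ofReal _)] at hone
    exact ⟨h1.trans hone, h2.trans hquarter, h3.trans hone, h4.trans hone⟩
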